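/- Let $n\ge 3$, let $M$ be a smooth $n$-manifold (Hausdorff, second countable, without boundary), let $n\le p\le\infty$, and let $g$ be a Riemannian metric on $M$ of class $C^0\cap W^{1,p}_{loc}(M)$. Let $\Sigma\subset M$ be a closed set such that $\mathcal H^{\,n-\frac p{p-1}}(\Sigma)<\infty$ if $p<\infty$, respectively $\mathcal H^{n-1}(\Sigma)=0$ if $p=\infty$ (Hausdorff measures of the Riemannian distance of $g$). Assume that $g$ is smooth on $M\setminus\Sigma$ with scalar curvature $R_g\ge 0$ there. Let $h$ be any smooth Riemannian metric on $M$, with Levi-Civita connection $\tilde\nabla$, Ricci tensor $\bar R_{ij}$ and Riemannian measure $\mu_h$. Let $\tilde\nabla g$ denote the weak covariant derivative of $g$, and put $$\Gamma_{ij}^k=\tfrac12 g^{kl}\big(\tilde\nabla_i g_{jl}+\tilde\nabla_j g_{il}-\tilde\nabla_l g_{ij}\big),\qquad V^k=g^{ij}\Gamma^k_{ij}-g^{ik}\Gamma^j_{ji},$$ $$F=g^{ij}\bar R_{ij}-\tilde\nabla_k g^{ij}\,\Gamma^k_{ij}+\tilde\nabla_k g^{ik}\,\Gamma^j_{ji}+g^{ij}\big(\Gamma^k_{kl}\Gamma^l_{ij}-\Gamma^k_{jl}\Gamma^l_{ik}\big).$$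 The scalar curvature distribution of $g$ is $$\langle R_g,u\rangle=\int_M\Big(-V\cdot\tilde\nabla\Big(u\,\frac{d\mu_g}{d\mu_h}\Big)+F\,u\,\frac{d\mu_g}{d\mu_h}\Big)\,d\mu_h ,$$ where $V\cdot\tilde\nabla f=V^k\tilde\nabla_k f$ and derivatives are taken in the weak sense. Then for every compactly supported $u\in W^{1,p/(p-1)}(M)$ (with $p/(p-1)=1$ if $p=\infty$) such that $u\ge 0$ almost everywhere, the function $u\,\frac{d\mu_g}{d\mu_h}$ is weakly differentiable, the integral converges absolutely, and $\langle R_g,u\rangle\ge 0$. -/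

import Mathlib

open Bundle Manifold MeasureTheory Set
open scoped Manifold ContDiff ENNReal Matrix

noncomputable section

namespace RoughMetric

/-! ## Coordinate expressions on `ℝⁿ` -/

/-- The model space `ℝⁿ` with its Euclidean norm. -/
abbrev Model (n : ℕ) : Type := EuclideanSpace ℝ (Fin n)

/-- The `i`-th coordinate vector of `ℝⁿ`. -/
def coordVec {n : ℕ} (i : Fin n) : Model n := EuclideanSpace.single i (1 : ℝ)

/-- The classical partial derivative `∂ₖ f` at `y`. -/
def pderiv {n : ℕ} (k : Fin n) (f : Model n → ℝ) (y : Model n) : ℝ :=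
  fderiv ℝ f y (coordVec k)

/-- The Christoffel symbol `Γᵏᵢⱼ = ½ Gᵏˡ (∂ᵢ Gⱼₗ + ∂ⱼ Gᵢₗ - ∂ₗ Gᵢⱼ)` of the coordinate metric `G`. -/
def coordChristoffel {n : ℕ} (G : Model n → Matrix (Fin n) (Fin n) ℝ) (k i j : Fin n)
    (y : Model n) : ℝ :=
  (1 / 2) * ∑ l, (G y)⁻¹ k l *
    (pderiv i (fun z => G z j l) y + pderiv j (fun z => G z i l) y - pderiv l (fun z => G z i j) y)

/-- The Ricci curvature
`Ricᵢⱼ = ∂ₖ Γᵏᵢⱼ - ∂ⱼ Γᵏᵢₖ + Γᵏₖₗ Γˡᵢⱼ - Γᵏⱼₗ Γˡᵢₖ` of the coordinate metric `G`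
(positive on round spheres). -/
def coordRicci {n : ℕ} (G : Model n → Matrix (Fin n) (Fin n) ℝ) (i j : Fin n)
    (y : Model n) : ℝ :=
  ∑ k, (pderiv k (coordChristoffel G k i j) y - pderiv j (coordChristoffel G k i k) y) +
  ∑ k, ∑ l, (coordChristoffel G k k l y * coordChristoffel G l i j y -
    coordChristoffel G k j l y * coordChristoffel G l i k y)

/-- `v` is the weak partial derivative `∂ₖ f` on the open set `Ω ⊆ ℝⁿ`. -/
def HasWeakPartial {n : ℕ} (Ω : Set (Model n)) (k : Fin n) (f v : Model n → ℝ) : Prop :=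
  LocallyIntegrableOn f Ω ∧ LocallyIntegrableOn v Ω ∧
    ∀ φ : Model n → ℝ, ContDiff ℝ ∞ φ → HasCompactSupport φ → tsupport φ ⊆ Ω →
      ∫ y in Ω, f y * pderiv k φ y = - ∫ y in Ω, v y * φ y

/-- `f ∈ Lᵖ_loc(Ω)`. -/
def MemLpLoc {n : ℕ} (p : ℝ≥0∞) (Ω : Set (Model n)) (f : Model n → ℝ) : Prop :=
  ∀ K : Set (Model n), IsCompact K → K ⊆ Ω → MemLp f p (volume.restrict K)

/-! ## Metrics and tensors on a manifold -/

section Manifold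

variable {n : ℕ} {M : Type*} [TopologicalSpace M] [ChartedSpace (Model n) M]

/-- Bilinear forms on the tangent spaces. -/
abbrev BilinField (n : ℕ) (M : Type*) [TopologicalSpace M] [ChartedSpace (Model n) M] : Type _ :=
  ∀ x : M, TangentSpace (𝓡 n) x →L[ℝ] TangentSpace (𝓡 n) x →L[ℝ] ℝ

/-- Trilinear forms on the tangent spaces. -/
abbrev TrilinField (n : ℕ) (M : Type*) [TopologicalSpace M] [ChartedSpace (Model n) M] : Type _ :=
  ∀ x : M, TangentSpace (𝓡 n) x →L[ℝ] TangentSpace (𝓡 n) x →L[ℝ]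
    TangentSpace (𝓡 n) x →L[ℝ] ℝ

/-- One-forms. -/
abbrev OneForm (n : ℕ) (M : Type*) [TopologicalSpace M] [ChartedSpace (Model n) M] : Type _ :=
  ∀ x : M, TangentSpace (𝓡 n) x →L[ℝ] ℝ

/-- Continuous (`C⁰`) Riemannian metrics on `M`. -/
abbrev ContMetric (n : ℕ) (M : Type*) [TopologicalSpace M] [ChartedSpace (Model n) M]
    [IsManifold (𝓡 n) ∞ M] : Type _ :=
  ContinuousRiemannianMetric (Model n) (fun x : M => TangentSpace (𝓡 n) x)

/-- Smooth Riemannian metrics on `M`. -/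
abbrev SmoothMetric (n : ℕ) (M : Type*) [TopologicalSpace M] [ChartedSpace (Model n) M]
    [IsManifold (𝓡 n) ∞ M] : Type _ :=
  ContMDiffRiemannianMetric (𝓡 n) ∞ (Model n) (fun x : M => TangentSpace (𝓡 n) x)

/-- The coordinate vector field `∂ᵢ` of the chart `e`, at the point with coordinates `y`. -/
def chartFrame (e : OpenPartialHomeomorph M (Model n)) (y : Model n) (i : Fin n) :
    TangentSpace (𝓡 n) (e.symm y) :=
  letI : ChartedSpace (Model n) (Model n) := chartedSpaceSelf (Model n)
  mfderiv (𝓡 n) (𝓡 n) e.symm y (coordVec i : Model n)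

/-- The coordinate matrix `Bᵢⱼ` of a bilinear form in the chart `e`. -/
def chartMatrix (B : BilinField n M) (e : OpenPartialHomeomorph M (Model n)) (y : Model n) :
    Matrix (Fin n) (Fin n) ℝ :=
  Matrix.of fun i j => B (e.symm y) (chartFrame e y i) (chartFrame e y j)

/-- The matrix `Bᵢⱼ` of a bilinear form at `x`, in the coordinate frame at `x` of the preferred
chart at `x` (in Mathlib this frame is the standard basis of `TangentSpace (𝓡 n) x = ℝⁿ`). -/
def matrixAt (B : BilinField n M) (x : M) : Matrix (Fin n) (Fin n) ℝ :=
  Matrix.of fun i j => B x (coordVec i : Model n) (coordVec j : Model n)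

/-- The Ricci curvature of a metric at `x`, in the coordinate frame of the preferred chart at `x`
(meaningful where the metric is twice differentiable). -/
def ricciAt (B : BilinField n M) (x : M) (i j : Fin n) : ℝ :=
  coordRicci (chartMatrix B (chartAt (Model n) x)) i j (chartAt (Model n) x x)

/-- The classical scalar curvature `R = gⁱʲ Ricᵢⱼ` of a metric at `x`
(meaningful where the metric is twice differentiable). -/
def scalarCurvature (B : BilinField n M) (x : M) : ℝ :=
  ∑ i, ∑ j, (matrixAt B x)⁻¹ i j * ricciAt B x i j

/-! ## The Riemannian measure and the Hausdorff measure -/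

/-- The measure `√(det hᵢⱼ) dy` of the chart domain of `e`, as a measure on `M`. -/
def chartVolume [MeasurableSpace M] (B : BilinField n M)
    (e : OpenPartialHomeomorph M (Model n)) : Measure M :=
  ((volume.restrict e.target).withDensity
    (fun y => ENNReal.ofReal (Real.sqrt (chartMatrix B e y).det))).map e.symm

/-- The Riemannian measure: the least measure that dominates `√(det hᵢⱼ) dy` on every chart domain.
As these measures agree on overlaps, it restricts to each of them. -/
def riemannianMeasure [MeasurableSpace M] (B : BilinField n M) : Measure M :=
  ⨆ e ∈ atlas (Model n) M, chartVolume B e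

/-- The `d`-dimensional Hausdorff measure of the Riemannian distance (the infimum of the lengths of
`C¹` curves) of the continuous metric `g`. -/
def hausdorffMeasure [IsManifold (𝓡 n) ∞ M] [T2Space M] [MeasurableSpace M] [BorelSpace M]
    (g : ContMetric n M) (d : ℝ) : Measure M :=
  letI : RiemannianBundle (fun x : M => TangentSpace (𝓡 n) x) := ⟨g.toRiemannianMetric⟩
  haveI : LocallyCompactSpace M := ChartedSpace.locallyCompactSpace (Model n) M
  haveI : IsManifold (𝓡 n) 1 M := IsManifold.of_le (n := ∞) (by norm_num)
  letI : EMetricSpace M := EMetricSpace.ofRiemannianMetric (𝓡 n) M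
  Measure.hausdorffMeasure d

/-! ## Weak derivatives and Sobolev spaces -/

/-- `w` is the weak differential of the function `u : M → ℝ`: in every chart its components are
the weak partial derivatives of `u`. -/
def HasWeakDifferential (u : M → ℝ) (w : OneForm n M) : Prop :=
  ∀ e ∈ atlas (Model n) M, ∀ k : Fin n,
    HasWeakPartial e.target k (fun y => u (e.symm y)) (fun y => w (e.symm y) (chartFrame e y k))

open Classical in
/-- The weak differential of `u` (unique up to null sets; `0` if there is none). -/
def weakDifferential (u : M → ℝ) : OneForm n M :=
  if H : ∃ w : OneForm n M, HasWeakDifferential u w then H.choose else fun _ => 0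

/-- `u ∈ W^{1,q}_loc(M)`. For compactly supported `u` this is the same as `u ∈ W^{1,q}(M)`. -/
def MemSobolevLoc (n : ℕ) {M : Type*} [TopologicalSpace M] [ChartedSpace (Model n) M]
    (q : ℝ≥0∞) (u : M → ℝ) : Prop :=
  ∃ w : OneForm n M, HasWeakDifferential u w ∧ ∀ e ∈ atlas (Model n) M,
    MemLpLoc q e.target (fun y => u (e.symm y)) ∧
    ∀ k : Fin n, MemLpLoc q e.target (fun y => w (e.symm y) (chartFrame e y k))

variable [IsManifold (𝓡 n) ∞ M]

/-- `T = ∇̄g` weakly, `∇̄` being the Levi-Civita connection of the smooth metric `h`: in every chart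
the weak partial derivatives of the components of `g` are
`∂ₖ gᵢⱼ = Tₖᵢⱼ + Γ̄ˡₖᵢ gₗⱼ + Γ̄ˡₖⱼ gᵢₗ`. -/
def HasWeakCovDeriv (h : SmoothMetric n M) (g : ContMetric n M) (T : TrilinField n M) : Prop :=
  ∀ e ∈ atlas (Model n) M, ∀ k i j : Fin n,
    HasWeakPartial e.target k (fun y => chartMatrix g.inner e y i j)
      (fun y => T (e.symm y) (chartFrame e y k) (chartFrame e y i) (chartFrame e y j) +
        ∑ l, (coordChristoffel (chartMatrix h.inner e) l k i y * chartMatrix g.inner e y l j +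
          coordChristoffel (chartMatrix h.inner e) l k j y * chartMatrix g.inner e y i l))

/-- The weak covariant derivative `∇̄g` (unique up to null sets; `0` if there is none). -/
def weakCovDeriv (h : SmoothMetric n M) (g : ContMetric n M) : TrilinField n M :=
  letI : Decidable (∃ T : TrilinField n M, HasWeakCovDeriv h g T) := Classical.propDecidable _
  if H : ∃ T : TrilinField n M, HasWeakCovDeriv h g T then H.choose else fun _ => 0

/-- The continuous metric `g` is in `W^{1,p}_loc(M)`: it has a weak covariant derivative with
respect to `h`, with components in `Lᵖ_loc`. (This does not depend on `h`.) -/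
def MetricMemSobolevLoc (h : SmoothMetric n M) (p : ℝ≥0∞) (g : ContMetric n M) : Prop :=
  ∃ T : TrilinField n M, HasWeakCovDeriv h g T ∧ ∀ e ∈ atlas (Model n) M, ∀ k i j : Fin n,
    MemLpLoc p e.target
      (fun y => T (e.symm y) (chartFrame e y k) (chartFrame e y i) (chartFrame e y j))

/-- The metric `g` is smooth on the set `U`. -/
def SmoothMetricOn (g : ContMetric n M) (U : Set M) : Prop :=
  ContMDiffOn (𝓡 n) ((𝓡 n).prod 𝓘(ℝ, Model n →L[ℝ] Model n →L[ℝ] ℝ)) ∞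
    (fun x : M => TotalSpace.mk' (Model n →L[ℝ] Model n →L[ℝ] ℝ)
      (E := fun x : M => TangentSpace (𝓡 n) x →L[ℝ] TangentSpace (𝓡 n) x →L[ℝ] ℝ)
      x (g.inner x)) U

/-! ## The scalar curvature distribution

All components at `x` are taken in the coordinate frame of the preferred chart at `x`. -/

variable (h : SmoothMetric n M) (g : ContMetric n M)

/-- `∇̄ₖ gᵢⱼ`. -/
def covDerivMetric (x : M) (k i j : Fin n) : ℝ :=
  weakCovDeriv h g x (coordVec k : Model n) (coordVec i : Model n) (coordVec j : Model n)

/-- `∇̄ₖ gⁱʲ = - gⁱᵃ gʲᵇ ∇̄ₖ gₐᵦ`. -/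
def covDerivInverse (x : M) (k i j : Fin n) : ℝ :=
  - ∑ a, ∑ b, (matrixAt g.inner x)⁻¹ i a * (matrixAt g.inner x)⁻¹ j b * covDerivMetric h g x k a b

/-- `Γᵏᵢⱼ = ½ gᵏˡ (∇̄ᵢ gⱼₗ + ∇̄ⱼ gᵢₗ - ∇̄ₗ gᵢⱼ)`. -/
def relChristoffel (x : M) (k i j : Fin n) : ℝ :=
  (1 / 2) * ∑ l, (matrixAt g.inner x)⁻¹ k l *
    (covDerivMetric h g x i j l + covDerivMetric h g x j i l - covDerivMetric h g x l i j)

/-- `Vᵏ = gⁱʲ Γᵏᵢⱼ - gⁱᵏ Γʲⱼᵢ`. -/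
def vectorV (x : M) (k : Fin n) : ℝ :=
  ∑ i, ∑ j, ((matrixAt g.inner x)⁻¹ i j * relChristoffel h g x k i j -
    (matrixAt g.inner x)⁻¹ i k * relChristoffel h g x j j i)

/-- `F = gⁱʲ R̄ᵢⱼ - ∇̄ₖ gⁱʲ Γᵏᵢⱼ + ∇̄ₖ gⁱᵏ Γʲⱼᵢ + gⁱʲ (Γᵏₖₗ Γˡᵢⱼ - Γᵏⱼₗ Γˡᵢₖ)`, where `R̄ᵢⱼ` is the Ricci
curvature of `h`. -/
def scalarF (x : M) : ℝ :=
  (∑ i, ∑ j, (matrixAt g.inner x)⁻¹ i j * ricciAt h.inner x i j) -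
  (∑ k, ∑ i, ∑ j, covDerivInverse h g x k i j * relChristoffel h g x k i j) +
  (∑ k, ∑ i, ∑ j, covDerivInverse h g x k i k * relChristoffel h g x j j i) +
  ∑ i, ∑ j, (matrixAt g.inner x)⁻¹ i j * ∑ k, ∑ l,
    (relChristoffel h g x k k l * relChristoffel h g x l i j -
      relChristoffel h g x k j l * relChristoffel h g x l i k)

/-- The density `dμ_g / dμ_h`. -/
def volumeRatio (x : M) : ℝ :=
  Real.sqrt (matrixAt g.inner x).det / Real.sqrt (matrixAt h.inner x).det

/-- The integrand `- V · ∇̄(u dμ_g/dμ_h) + F u dμ_g/dμ_h`. -/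
def curvatureIntegrand (u : M → ℝ) (x : M) : ℝ :=
  - (∑ k, vectorV h g x k *
      weakDifferential (fun z => u z * volumeRatio h g z) x (coordVec k : Model n)) +
    scalarF h g x * (u x * volumeRatio h g x)

/-- The scalar curvature distribution `⟨R_g, u⟩`, computed with the background metric `h`. -/
def scalarCurvatureDistribution [MeasurableSpace M] (u : M → ℝ) : ℝ :=
  ∫ x, curvatureIntegrand h g u x ∂(riemannianMeasure h.inner)

/-- The pairing `⟨R_g, u⟩` is well defined: the product `u dμ_g/dμ_h` is weakly differentiable and
the integral converges absolutely. -/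
def PairingDefined [MeasurableSpace M] (u : M → ℝ) : Prop :=
  (∃ w : OneForm n M, HasWeakDifferential (fun z => u z * volumeRatio h g z) w) ∧
    Integrable (curvatureIntegrand h g u) (riemannianMeasure h.inner)

end Manifold

end RoughMetric

end

/-! Put q = p/(p-1). In a chart the pairing is a first-order form ∫ (∑ aₖ ∂ₖu + b u) dy, where aₖ =
-√(det g) Vᵏ (`chartA`) and b collects F and the derivative of the density (`chartB`). Since V is
linear and F quadratic in ∇̄g, up to continuous coefficients and a continuous term from the
curvature of h, aₖ lies in Lᵖ_loc and b in L^{p/2}_loc. Positivity of this form is proved for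
successively larger classes of u.

Off Σ the metric is smooth and the classical identity div V + F = R holds, the divergence being that
of h (`scalar_identity`, `div_add_scalar`). For a test function φ ≥ 0 supported there the form
differs from the integral of R φ against μ_g only by the integral of a compactly supported
divergence, so it is nonnegative (`chart_test_nonneg`).

To cross Σ (`pairing_test_nonneg_of_off`), the form is tested with ηφ, where η vanishes near Σ and
equals 1 away from it. Such η come from coverings by balls: a ball of radius r contributes about
r^{n-q} to ‖∇η‖_q^q, so this norm is controlled by the (n-q)-dimensional Hausdorff measure
(`exists_capacity_cutoff`). The only new term is ∫ φ a·∇η, bounded by the Lᵖ norm of φa near Σ times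
‖∇η‖_q. If p < ∞ the second factor is bounded and the first tends to 0, because Σ is Lebesgue null.
If p = ∞ the first is bounded and the second tends to 0, because the Hausdorff measure vanishes.

To reach u ∈ W^{1,q} (`pairing_nonneg_of_test`), u is mollified. The gradient term passes to the
limit by the duality of Lᵖ and L^q. The term b u needs u ∈ Lˢ with 1/s = 1 - 2/p, and the Sobolev
embedding gives this because 1/q - 1/n ≤ 1 - 2/p is the condition p ≥ n; the bound n ≥ 3 keeps s
finite (`exists_holder_exponents`). Mollification also yields the product and chain rules behind the
weak differentiability of u dμ_g/dμ_h (`HasWeakPartial.mul`, `HasWeakPartial.comp`).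

On the manifold, components at x refer to the preferred chart at x, which varies with x. To read the
integrand in one fixed chart (`curvatureIntegrand_chart`) one needs that the contractions are
invariant (`sum_tV_act`, `tF_act`) and that Ricci is a tensor (`IsPullback.coordRicci_eq`). Charts
are locally Lipschitz for the distance of g, which carries the Hausdorff hypothesis to ℝⁿ
(`exists_hausdorffMeasure_chart_image_le`), and a smooth partition of unity adds up the local
results (`integral_curvatureIntegrand_nonneg_of_local`). -/

noncomputable section

namespace RoughMetric

open Filter Topology

/-! ## Weak partial derivatives on open subsets of `ℝⁿ` -/

section Weak

variable {n : ℕ} {Ω Ω' : Set (Model n)} {k : Fin n} {f f' v v' : Model n → ℝ}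

lemma contDiff_pderiv (hf : ContDiff ℝ ∞ f) (k : Fin n) : ContDiff ℝ ∞ (pderiv k f) :=
  (hf.fderiv_right (m := ∞) (by simp)).clm_apply contDiff_const

lemma continuous_pderiv (hf : ContDiff ℝ 1 f) (k : Fin n) : Continuous (pderiv k f) :=
  (hf.continuous_fderiv one_ne_zero).clm_apply continuous_const

lemma tsupport_pderiv_subset (k : Fin n) (f : Model n → ℝ) :
    tsupport (pderiv k f) ⊆ tsupport f := by
  refine (closure_mono fun x hx => ?_).trans (tsupport_fderiv_subset ℝ (f := f))
  rw [Function.mem_support] at hx ⊢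
  intro h
  exact hx (by simp [pderiv, h])

lemma _root_.HasCompactSupport.pderiv (hf : HasCompactSupport f) (k : Fin n) :
    HasCompactSupport (pderiv k f) :=
  hf.of_isClosed_subset (isClosed_tsupport _) (tsupport_pderiv_subset k f)

lemma pderiv_mul {y : Model n} (hf : DifferentiableAt ℝ f y) (hg : DifferentiableAt ℝ f' y)
    (k : Fin n) :
    pderiv k (fun z => f z * f' z) y = f y * pderiv k f' y + pderiv k f y * f' y := by
  simp only [pderiv, fderiv_fun_mul hf hg]
  simp [mul_comm]

lemma pderiv_add {y : Model n} (hf : DifferentiableAt ℝ f y) (hg : DifferentiableAt ℝ f' y)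
    (k : Fin n) :
    pderiv k (fun z => f z + f' z) y = pderiv k f y + pderiv k f' y := by
  simp [pderiv, fderiv_fun_add hf hg]

lemma pderiv_sub {y : Model n} (hf : DifferentiableAt ℝ f y) (hg : DifferentiableAt ℝ f' y)
    (k : Fin n) :
    pderiv k (fun z => f z - f' z) y = pderiv k f y - pderiv k f' y := by
  simp [pderiv, fderiv_fun_sub hf hg]

lemma pderiv_sum {ι : Type*} (s : Finset ι) {F : ι → Model n → ℝ} {y : Model n}
    (hf : ∀ i ∈ s, DifferentiableAt ℝ (F i) y) (k : Fin n) :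
    pderiv k (fun z => ∑ i ∈ s, F i z) y = ∑ i ∈ s, pderiv k (F i) y := by
  simp only [pderiv]
  rw [fderiv_fun_sum hf]
  simp

lemma pderiv_congr {y : Model n} (h : f =ᶠ[𝓝 y] f') (k : Fin n) : pderiv k f y = pderiv k f' y := by
  simp [pderiv, h.fderiv_eq]

/-- The integral of a partial derivative of a compactly supported `C¹` function vanishes. -/
lemma integral_pderiv_eq_zero (hf : ContDiff ℝ 1 f) (hc : HasCompactSupport f) (k : Fin n) :
    ∫ y, pderiv k f y = 0 := by
  have h := integral_mul_fderiv_eq_neg_fderiv_mul_of_integrable (μ := (volume : Measure (Model n)))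
    (f := fun _ : Model n => (1 : ℝ)) (g := f) (v := coordVec k) (by simp) ?_ ?_
    (fun x _ => differentiableAt_const _) (fun x _ => hf.differentiable one_ne_zero x)
  · simpa [pderiv] using h
  · have := (continuous_pderiv hf k).integrable_of_hasCompactSupport (μ := volume) (hc.pderiv k)
    simp only [one_mul]
    exact this
  · simpa using hf.continuous.integrable_of_hasCompactSupport hc

lemma setIntegral_eq_of_support {F : Model n → ℝ} (h : Function.support F ⊆ Ω) :
    ∫ y in Ω, F y = ∫ y, F y :=
  setIntegral_eq_integral_of_forall_compl_eq_zero fun x hx => by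
    by_contra h'
    exact hx (h h')

lemma integrable_mul_of_locallyIntegrableOn {φ : Model n → ℝ}
    (hf : LocallyIntegrableOn f Ω)
    (hφ : Continuous φ) (hc : HasCompactSupport φ) (hs : tsupport φ ⊆ Ω) :
    Integrable (fun y => f y * φ y) := by
  have h1 : IntegrableOn f (tsupport φ) := hf.integrableOn_compact_subset hs hc
  have h2 : IntegrableOn (fun y => f y * φ y) (tsupport φ) :=
    h1.mul_continuousOn hφ.continuousOn hc
  rw [← integrableOn_iff_integrable_of_support_subset (s := tsupport φ)]
  · exact h2
  · intro x hx
    exact subset_tsupport _ (right_ne_zero_of_mul hx)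

lemma HasWeakPartial.integral_eq (h : HasWeakPartial Ω k f v) {φ : Model n → ℝ}
    (hφ : ContDiff ℝ ∞ φ) (hc : HasCompactSupport φ) (hs : tsupport φ ⊆ Ω) :
    ∫ y, f y * pderiv k φ y = - ∫ y, v y * φ y := by
  have := h.2.2 φ hφ hc hs
  rwa [setIntegral_eq_of_support, setIntegral_eq_of_support] at this
  · intro x hx
    exact hs (subset_tsupport _ (right_ne_zero_of_mul hx))
  · intro x hx
    exact hs (tsupport_pderiv_subset k φ (subset_tsupport _ (right_ne_zero_of_mul hx)))

lemma hasWeakPartial_of_integral_eq (h1 : LocallyIntegrableOn f Ω) (h2 : LocallyIntegrableOn v Ω)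
    (h : ∀ φ : Model n → ℝ, ContDiff ℝ ∞ φ → HasCompactSupport φ → tsupport φ ⊆ Ω →
      ∫ y, f y * pderiv k φ y = - ∫ y, v y * φ y) : HasWeakPartial Ω k f v := by
  refine ⟨h1, h2, fun φ hφ hc hs => ?_⟩
  rw [setIntegral_eq_of_support, setIntegral_eq_of_support]
  · exact h φ hφ hc hs
  · intro x hx
    exact hs (subset_tsupport _ (right_ne_zero_of_mul hx))
  · intro x hx
    exact hs (tsupport_pderiv_subset k φ (subset_tsupport _ (right_ne_zero_of_mul hx)))

lemma HasWeakPartial.mono (h : HasWeakPartial Ω k f v) (hs : Ω' ⊆ Ω) :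
    HasWeakPartial Ω' k f v :=
  hasWeakPartial_of_integral_eq (h.1.mono_set hs) (h.2.1.mono_set hs)
    fun _ hφ hc h' => h.integral_eq hφ hc (h'.trans hs)

lemma _root_.MeasureTheory.LocallyIntegrableOn.congr_ae (h : LocallyIntegrableOn f Ω)
    (he : ∀ᵐ y ∂volume.restrict Ω, f y = f' y) : LocallyIntegrableOn f' Ω := by
  intro x hx
  obtain ⟨s, hs, hi⟩ := h x hx
  refine ⟨s ∩ Ω, inter_mem hs self_mem_nhdsWithin, (hi.mono_set inter_subset_left).congr_fun_ae ?_⟩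
  exact ae_restrict_of_ae_restrict_of_subset inter_subset_right he

lemma HasWeakPartial.congr_ae (h : HasWeakPartial Ω k f v)
    (hf : ∀ᵐ y ∂volume.restrict Ω, f y = f' y) (hv : ∀ᵐ y ∂volume.restrict Ω, v y = v' y) :
    HasWeakPartial Ω k f' v' := by
  refine ⟨h.1.congr_ae hf, h.2.1.congr_ae hv, fun φ hφ hc hs => ?_⟩
  have h1 : ∫ y in Ω, f' y * pderiv k φ y = ∫ y in Ω, f y * pderiv k φ y :=
    integral_congr_ae (hf.mono fun y hy => by simp [hy])
  have h2 : ∫ y in Ω, v' y * φ y = ∫ y in Ω, v y * φ y :=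
    integral_congr_ae (hv.mono fun y hy => by simp [hy])
  rw [h1, h2]
  exact h.2.2 φ hφ hc hs

/-- Weak partial derivatives are unique up to null sets. -/
lemma HasWeakPartial.ae_eq (hΩ : IsOpen Ω) (h : HasWeakPartial Ω k f v)
    (h' : HasWeakPartial Ω k f v') : ∀ᵐ y ∂volume.restrict Ω, v y = v' y := by
  rw [ae_restrict_iff' hΩ.measurableSet]
  have hl : LocallyIntegrableOn (fun y => v y - v' y) Ω := h.2.1.sub h'.2.1
  suffices H : ∀ φ : Model n → ℝ, ContDiff ℝ ∞ φ → HasCompactSupport φ → tsupport φ ⊆ Ω →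
      ∫ y, φ y • (v y - v' y) = 0 by
    filter_upwards [hΩ.ae_eq_zero_of_integral_contDiff_smul_eq_zero hl H] with y hy hyΩ
    linarith [hy hyΩ]
  intro φ hφ hc hs
  have h1 := h.integral_eq hφ hc hs
  have h2 := h'.integral_eq hφ hc hs
  have i1 := integrable_mul_of_locallyIntegrableOn h.2.1 hφ.continuous hc hs
  have i2 := integrable_mul_of_locallyIntegrableOn h'.2.1 hφ.continuous hc hs
  calc ∫ y, φ y • (v y - v' y) = ∫ y, (v y * φ y - v' y * φ y) := by
        congr 1; ext y; simp only [smul_eq_mul]; ring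
    _ = 0 := by rw [integral_sub i1 i2]; linarith

/-- A classical partial derivative is a weak one. -/
lemma hasWeakPartial_of_contDiffOn (hΩ : IsOpen Ω) (hf : ContDiffOn ℝ 1 f Ω) (k : Fin n) :
    HasWeakPartial Ω k f (pderiv k f) := by
  have hd : ContinuousOn (pderiv k f) Ω :=
    (hf.continuousOn_fderiv_of_isOpen hΩ le_rfl).clm_apply continuousOn_const
  have l1 := hf.continuousOn.locallyIntegrableOn (μ := volume) hΩ.measurableSet
  have l2 := hd.locallyIntegrableOn (μ := volume) hΩ.measurableSet
  refine hasWeakPartial_of_integral_eq l1 l2 fun φ hφ hc hs => ?_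
  have hφ1 : ContDiff ℝ 1 φ := hφ.of_le (by simp)
  -- Although f is regular only on Ω, the product is globally C¹: near a point outside the support
  -- of φ it vanishes identically. Its partial derivative therefore integrates to 0.
  have hprod : ContDiff ℝ 1 (fun y => f y * φ y) := by
    rw [contDiff_iff_contDiffAt]
    intro y
    by_cases hy : y ∈ tsupport φ
    · exact (hf.contDiffAt (hΩ.mem_nhds (hs hy))).mul hφ1.contDiffAt
    · have : (fun y => f y * φ y) =ᶠ[𝓝 y] fun _ => 0 := by
        filter_upwards [(isClosed_tsupport φ).isOpen_compl.mem_nhds hy] with z hz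
        simp [image_eq_zero_of_notMem_tsupport hz]
      exact contDiffAt_const.congr_of_eventuallyEq this
  have h0 := integral_pderiv_eq_zero hprod (hc.mul_left (f := f)) k
  have hpt : ∀ y, pderiv k (fun y => f y * φ y) y = f y * pderiv k φ y + pderiv k f y * φ y := by
    intro y
    by_cases hy : y ∈ tsupport φ
    · exact pderiv_mul ((hf.contDiffAt (hΩ.mem_nhds (hs hy))).differentiableAt one_ne_zero)
        (hφ1.differentiable one_ne_zero y) k
    · have h1 : y ∉ tsupport (pderiv k φ) := fun h => hy (tsupport_pderiv_subset k φ h)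
      have h2 : y ∉ tsupport (pderiv k (fun y => f y * φ y)) := fun h =>
        hy (tsupport_mul_subset_right (tsupport_pderiv_subset k _ h))
      rw [image_eq_zero_of_notMem_tsupport h2, image_eq_zero_of_notMem_tsupport h1,
        image_eq_zero_of_notMem_tsupport hy]
      simp
  simp_rw [hpt] at h0
  rw [integral_add] at h0
  · linarith
  · exact integrable_mul_of_locallyIntegrableOn l1 (continuous_pderiv hφ1 k) (hc.pderiv k)
      ((tsupport_pderiv_subset k φ).trans hs)
  · exact integrable_mul_of_locallyIntegrableOn l2 hφ.continuous hc hs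

lemma locallyIntegrable_mul_of_tsupport {χ : Model n → ℝ}
    (hf : LocallyIntegrableOn f Ω)
    (hχ : Continuous χ) (hc : HasCompactSupport χ) (hs : tsupport χ ⊆ Ω) :
    LocallyIntegrable (fun y => χ y * f y) := by
  have := (integrable_mul_of_locallyIntegrableOn hf hχ hc hs).locallyIntegrable
  simpa only [mul_comm] using this

/-- Cutting off a weakly differentiable function makes it globally weakly differentiable. -/
lemma HasWeakPartial.cutoff (h : HasWeakPartial Ω k f v) {χ : Model n → ℝ}
    (hχ : ContDiff ℝ ∞ χ) (hc : HasCompactSupport χ) (hs : tsupport χ ⊆ Ω) :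
    HasWeakPartial univ k (fun y => χ y * f y) (fun y => χ y * v y + pderiv k χ y * f y) := by
  have l1 := locallyIntegrable_mul_of_tsupport h.1 hχ.continuous hc hs
  have l2 := locallyIntegrable_mul_of_tsupport h.2.1 hχ.continuous hc hs
  have l3 := locallyIntegrable_mul_of_tsupport h.1
    (continuous_pderiv (hχ.of_le (by simp)) k) (hc.pderiv k)
    ((tsupport_pderiv_subset k χ).trans hs)
  refine hasWeakPartial_of_integral_eq (l1.locallyIntegrableOn _) ((l2.add l3).locallyIntegrableOn _)
    fun φ hφ hcφ _ => ?_
  have hs' : tsupport (fun y => χ y * φ y) ⊆ Ω := tsupport_mul_subset_left.trans hs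
  have h1 := h.integral_eq (φ := fun y => χ y * φ y) (hχ.mul hφ) hc.mul_right hs'
  have hpt : ∀ y, pderiv k (fun y => χ y * φ y) y = χ y * pderiv k φ y + pderiv k χ y * φ y :=
    fun y => pderiv_mul (hχ.differentiable (by simp) y) (hφ.differentiable (by simp) y) k
  simp_rw [hpt, mul_add] at h1
  have i1 : Integrable (fun y => f y * (χ y * pderiv k φ y)) :=
    integrable_mul_of_locallyIntegrableOn h.1
      (hχ.continuous.mul (contDiff_pderiv hφ k).continuous) hc.mul_right
      (tsupport_mul_subset_left.trans hs)
  have i2 : Integrable (fun y => f y * (pderiv k χ y * φ y)) :=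
    integrable_mul_of_locallyIntegrableOn h.1
      ((contDiff_pderiv hχ k).continuous.mul hφ.continuous) (hc.pderiv k).mul_right
      (tsupport_mul_subset_left.trans ((tsupport_pderiv_subset k χ).trans hs))
  have i3 : Integrable (fun y => v y * (χ y * φ y)) :=
    integrable_mul_of_locallyIntegrableOn h.2.1
      (hχ.continuous.mul hφ.continuous) hc.mul_right hs'
  rw [integral_add i1 i2] at h1
  calc ∫ y, χ y * f y * pderiv k φ y = ∫ y, f y * (χ y * pderiv k φ y) := by
        congr 1; ext y; ring
    _ = -(∫ y, v y * (χ y * φ y)) - ∫ y, f y * (pderiv k χ y * φ y) := by linarith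
    _ = -∫ y, (v y * (χ y * φ y) + f y * (pderiv k χ y * φ y)) := by
        rw [integral_add i3 i2]; ring
    _ = _ := by congr 2; ext y; ring

end Weak


/-! ## Mollification -/

section Mollification

variable {n : ℕ}

/-- A smooth bump function supported in the ball of radius `1 / (j + 1)`. -/
def bump (n j : ℕ) : ContDiffBump (0 : Model n) where
  -- The fixed ratio of outer to inner radius, here 2, is what almost everywhere convergence of the
  -- mollifications requires later.
  rIn := 1 / (2 * (j + 1))
  rOut := 1 / (j + 1)
  rIn_pos := by positivity
  rIn_lt_rOut := by
    apply one_div_lt_one_div_of_lt <;> linarith [(Nat.cast_nonneg j : (0 : ℝ) ≤ j)]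

/-- The mollification of `f` at scale `1 / (j + 1)`. -/
def moll (j : ℕ) (f : Model n → ℝ) : Model n → ℝ :=
  convolution ((bump n j).normed volume) f (ContinuousLinearMap.lsmul ℝ ℝ) volume

lemma tendsto_bump_rOut (n : ℕ) : Tendsto (fun j => (bump n j).rOut) atTop (𝓝 0) :=
  tendsto_one_div_add_atTop_nhds_zero_nat

lemma moll_apply (j : ℕ) (f : Model n → ℝ) (x : Model n) :
    moll j f x = ∫ t, (bump n j).normed volume t * f (x - t) := rfl

lemma moll_apply' (j : ℕ) (f : Model n → ℝ) (x : Model n) :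
    moll j f x = ∫ t, (bump n j).normed volume (x - t) * f t :=
  convolution_eq_swap _

lemma moll_congr_ae {f g : Model n → ℝ} (h : f =ᵐ[volume] g) (j : ℕ) : moll j f = moll j g :=
  convolution_congr _ (ae_eq_refl _) h

variable {f g : Model n → ℝ}

lemma contDiff_moll (hf : LocallyIntegrable f) (j : ℕ) : ContDiff ℝ ∞ (moll j f) :=
  (bump n j).hasCompactSupport_normed.contDiff_convolution_left _ (bump n j).contDiff_normed hf

lemma convolutionExists_moll (hf : LocallyIntegrable f) (j : ℕ) :
    ConvolutionExists ((bump n j).normed volume) f (ContinuousLinearMap.lsmul ℝ ℝ) volume :=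
  (bump n j).hasCompactSupport_normed.convolutionExists_left _ (bump n j).continuous_normed hf

lemma moll_sub (hf : LocallyIntegrable f) (hg : LocallyIntegrable g) (j : ℕ) (x : Model n) :
    moll j (fun y => f y - g y) x = moll j f x - moll j g x := by
  have h1 : Integrable (fun t => (bump n j).normed volume t * f (x - t)) :=
    convolutionExists_moll hf j x
  have h2 : Integrable (fun t => (bump n j).normed volume t * g (x - t)) :=
    convolutionExists_moll hg j x
  rw [moll_apply, moll_apply, moll_apply, ← integral_sub h1 h2]
  congr 1; ext t; ring

lemma moll_nonneg (hf : ∀ᵐ y, 0 ≤ f y) (j : ℕ) (x : Model n) : 0 ≤ moll j f x := by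
  rw [moll_apply']
  exact integral_nonneg_of_ae (hf.mono fun y hy => mul_nonneg ((bump n j).nonneg_normed _) hy)

lemma support_moll_subset (j : ℕ) (f : Model n → ℝ) :
    Function.support (moll j f) ⊆ Metric.cthickening (1 / (j + 1)) (tsupport f) := by
  refine (support_convolution_subset (ContinuousLinearMap.lsmul ℝ ℝ)).trans ?_
  rintro _ ⟨a, ha, b, hb, rfl⟩
  rw [(bump n j).support_normed_eq] at ha
  refine Metric.mem_cthickening_of_dist_le _ b _ _ (subset_tsupport f hb) ?_
  have : ‖a‖ < 1 / (j + 1) := by simpa [bump] using ha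
  simpa [dist_eq_norm] using this.le

lemma tsupport_moll_subset (j : ℕ) (f : Model n → ℝ) :
    tsupport (moll j f) ⊆ Metric.cthickening (1 / (j + 1)) (tsupport f) :=
  closure_minimal (support_moll_subset j f) Metric.isClosed_cthickening

/-- Mollification commutes with weak partial derivatives. -/
lemma pderiv_moll {k : Fin n} {v : Model n → ℝ} (h : HasWeakPartial univ k f v) (j : ℕ)
    (x : Model n) : pderiv k (moll j f) x = moll j v x := by
  set ρ : Model n → ℝ := (bump n j).normed volume with hρ
  have hc : HasCompactSupport ρ := (bump n j).hasCompactSupport_normed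
  have hs : ContDiff ℝ ∞ ρ := (bump n j).contDiff_normed
  have hd := hc.hasFDerivAt_convolution_left (ContinuousLinearMap.lsmul ℝ ℝ) (hs.of_le (by simp))
    (locallyIntegrableOn_univ.1 h.1) x (μ := volume)
  have h1 : pderiv k (moll j f) x = ∫ t, pderiv k ρ (x - t) * f t := by
    rw [pderiv, moll, hd.fderiv, convolution_eq_swap, ContinuousLinearMap.integral_apply]
    · rfl
    · have := (hc.fderiv ℝ).convolutionExists_left
        ((ContinuousLinearMap.lsmul ℝ ℝ : ℝ →L[ℝ] ℝ →L[ℝ] ℝ).precompL (Model n))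
        (hs.continuous_fderiv (by simp)) (locallyIntegrableOn_univ.1 h.1) (μ := volume) x
      exact this.integrable_swap
  -- The reflected kernel is itself a test function, and the sign from differentiating x - t cancels
  -- the sign in the definition of the weak derivative.
  have hsx : ContDiff ℝ ∞ fun t => ρ (x - t) := hs.comp (contDiff_const.sub contDiff_id)
  have hcx : HasCompactSupport fun t => ρ (x - t) :=
    hc.comp_homeomorph (Homeomorph.subLeft x)
  have h2 : ∀ t, pderiv k (fun t => ρ (x - t)) t = - pderiv k ρ (x - t) := by
    intro t
    have : HasFDerivAt (fun t => ρ (x - t))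
        ((fderiv ℝ ρ (x - t)).comp (-ContinuousLinearMap.id ℝ (Model n))) t :=
      ((hs.differentiable (by simp) _).hasFDerivAt).comp t ((hasFDerivAt_id t).const_sub x)
    simp [pderiv, this.fderiv]
  have h3 := h.integral_eq hsx hcx (subset_univ _)
  simp_rw [h2] at h3
  rw [h1, moll_apply']
  simp only [mul_neg, integral_neg, neg_inj] at h3
  simpa only [mul_comm] using h3

/-- Jensen's inequality: the kernel is a probability density, and for a probability measure the L¹
norm is at most the Lᵠ norm. -/
lemma enorm_moll_rpow_le (hf : AEStronglyMeasurable f) {q : ℝ≥0∞} (hq : 1 ≤ q) (hq' : q ≠ ⊤)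
    (j : ℕ) (x : Model n) :
    ‖moll j f x‖ₑ ^ q.toReal ≤
      ∫⁻ t, ENNReal.ofReal ((bump n j).normed volume t) * ‖f (x - t)‖ₑ ^ q.toReal := by
  set ρ : Model n → ℝ := (bump n j).normed volume with hρ
  have hm : Measurable fun t => ENNReal.ofReal (ρ t) :=
    ((bump n j).continuous_normed.measurable).ennreal_ofReal
  set ν : Measure (Model n) := volume.withDensity fun t => ENNReal.ofReal (ρ t) with hν
  have hν1 : IsProbabilityMeasure ν := by
    constructor
    rw [hν, withDensity_apply _ MeasurableSet.univ, Measure.restrict_univ,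
      ← ofReal_integral_eq_lintegral_ofReal (bump n j).integrable_normed
        (Eventually.of_forall fun t => (bump n j).nonneg_normed t), (bump n j).integral_normed]
    simp
  have hmeas : AEStronglyMeasurable (fun t => f (x - t)) volume :=
    hf.comp_quasiMeasurePreserving
      (quasiMeasurePreserving_sub_left_of_right_invariant volume x)
  have hmeas' : AEStronglyMeasurable (fun t => f (x - t)) ν :=
    hmeas.mono_ac (withDensity_absolutelyContinuous _ _)
  have hq0 : q ≠ 0 := (zero_lt_one.trans_le hq).ne'
  have hqr : 0 < q.toReal := ENNReal.toReal_pos hq0 hq'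
  have h1 : ‖moll j f x‖ₑ ≤ eLpNorm (fun t => f (x - t)) 1 ν := by
    rw [eLpNorm_one_eq_lintegral_enorm, hν, lintegral_withDensity_eq_lintegral_mul₀ hm.aemeasurable
      hmeas.enorm, moll_apply]
    refine (enorm_integral_le_lintegral_enorm _).trans (lintegral_mono fun t => ?_)
    rw [enorm_mul, Pi.mul_apply, Real.enorm_of_nonneg ((bump n j).nonneg_normed t)]
  have h2 := h1.trans (eLpNorm_le_eLpNorm_of_exponent_le hq hmeas')
  rw [eLpNorm_eq_lintegral_rpow_enorm_toReal hq0 hq'] at h2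
  have h3 := ENNReal.rpow_le_rpow h2 hqr.le
  rw [← ENNReal.rpow_mul, one_div, inv_mul_cancel₀ hqr.ne', ENNReal.rpow_one] at h3
  refine h3.trans_eq ?_
  rw [hν, lintegral_withDensity_eq_lintegral_mul₀ hm.aemeasurable (hmeas.enorm.pow_const _)]
  rfl

/-- Mollification does not increase `Lᵠ` norms. -/
lemma eLpNorm_moll_le (hf : AEStronglyMeasurable f) {q : ℝ≥0∞} (hq : 1 ≤ q) (hq' : q ≠ ⊤) (j : ℕ) :
    eLpNorm (moll j f) q volume ≤ eLpNorm f q volume := by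
  -- A strongly measurable representative makes the integrand jointly measurable in (x, t), as the
  -- exchange of integrals needs.
  wlog hfm : StronglyMeasurable f generalizing f
  · rw [moll_congr_ae hf.ae_eq_mk, eLpNorm_congr_ae hf.ae_eq_mk]
    exact this hf.stronglyMeasurable_mk.aestronglyMeasurable hf.stronglyMeasurable_mk
  have hq0 : q ≠ 0 := (zero_lt_one.trans_le hq).ne'
  have hqr : 0 < q.toReal := ENNReal.toReal_pos hq0 hq'
  rw [eLpNorm_eq_lintegral_rpow_enorm_toReal hq0 hq', eLpNorm_eq_lintegral_rpow_enorm_toReal hq0 hq']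
  refine ENNReal.rpow_le_rpow ?_ (by positivity)
  refine (lintegral_mono fun x => enorm_moll_rpow_le hf hq hq' j x).trans ?_
  have hm : Measurable fun t => ENNReal.ofReal ((bump n j).normed volume t) :=
    ((bump n j).continuous_normed.measurable).ennreal_ofReal
  rw [lintegral_lintegral_swap]
  · have : ∀ t : Model n, ∫⁻ x, ENNReal.ofReal ((bump n j).normed volume t) *
        ‖f (x - t)‖ₑ ^ q.toReal =
        ENNReal.ofReal ((bump n j).normed volume t) * ∫⁻ x, ‖f x‖ₑ ^ q.toReal := by
      intro t
      rw [lintegral_const_mul' _ _ ENNReal.ofReal_ne_top,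
        lintegral_sub_right_eq_self (fun x => ‖f x‖ₑ ^ q.toReal) t]
    simp_rw [this]
    rw [lintegral_mul_const _ hm,
      ← ofReal_integral_eq_lintegral_ofReal (bump n j).integrable_normed
        (Eventually.of_forall fun t => (bump n j).nonneg_normed t), (bump n j).integral_normed]
    simp
  · refine Measurable.aemeasurable ?_
    exact (hm.comp measurable_snd).mul
      (((hfm.measurable.comp (measurable_fst.sub measurable_snd)).enorm).pow_const _)

lemma moll_dist_le_of_continuous (hf : Continuous f) (hc : HasCompactSupport f) {ε : ℝ}
    (hε : 0 < ε) : ∀ᶠ j in atTop, ∀ x, dist (moll j f x) (f x) ≤ ε := by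
  obtain ⟨δ, hδ, H⟩ := Metric.uniformContinuous_iff.1
    (hc.uniformContinuous_of_continuous hf) ε hε
  filter_upwards [(tendsto_bump_rOut n).eventually (gt_mem_nhds hδ)] with j hj x
  refine (bump n j).dist_normed_convolution_le hf.aestronglyMeasurable fun y hy => (H ?_).le
  exact (Metric.mem_ball.1 hy).trans hj

/-- Mollifications converge in `Lᵠ` for finite `q`. -/
lemma tendsto_eLpNorm_moll_sub {q : ℝ≥0∞} (hq : 1 ≤ q) (hq' : q ≠ ⊤) (hf : MemLp f q volume) :
    Tendsto (fun j => eLpNorm (fun x => moll j f x - f x) q volume) atTop (𝓝 0) := by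
  rw [ENNReal.tendsto_nhds_zero]
  intro ε hε
  have hε3 : ε / 3 ≠ 0 := (ENNReal.div_pos hε.ne' (by norm_num)).ne'
  -- With g continuous and compactly supported, the error splits into the mollification of f - g,
  -- the error for g, and g - f. The first is no larger than the third because mollification
  -- contracts Lᵠ.
  obtain ⟨g, hgc, hfg, hg, hgm⟩ := hf.exists_hasCompactSupport_eLpNorm_sub_le hq' hε3
  set K := Metric.cthickening 1 (tsupport g)
  have hK : IsCompact K := IsCompact.cthickening hgc
  have hlf : LocallyIntegrable f := hf.locallyIntegrable hq
  have hlg : LocallyIntegrable g := hgm.locallyIntegrable hq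
  -- All mollifications of g are supported in the fixed compact set K, so a uniform error δ costs at
  -- most δ times a power of the volume of K in Lᵠ.
  obtain ⟨δ, hδ, hδ'⟩ : ∃ δ : ℝ, 0 < δ ∧
      ENNReal.ofReal δ * volume K ^ (1 / q.toReal) ≤ ε / 3 := by
    have hfin : volume K ^ (1 / q.toReal) ≠ ⊤ :=
      ENNReal.rpow_ne_top_of_nonneg (by positivity) hK.measure_lt_top.ne
    have ht : Tendsto (fun δ : ℝ => ENNReal.ofReal δ * volume K ^ (1 / q.toReal)) (𝓝[>] 0)
        (𝓝 0) := by
      have : Tendsto (fun δ : ℝ => ENNReal.ofReal δ * volume K ^ (1 / q.toReal)) (𝓝 0)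
          (𝓝 (ENNReal.ofReal 0 * volume K ^ (1 / q.toReal))) :=
        ENNReal.Tendsto.mul_const (ENNReal.continuous_ofReal.tendsto 0) (Or.inr hfin)
      simpa using this.mono_left nhdsWithin_le_nhds
    obtain ⟨δ, h1, h2⟩ := ((ht.eventually (ge_mem_nhds (pos_iff_ne_zero.2 hε3))).and
      self_mem_nhdsWithin).exists
    exact ⟨δ, h2, h1⟩
  filter_upwards [moll_dist_le_of_continuous hg hgc hδ] with j hj
  have e : (fun x => moll j f x - f x) =
      (moll j (fun y => f y - g y) + (moll j g - g)) - (f - g) := by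
    ext x
    simp only [Pi.add_apply, Pi.sub_apply, moll_sub hlf hlg]
    ring
  have m1 := ((contDiff_moll (hlf.sub hlg) j).continuous.aestronglyMeasurable :
    AEStronglyMeasurable _ volume)
  have m2 := ((contDiff_moll hlg j).continuous.aestronglyMeasurable :
    AEStronglyMeasurable _ volume).sub hgm.1
  have m3 := hf.1.sub hgm.1
  have b1 : eLpNorm (moll j (fun y => f y - g y)) q volume ≤ ε / 3 :=
    (eLpNorm_moll_le m3 hq hq' j).trans hfg
  have b2 : eLpNorm (moll j g - g) q volume ≤ ε / 3 := by
    refine (eLpNorm_sub_le_of_dist_bdd volume hq' hK.measurableSet hδ.le hj ?_ ?_).trans hδ'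
    · refine (support_moll_subset j g).trans (Metric.cthickening_mono ?_ _)
      rw [div_le_one (by positivity)]
      linarith [(Nat.cast_nonneg j : (0 : ℝ) ≤ j)]
    · exact (subset_tsupport g).trans (Metric.self_subset_cthickening _)
  rw [e]
  calc _ ≤ eLpNorm (moll j (fun y => f y - g y) + (moll j g - g)) q volume +
        eLpNorm (f - g) q volume := eLpNorm_sub_le (m1.add m2) m3 hq
    _ ≤ (ε / 3 + ε / 3) + ε / 3 := by
        gcongr
        exact (eLpNorm_add_le m1 m2 hq).trans (add_le_add b1 b2)
    _ = ε := ENNReal.add_thirds ε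

end Mollification


/-! ## Calculus of weak derivatives -/

section Calculus

variable {n : ℕ} {Ω : Set (Model n)} {k : Fin n}

/-- A smooth cutoff function that is `1` near a compact set. -/
lemma exists_cutoff {K : Set (Model n)} (hK : IsCompact K) (hΩ : IsOpen Ω) (h : K ⊆ Ω) :
    ∃ χ : Model n → ℝ, ContDiff ℝ ∞ χ ∧ HasCompactSupport χ ∧ tsupport χ ⊆ Ω ∧
      (∀ y, χ y ∈ Icc (0 : ℝ) 1) ∧ ∀ y ∈ K, χ =ᶠ[𝓝 y] fun _ => 1 := by
  obtain ⟨L, hL, hKL, hLΩ⟩ := exists_compact_between hK hΩ h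
  obtain ⟨χ, h1, h2, h3⟩ := exists_contMDiffMap_one_nhds_of_subset_interior 𝓘(ℝ, Model n)
    hK.isClosed hKL (n := ⊤)
  have hsupp : Function.support χ ⊆ L := fun x hx => by
    by_contra hxL
    exact hx (h2 x hxL)
  refine ⟨χ, χ.contMDiff.contDiff, HasCompactSupport.of_support_subset_isCompact hL hsupp,
    (closure_minimal hsupp hL.isClosed).trans hLΩ, h3, fun y hy => ?_⟩
  exact (eventually_nhdsSet_iff_forall.1 h1) y hy

lemma MemLpLoc.mono {p : ℝ≥0∞} {Ω' : Set (Model n)} {f : Model n → ℝ} (h : MemLpLoc p Ω f)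
    (hs : Ω' ⊆ Ω) : MemLpLoc p Ω' f := fun K hK hKs => h K hK (hKs.trans hs)

lemma MemLpLoc.locallyIntegrableOn {p : ℝ≥0∞} {f : Model n → ℝ} (hΩ : IsOpen Ω)
    (h : MemLpLoc p Ω f) (hp : 1 ≤ p) : LocallyIntegrableOn f Ω := by
  rw [locallyIntegrableOn_iff hΩ.isLocallyClosed]
  intro K hKs hK
  have : IsFiniteMeasure ((volume : Measure (Model n)).restrict K) := ⟨by simpa using hK.measure_lt_top⟩
  exact (h K hK hKs).integrable hp

lemma _root_.ContinuousOn.memLpLoc {p : ℝ≥0∞} {f : Model n → ℝ} (h : ContinuousOn f Ω) :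
    MemLpLoc p Ω f := by
  intro K hK hKs
  have : IsFiniteMeasure ((volume : Measure (Model n)).restrict K) := ⟨by simpa using hK.measure_lt_top⟩
  obtain ⟨C, hC⟩ := hK.exists_bound_of_continuousOn (h.mono hKs)
  refine MemLp.of_bound ((h.mono hKs).aestronglyMeasurable hK.measurableSet) C ?_
  exact (ae_restrict_iff' hK.measurableSet).2 (Eventually.of_forall hC)

lemma MemLpLoc.congr_ae {p : ℝ≥0∞} {f f' : Model n → ℝ} (h : MemLpLoc p Ω f)
    (he : ∀ᵐ y ∂volume.restrict Ω, f y = f' y) : MemLpLoc p Ω f' := fun K hK hKs =>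
  (memLp_congr_ae (ae_restrict_of_ae_restrict_of_subset hKs he)).1 (h K hK hKs)

lemma MemLpLoc.mul {p q r : ℝ≥0∞} {f g : Model n → ℝ} [ENNReal.HolderTriple p q r]
    (hf : MemLpLoc p Ω f) (hg : MemLpLoc q Ω g) : MemLpLoc r Ω (fun y => f y * g y) :=
  fun K hK hKs => (hg K hK hKs).mul' (hf K hK hKs)

lemma MemLpLoc.add {p : ℝ≥0∞} {f g : Model n → ℝ}
    (hf : MemLpLoc p Ω f) (hg : MemLpLoc p Ω g) : MemLpLoc p Ω (fun y => f y + g y) :=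
  fun K hK hKs => (hf K hK hKs).add (hg K hK hKs)

lemma MemLpLoc.sub {p : ℝ≥0∞} {f g : Model n → ℝ}
    (hf : MemLpLoc p Ω f) (hg : MemLpLoc p Ω g) : MemLpLoc p Ω (fun y => f y - g y) :=
  fun K hK hKs => (hf K hK hKs).sub (hg K hK hKs)

lemma MemLpLoc.neg {p : ℝ≥0∞} {f : Model n → ℝ}
    (hf : MemLpLoc p Ω f) : MemLpLoc p Ω (fun y => - f y) :=
  fun K hK hKs => (hf K hK hKs).neg

lemma MemLpLoc.const_mul {p : ℝ≥0∞} {f : Model n → ℝ}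
    (hf : MemLpLoc p Ω f) (c : ℝ) : MemLpLoc p Ω (fun y => c * f y) :=
  fun K hK hKs => (hf K hK hKs).const_mul c

lemma MemLpLoc.sum {ι : Type*} (s : Finset ι) {p : ℝ≥0∞} {f : ι → Model n → ℝ}
    (hf : ∀ i ∈ s, MemLpLoc p Ω (f i)) : MemLpLoc p Ω (fun y => ∑ i ∈ s, f i y) :=
  fun K hK hKs => memLp_finsetSum s fun i hi => hf i hi K hK hKs

lemma MemLpLoc.continuousOn_mul {p : ℝ≥0∞} {f g : Model n → ℝ}
    (hf : ContinuousOn f Ω) (hg : MemLpLoc p Ω g) : MemLpLoc p Ω (fun y => f y * g y) :=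
  MemLpLoc.mul (p := ⊤) (q := p) hf.memLpLoc hg

lemma MemLpLoc.memLp_mul {p : ℝ≥0∞} {χ f : Model n → ℝ} (hf : MemLpLoc p Ω f) (hχ : Continuous χ)
    (hc : HasCompactSupport χ) (hs : tsupport χ ⊆ Ω) : MemLp (fun y => χ y * f y) p volume := by
  have h1 := MemLpLoc.continuousOn_mul hχ.continuousOn hf _ hc.isCompact hs
  have : (fun y => χ y * f y) = (tsupport χ).indicator (fun y => χ y * f y) := by
    symm
    rw [Set.indicator_eq_self]
    intro x hx
    exact subset_tsupport _ (left_ne_zero_of_mul hx)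
  rw [this, memLp_indicator_iff_restrict (isClosed_tsupport χ).measurableSet]
  exact h1

/-- Hölder's inequality: pairing with a fixed Lᵖ function is continuous on L^q. This is the limit
passage behind every mollification argument with conjugate exponents. -/
lemma tendsto_integral_mul {α : Type*} {m : MeasurableSpace α} {μ : Measure α} {p q : ℝ≥0∞}
    [ENNReal.HolderConjugate p q]
    {a f : α → ℝ} {F : ℕ → α → ℝ} (ha : MemLp a p μ) (hf : MemLp f q μ)
    (hF : ∀ j, MemLp (F j) q μ)
    (h : Tendsto (fun j => eLpNorm (fun x => F j x - f x) q μ) atTop (𝓝 0)) :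
    Tendsto (fun j => ∫ x, a x * F j x ∂μ) atTop (𝓝 (∫ x, a x * f x ∂μ)) := by
  refine tendsto_integral_of_L1' _ (ha.1.mul hf.1)
    (Eventually.of_forall fun j => memLp_one_iff_integrable.1 ((hF j).mul' (r := 1) ha)) ?_
  have h2 : Tendsto (fun j => eLpNorm a p μ * eLpNorm (fun x => F j x - f x) q μ) atTop (𝓝 0) := by
    have := ENNReal.Tendsto.const_mul (a := eLpNorm a p μ) h (Or.inr ha.2.ne)
    rwa [mul_zero] at this
  refine tendsto_of_tendsto_of_tendsto_of_le_of_le tendsto_const_nhds h2 (fun _ => zero_le) ?_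
  intro j
  have e : (fun x => a x * F j x) - (fun x => a x * f x) = a • (fun x => F j x - f x) := by
    ext x
    simp only [Pi.sub_apply, Pi.smul_apply', smul_eq_mul]
    ring
  change eLpNorm ((fun x => a x * F j x) - (fun x => a x * f x)) 1 μ ≤ _
  rw [e]
  exact eLpNorm_smul_le_mul_eLpNorm ((hF j).1.sub hf.1) ha.1

lemma memLp_moll {q : ℝ≥0∞} (hq : 1 ≤ q) (hq' : q ≠ ⊤) {f : Model n → ℝ} (hf : MemLp f q volume)
    (j : ℕ) : MemLp (moll j f) q volume :=
  ⟨(contDiff_moll (hf.locallyIntegrable hq) j).continuous.aestronglyMeasurable,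
    (eLpNorm_moll_le hf.1 hq hq' j).trans_lt hf.2⟩

lemma pderiv_eq_zero_of_eventually_const {f : Model n → ℝ} {y : Model n} {c : ℝ}
    (h : f =ᶠ[𝓝 y] fun _ => c) (k : Fin n) : pderiv k f y = 0 := by
  rw [pderiv_congr h]
  simp [pderiv]

/-- The product rule for `u ∈ W^{1,q}_loc` and a continuous `r ∈ W^{1,p}_loc`, `1/p + 1/q = 1`. -/
lemma HasWeakPartial.mul {p q : ℝ≥0∞} [ENNReal.HolderConjugate p q] (hΩ : IsOpen Ω) (hq' : q ≠ ⊤)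
    {u v r w : Model n → ℝ} (hu : HasWeakPartial Ω k u v) (huq : MemLpLoc q Ω u)
    (hvq : MemLpLoc q Ω v) (hr : HasWeakPartial Ω k r w) (hrc : ContinuousOn r Ω)
    (hwp : MemLpLoc p Ω w) :
    HasWeakPartial Ω k (fun y => u y * r y) (fun y => v y * r y + u y * w y) := by
  have hq : 1 ≤ q := ENNReal.HolderConjugate.one_le q p
  have l1 : MemLpLoc 1 Ω (fun y => r y * u y) := MemLpLoc.mul hrc.memLpLoc huq (p := p) (q := q)
  have l2 : MemLpLoc 1 Ω (fun y => r y * v y) := MemLpLoc.mul hrc.memLpLoc hvq (p := p) (q := q)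
  have l3 : MemLpLoc 1 Ω (fun y => w y * u y) := MemLpLoc.mul hwp huq (p := p) (q := q)
  refine hasWeakPartial_of_integral_eq (by simpa only [mul_comm] using l1.locallyIntegrableOn hΩ le_rfl)
    (by simpa only [mul_comm] using (l2.add l3).locallyIntegrableOn hΩ le_rfl) fun φ hφ hc hs => ?_
  -- Cutting off by a function equal to 1 near the support of φ replaces u by a global W^{1,q}
  -- function that can be mollified, without changing the integrals against φ.
  obtain ⟨χ, hχ, hχc, hχs, -, hχ1⟩ := exists_cutoff hc.isCompact hΩ hs
  set U : Model n → ℝ := fun y => χ y * u y with hU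
  set V : Model n → ℝ := fun y => χ y * v y + pderiv k χ y * u y with hV
  have hUV : HasWeakPartial univ k U V := hu.cutoff hχ hχc hχs
  have mU : MemLp U q volume := huq.memLp_mul hχ.continuous hχc hχs
  have mV : MemLp V q volume := (hvq.memLp_mul hχ.continuous hχc hχs).add
    (huq.memLp_mul (contDiff_pderiv hχ k).continuous (hχc.pderiv k)
      ((tsupport_pderiv_subset k χ).trans hχs))
  have hUu : ∀ y ∈ tsupport φ, U y = u y := fun y hy => by simp [hU, (hχ1 y hy).eq_of_nhds]
  have hVv : ∀ y ∈ tsupport φ, V y = v y := fun y hy => by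
    simp [hV, (hχ1 y hy).eq_of_nhds, pderiv_eq_zero_of_eventually_const (hχ1 y hy)]
  have sφ' : tsupport (pderiv k φ) ⊆ Ω := (tsupport_pderiv_subset k φ).trans hs
  have m1 : MemLp (fun y => pderiv k φ y * r y) p volume :=
    hrc.memLpLoc.memLp_mul (contDiff_pderiv hφ k).continuous (hc.pderiv k) sφ'
  have m2 : MemLp (fun y => φ y * r y) p volume := hrc.memLpLoc.memLp_mul hφ.continuous hc hs
  have m3 : MemLp (fun y => φ y * w y) p volume := hwp.memLp_mul hφ.continuous hc hs
  have t1 := tendsto_integral_mul m1 mU (fun j => memLp_moll hq hq' mU j)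
    (tendsto_eLpNorm_moll_sub hq hq' mU)
  have t2 := tendsto_integral_mul m2 mV (fun j => memLp_moll hq hq' mV j)
    (tendsto_eLpNorm_moll_sub hq hq' mV)
  have t3 := tendsto_integral_mul m3 mU (fun j => memLp_moll hq hq' mU j)
    (tendsto_eLpNorm_moll_sub hq hq' mU)
  have lU := mU.locallyIntegrable hq
  -- Once U is mollified, its product with φ is a smooth test function, so the product rule is just
  -- the definition of the weak derivative of r.
  have key : ∀ j, ∫ y, pderiv k φ y * r y * moll j U y =
      -(∫ y, φ y * r y * moll j V y) - ∫ y, φ y * w y * moll j U y := by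
    intro j
    have hm := contDiff_moll lU j
    have e := hr.integral_eq (φ := fun y => moll j U y * φ y) (hm.mul hφ) hc.mul_left
      (tsupport_mul_subset_right.trans hs)
    have hpt : ∀ y, pderiv k (fun y => moll j U y * φ y) y =
        moll j U y * pderiv k φ y + moll j V y * φ y := fun y => by
      rw [pderiv_mul (hm.differentiable (by simp) y) (hφ.differentiable (by simp) y),
        pderiv_moll hUV]
    simp_rw [hpt] at e
    have i1 : Integrable fun y => pderiv k φ y * r y * moll j U y :=
      memLp_one_iff_integrable.1 ((memLp_moll hq hq' mU j).mul' (r := 1) m1)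
    have i2 : Integrable fun y => φ y * r y * moll j V y :=
      memLp_one_iff_integrable.1 ((memLp_moll hq hq' mV j).mul' (r := 1) m2)
    have e1 : ∫ y, r y * (moll j U y * pderiv k φ y + moll j V y * φ y) =
        (∫ y, pderiv k φ y * r y * moll j U y) + ∫ y, φ y * r y * moll j V y := by
      rw [← integral_add i1 i2]
      congr 1; ext y; ring
    have e2 : ∫ y, w y * (moll j U y * φ y) = ∫ y, φ y * w y * moll j U y := by
      congr 1; ext y; ring
    rw [e1, e2] at e
    linarith
  simp_rw [key] at t1
  have lim := tendsto_nhds_unique t1 (t2.neg.sub t3)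
  have f1 : ∫ y, u y * r y * pderiv k φ y = ∫ y, pderiv k φ y * r y * U y := by
    congr 1; ext y
    by_cases hy : y ∈ tsupport φ
    · rw [hUu y hy]; ring
    · have : pderiv k φ y = 0 :=
        image_eq_zero_of_notMem_tsupport fun h => hy (tsupport_pderiv_subset k φ h)
      simp [this]
  have f2 : ∫ y, (v y * r y + u y * w y) * φ y = ∫ y, (φ y * r y * V y + φ y * w y * U y) := by
    congr 1; ext y
    by_cases hy : y ∈ tsupport φ
    · rw [hUu y hy, hVv y hy]; ring
    · simp [image_eq_zero_of_notMem_tsupport hy]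
  rw [f1, f2, lim, integral_add]
  · ring
  · exact memLp_one_iff_integrable.1 (mV.mul' (r := 1) m2)
  · exact memLp_one_iff_integrable.1 (mU.mul' (r := 1) m3)

end Calculus


/-! ## Chain rule, Sobolev embedding and density of smooth functions -/

section ChainRule

variable {n : ℕ} {Ω : Set (Model n)} {k : Fin n}

lemma continuous_mul_of_tsupport {χ f : Model n → ℝ} (hΩ : IsOpen Ω) (hχ : Continuous χ)
    (hs : tsupport χ ⊆ Ω) (hf : ContinuousOn f Ω) : Continuous fun y => χ y * f y := by
  rw [continuous_iff_continuousAt]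
  intro y
  by_cases hy : y ∈ tsupport χ
  · exact hχ.continuousAt.mul (hf.continuousAt (hΩ.mem_nhds (hs hy)))
  · have : (fun y => χ y * f y) =ᶠ[𝓝 y] fun _ => 0 := by
      filter_upwards [(isClosed_tsupport χ).isOpen_compl.mem_nhds hy] with z hz
      simp [image_eq_zero_of_notMem_tsupport hz]
    exact continuousAt_const.congr this.symm

/-- The partial derivative of a composition with a function of finitely many variables. -/
lemma pderiv_comp {ι : Type*} [Fintype ι] [DecidableEq ι] {F : (ι → ℝ) → ℝ} {f : ι → Model n → ℝ}
    {y : Model n} (hF : DifferentiableAt ℝ F (fun a => f a y))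
    (hf : ∀ a, DifferentiableAt ℝ (f a) y) (k : Fin n) :
    pderiv k (fun z => F fun a => f a z) y =
      ∑ a, fderiv ℝ F (fun a => f a y) (Pi.single a 1) * pderiv k (f a) y := by
  have h1 : HasFDerivAt (fun z a => f a z) (ContinuousLinearMap.pi fun a => fderiv ℝ (f a) y) y :=
    hasFDerivAt_pi.2 fun a => (hf a).hasFDerivAt
  have h2 := (hF.hasFDerivAt.comp y h1).fderiv
  have h3 : pderiv k (fun z => F fun a => f a z) y =
      fderiv ℝ F (fun a => f a y) (fun a => pderiv k (f a) y) := by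
    rw [pderiv]
    change (fderiv ℝ (F ∘ fun z a => f a z) y) (coordVec k) = _
    rw [h2]
    rfl
  rw [h3]
  conv_lhs => rw [← Finset.univ_sum_single (fun a => pderiv k (f a) y)]
  rw [map_sum]
  refine Finset.sum_congr rfl fun a _ => ?_
  rw [show (Pi.single a (pderiv k (f a) y) : ι → ℝ) = pderiv k (f a) y • Pi.single a 1 by
    rw [← Pi.single_smul]; simp, map_smul, smul_eq_mul, mul_comm]

lemma integrable_of_bounded_mul {a v : Model n → ℝ} {C : ℝ} (ha : AEStronglyMeasurable a)
    (hv : Integrable v) (h : ∀ y, |a y| ≤ C) : Integrable fun y => a y * v y :=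
  hv.bdd_mul ha (Eventually.of_forall h)

/-- If `a j → a` boundedly and `v j → v` in `L¹` then `∫ a j * v j → ∫ a * v`. -/
lemma tendsto_integral_mul_of_bounded {a v : Model n → ℝ} {A V : ℕ → Model n → ℝ} {C : ℝ}
    (hA : ∀ᶠ j in atTop, AEStronglyMeasurable (A j) ∧ ∀ y, |A j y| ≤ C)
    (ha : ∀ y, Tendsto (fun j => A j y) atTop (𝓝 (a y)))
    (hV : ∀ j, MemLp (V j) 1 volume) (hv : MemLp v 1 volume)
    (h : Tendsto (fun j => eLpNorm (fun x => V j x - v x) 1 volume) atTop (𝓝 0)) :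
    Tendsto (fun j => ∫ y, A j y * V j y) atTop (𝓝 (∫ y, a y * v y)) := by
  -- The difference splits as A (V - v) + (A - a) v: the first part is small because A is bounded,
  -- the second by dominated convergence.
  have iV := fun j => memLp_one_iff_integrable.1 (hV j)
  have iv := memLp_one_iff_integrable.1 hv
  have t1 : Tendsto (fun j => ∫ y, A j y * v y) atTop (𝓝 (∫ y, a y * v y)) := by
    refine tendsto_integral_filter_of_dominated_convergence (fun y => C * |v y|)
      (hA.mono fun j hj => hj.1.mul hv.1) (hA.mono fun j hj => Eventually.of_forall fun y => ?_)
      (iv.abs.const_mul C) (Eventually.of_forall fun y => (ha y).mul_const _)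
    rw [norm_mul, Real.norm_eq_abs, Real.norm_eq_abs]
    exact mul_le_mul_of_nonneg_right (hj.2 y) (abs_nonneg _)
  have t2 : Tendsto (fun j => C * ∫ y, |V j y - v y|) atTop (𝓝 0) := by
    have h0 := (ENNReal.tendsto_toReal ENNReal.zero_ne_top).comp h
    have : ∀ j, (eLpNorm (fun x => V j x - v x) 1 volume).toReal = ∫ y, |V j y - v y| := by
      intro j
      have hm : AEStronglyMeasurable (fun x => V j x - v x) volume := ((hV j).sub hv).1
      rw [eLpNorm_one_eq_lintegral_enorm, ← integral_norm_eq_lintegral_enorm hm]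
      rfl
    have h1 : Tendsto (fun j => ∫ y, |V j y - v y|) atTop (𝓝 0) := by
      refine (h0.congr this)
    simpa using h1.const_mul C
  have t3 : Tendsto (fun j => ∫ y, A j y * (V j y - v y)) atTop (𝓝 0) := by
    refine squeeze_zero_norm' (hA.mono fun j hj => ?_) t2
    rw [← integral_const_mul]
    refine norm_integral_le_of_norm_le (((iV j).sub iv).abs.const_mul C)
      (Eventually.of_forall fun y => ?_)
    rw [norm_mul, Real.norm_eq_abs, Real.norm_eq_abs]
    exact mul_le_mul_of_nonneg_right (hj.2 y) (abs_nonneg _)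
  have := t3.add t1
  rw [zero_add] at this
  refine this.congr' (hA.mono fun j hj => ?_)
  have i1 : Integrable fun y => A j y * (V j y - v y) :=
    integrable_of_bounded_mul hj.1 ((iV j).sub iv) hj.2
  rw [← integral_add i1 (integrable_of_bounded_mul hj.1 iv hj.2)]
  congr 1; ext y; ring

/-- The chain rule for continuous weakly differentiable functions. -/
lemma HasWeakPartial.comp {ι : Type*} [Fintype ι] [DecidableEq ι] (hΩ : IsOpen Ω)
    {f v : ι → Model n → ℝ} (hf : ∀ a, HasWeakPartial Ω k (f a) (v a))
    (hfc : ∀ a, ContinuousOn (f a) Ω) {F : (ι → ℝ) → ℝ} {U : Set (ι → ℝ)} (hU : IsOpen U)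
    (hF : ContDiffOn ℝ 1 F U) (hfU : ∀ y ∈ Ω, (fun a => f a y) ∈ U) :
    HasWeakPartial Ω k (fun y => F fun a => f a y)
      (fun y => ∑ a, fderiv ℝ F (fun a => f a y) (Pi.single a 1) * v a y) := by
  have hfc' : ContinuousOn (fun y a => f a y) Ω := continuousOn_pi.2 hfc
  have hFc : ContinuousOn (fun y => F fun a => f a y) Ω := hF.continuousOn.comp hfc' hfU
  have hDF : ∀ a : ι, ContinuousOn (fun z => fderiv ℝ F z (Pi.single a 1)) U := fun a =>
    (hF.continuousOn_fderiv_of_isOpen hU le_rfl).clm_apply continuousOn_const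
  refine hasWeakPartial_of_integral_eq (hFc.locallyIntegrableOn hΩ.measurableSet) ?_
    fun φ hφ hc hs => ?_
  · have : ∀ a ∈ (Finset.univ : Finset ι), LocallyIntegrableOn
        (fun y => fderiv ℝ F (fun a => f a y) (Pi.single a 1) * v a y) Ω := fun a _ =>
      (hf a).2.1.continuousOn_mul ((hDF a).comp hfc' hfU) hΩ.isLocallyClosed
    rw [locallyIntegrableOn_iff hΩ.isLocallyClosed]
    intro K hKs hK
    exact integrable_finsetSum _ fun a ha =>
      ((locallyIntegrableOn_iff hΩ.isLocallyClosed).1 (this a ha) K hKs hK)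
  obtain ⟨χ, hχ, hχc, hχs, -, hχ1⟩ := exists_cutoff hc.isCompact hΩ hs
  set K := tsupport φ with hK
  have hKc : IsCompact K := hc.isCompact
  set G : ι → Model n → ℝ := fun a y => χ y * f a y with hG
  set V : ι → Model n → ℝ := fun a y => χ y * v a y + pderiv k χ y * f a y with hV
  have hGV : ∀ a, HasWeakPartial univ k (G a) (V a) := fun a => (hf a).cutoff hχ hχc hχs
  have hGc : ∀ a, Continuous (G a) := fun a => continuous_mul_of_tsupport hΩ hχ.continuous hχs (hfc a)
  have hGs : ∀ a, HasCompactSupport (G a) := fun a => hχc.mul_right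
  have mV : ∀ a, MemLp (V a) 1 volume := fun a =>
    memLp_one_iff_integrable.2 <| by
      have h1 := integrable_mul_of_locallyIntegrableOn (hf a).2.1 hχ.continuous hχc hχs
      have h2 := integrable_mul_of_locallyIntegrableOn (hf a).1 (contDiff_pderiv hχ k).continuous
        (hχc.pderiv k) ((tsupport_pderiv_subset k χ).trans hχs)
      refine (h1.add h2).congr (Eventually.of_forall fun y => ?_)
      simp only [hV, Pi.add_apply]; ring
  have hGf : ∀ a, ∀ y ∈ K, G a y = f a y := fun a y hy => by simp [hG, (hχ1 y hy).eq_of_nhds]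
  have hVv : ∀ a, ∀ y ∈ K, V a y = v a y := fun a y hy => by
    simp [hV, (hχ1 y hy).eq_of_nhds, pderiv_eq_zero_of_eventually_const (hχ1 y hy)]
  -- a compact neighbourhood of the image of the support
  have hI : IsCompact ((fun y a => f a y) '' K) := hKc.image_of_continuousOn (hfc'.mono hs)
  obtain ⟨ε, hε, hεU⟩ := hI.exists_cthickening_subset_open hU (by
    rintro _ ⟨y, hy, rfl⟩; exact hfU y (hs hy))
  set L := Metric.cthickening ε ((fun y a => f a y) '' K)
  have hL : IsCompact L := hI.cthickening
  obtain ⟨C, hC⟩ := hL.exists_bound_of_continuousOn (hF.continuousOn.mono hεU)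
  have hC' : ∀ a : ι, ∃ C, ∀ z ∈ L, ‖fderiv ℝ F z (Pi.single a 1)‖ ≤ C := fun a =>
    hL.exists_bound_of_continuousOn ((hDF a).mono hεU)
  choose D hD using hC'
  set m : ℕ → Model n → ι → ℝ := fun j y a => moll j (G a) y with hm
  -- Continuous compactly supported functions are mollified uniformly well, so eventually the values
  -- on K stay in the compact set L ⊆ U. There F is C¹ with bounded derivative, although nothing is
  -- known about F outside U.
  have hmL : ∀ᶠ j in atTop, ∀ y ∈ K, m j y ∈ L := by
    have := fun a => moll_dist_le_of_continuous (hGc a) (hGs a) hε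
    filter_upwards [eventually_all.2 this] with j hj y hy
    refine Metric.mem_cthickening_of_dist_le _ (fun a => f a y) _ _ ⟨y, hy, rfl⟩ ?_
    rw [dist_pi_le_iff hε.le]
    intro a
    rw [← hGf a y hy]
    exact hj a y
  have hmlim : ∀ y ∈ K, Tendsto (fun j => m j y) atTop (𝓝 fun a => f a y) := by
    intro y hy
    rw [tendsto_pi_nhds]
    intro a
    rw [← hGf a y hy]
    exact ContDiffBump.convolution_tendsto_right_of_continuous (tendsto_bump_rOut n) (hGc a) y
  have hmd : ∀ j a, ContDiff ℝ ∞ (moll j (G a)) := fun j a =>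
    contDiff_moll (hGc a).locallyIntegrable j
  have hmc : ∀ j, Continuous (m j) := fun j => continuous_pi fun a => (hmd j a).continuous
  have hW : ∀ j, IsOpen (m j ⁻¹' U) := fun j => hU.preimage (hmc j)
  have hKW : ∀ᶠ j in atTop, K ⊆ m j ⁻¹' U := hmL.mono fun j hj y hy => hεU (hj y hy)
  have hWF : ∀ j, ContDiffOn ℝ 1 (fun y => F (m j y)) (m j ⁻¹' U) := fun j =>
    hF.comp (contDiff_pi.2 fun a => (hmd j a).of_le (by simp)).contDiffOn fun _ hy => hy
  have hWD : ∀ j a, ContinuousOn (fun y => fderiv ℝ F (m j y) (Pi.single a 1)) (m j ⁻¹' U) :=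
    fun j a => (hDF a).comp (hmc j).continuousOn fun _ hy => hy
  have hφ0 : ∀ y, y ∉ K → φ y = 0 := fun y hy => image_eq_zero_of_notMem_tsupport hy
  have hφ0' : ∀ y, y ∉ K → pderiv k φ y = 0 := fun y hy =>
    image_eq_zero_of_notMem_tsupport fun h => hy (tsupport_pderiv_subset k φ h)
  obtain ⟨B, hB⟩ := hc.exists_bound_of_continuous hφ.continuous
  have hA : ∀ a, ∀ᶠ j in atTop,
      AEStronglyMeasurable (fun y => φ y * fderiv ℝ F (m j y) (Pi.single a 1)) volume ∧
      ∀ y, |φ y * fderiv ℝ F (m j y) (Pi.single a 1)| ≤ B * |D a| := by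
    intro a
    filter_upwards [hmL, hKW] with j hj hjW
    refine ⟨(continuous_mul_of_tsupport (hW j) hφ.continuous hjW
      (hWD j a)).aestronglyMeasurable, fun y => ?_⟩
    by_cases hy : y ∈ K
    · rw [abs_mul]
      exact mul_le_mul (hB y) ((hD a _ (hj y hy)).trans (le_abs_self _)) (abs_nonneg _)
        ((norm_nonneg _).trans (hB y))
    · rw [hφ0 y hy, zero_mul, abs_zero]
      exact mul_nonneg ((norm_nonneg _).trans (hB y)) (abs_nonneg _)
  -- the identity for mollified functions
  have key : ∀ᶠ j in atTop, ∫ y, F (m j y) * pderiv k φ y =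
      -∑ a, ∫ y, (φ y * fderiv ℝ F (m j y) (Pi.single a 1)) * moll j (V a) y := by
    filter_upwards [hKW, eventually_all.2 hA] with j hj hjA
    rw [(hasWeakPartial_of_contDiffOn (hW j) (hWF j) k).integral_eq hφ hc hj, neg_inj,
      ← integral_finsetSum]
    · congr 1; ext y
      by_cases hy : y ∈ K
      · have hd : DifferentiableAt ℝ F (m j y) :=
          (hF.contDiffAt (hU.mem_nhds (hj hy))).differentiableAt one_ne_zero
        rw [pderiv_comp hd (fun a => (hmd j a).differentiable (by simp) y), Finset.sum_mul]
        refine Finset.sum_congr rfl fun a _ => ?_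
        rw [pderiv_moll (hGV a)]
        ring
      · simp [hφ0 y hy]
    · intro a _
      exact integrable_of_bounded_mul (hjA a).1
        (memLp_one_iff_integrable.1 (memLp_moll le_rfl (by simp) (mV a) j)) (hjA a).2
  have lim1 : Tendsto (fun j => ∫ y, F (m j y) * pderiv k φ y) atTop
      (𝓝 (∫ y, F (fun a => f a y) * pderiv k φ y)) := by
    refine tendsto_integral_filter_of_dominated_convergence (fun y => |C| * |pderiv k φ y|)
      ?_ ?_ ?_ ?_
    · filter_upwards [hKW] with j hj
      have := continuous_mul_of_tsupport (hW j) (contDiff_pderiv hφ k).continuous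
        ((tsupport_pderiv_subset k φ).trans hj) (hWF j).continuousOn
      simpa only [mul_comm] using this.aestronglyMeasurable
    · filter_upwards [hmL] with j hj
      refine Eventually.of_forall fun y => ?_
      by_cases hy : y ∈ K
      · rw [norm_mul]
        exact mul_le_mul_of_nonneg_right ((hC _ (hj y hy)).trans (le_abs_self _)) (norm_nonneg _)
      · simp [hφ0' y hy]
    · exact (((contDiff_pderiv hφ k).continuous.integrable_of_hasCompactSupport
        (hc.pderiv k)).abs).const_mul _
    · refine Eventually.of_forall fun y => ?_
      by_cases hy : y ∈ K
      · refine Tendsto.mul_const _ ?_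
        exact ((hF.continuousOn.continuousAt (hU.mem_nhds (hfU y (hs hy)))).tendsto).comp
          (hmlim y hy)
      · simp [hφ0' y hy]
  -- The weak derivatives converge only in L¹, while their coefficients stay bounded and converge
  -- pointwise.
  have lim2 : ∀ a, Tendsto
      (fun j => ∫ y, (φ y * fderiv ℝ F (m j y) (Pi.single a 1)) * moll j (V a) y) atTop
      (𝓝 (∫ y, (φ y * fderiv ℝ F (fun a => f a y) (Pi.single a 1)) * V a y)) := by
    intro a
    refine tendsto_integral_mul_of_bounded (hA a) (fun y => ?_)
      (fun j => memLp_moll le_rfl (by simp) (mV a) j) (mV a)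
      (tendsto_eLpNorm_moll_sub le_rfl (by simp) (mV a))
    by_cases hy : y ∈ K
    · refine Tendsto.const_mul _ ?_
      exact (((hDF a).continuousAt (hU.mem_nhds (hfU y (hs hy)))).tendsto).comp (hmlim y hy)
    · simp [hφ0 y hy]
  have lim3 := (tendsto_finsetSum Finset.univ fun a _ => lim2 a).neg
  rw [tendsto_nhds_unique (lim1.congr' key) lim3, neg_inj, ← integral_finsetSum]
  · congr 1; ext y
    rw [Finset.sum_mul]
    refine Finset.sum_congr rfl fun a _ => ?_
    by_cases hy : y ∈ K
    · rw [hVv a y hy]; ring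
    · simp [hφ0 y hy]
  · intro a _
    have hcont : Continuous fun y => φ y * fderiv ℝ F (fun a => f a y) (Pi.single a 1) :=
      continuous_mul_of_tsupport hΩ hφ.continuous hs ((hDF a).comp hfc' hfU)
    obtain ⟨B', hB'⟩ := HasCompactSupport.exists_bound_of_continuous hc.mul_right hcont
    exact integrable_of_bounded_mul hcont.aestronglyMeasurable
      (memLp_one_iff_integrable.1 (mV a)) hB'

end ChainRule


/-! ## Sobolev embedding and positivity of first-order pairings -/

section Sobolev

open scoped NNReal

variable {n : ℕ} {Ω : Set (Model n)}

lemma norm_le_sum_apply_coordVec (L : Model n →L[ℝ] ℝ) : ‖L‖ ≤ ∑ k, |L (coordVec k)| := by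
  refine L.opNorm_le_bound (Finset.sum_nonneg fun _ _ => abs_nonneg _) fun x => ?_
  have hx : x = ∑ k, x k • (coordVec k : Model n) := by
    ext i
    simp [coordVec, Pi.single_apply]
  conv_lhs => rw [hx]
  rw [map_sum, Finset.sum_mul]
  refine (norm_sum_le _ _).trans (Finset.sum_le_sum fun k _ => ?_)
  rw [map_smul, norm_smul, mul_comm, Real.norm_eq_abs]
  exact mul_le_mul_of_nonneg_left (PiLp.norm_apply_le x k) (abs_nonneg _)

/-- The Sobolev embedding for compactly supported functions. -/
lemma memLp_of_hasWeakPartial {u : Model n → ℝ} {v : Fin n → Model n → ℝ} {q s : ℝ≥0}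
    (hc : HasCompactSupport u) (huv : ∀ k, HasWeakPartial univ k u (v k))
    (hu : MemLp u q volume) (hv : ∀ k, MemLp (v k) q volume) (hq : 1 ≤ q) (hqn : q < n)
    (hqs : (q : ℝ)⁻¹ - (n : ℝ)⁻¹ ≤ (s : ℝ)⁻¹) : MemLp u s volume := by
  have hq1 : (1 : ℝ≥0∞) ≤ q := by exact_mod_cast hq
  have lu := hu.locallyIntegrable hq1
  set T := Metric.cthickening 1 (tsupport u)
  have hT : IsCompact T := IsCompact.cthickening hc
  have hsupp : ∀ j, Function.support (moll j u) ⊆ T := fun j => by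
    refine (support_moll_subset j u).trans (Metric.cthickening_mono ?_ _)
    rw [div_le_one (by positivity)]
    linarith [(Nat.cast_nonneg j : (0 : ℝ) ≤ j)]
  set C := eLpNormLESNormFDerivOfLeConst ℝ (volume : Measure (Model n)) T q s
  -- The Gagliardo–Nirenberg–Sobolev inequality for smooth functions. Its constant depends only on
  -- the common support T and the exponents, and mollifying does not increase the norms of the
  -- derivatives, so the bound is uniform in j.
  have hbound : ∀ j, eLpNorm (moll j u) s volume ≤ C * ∑ k, eLpNorm (v k) q volume := by
    intro j
    have h1 := eLpNorm_le_eLpNorm_fderiv_of_le (volume : Measure (Model n))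
      ((contDiff_moll lu j).of_le (by simp)) (hsupp j) hq (by simpa using hqn)
      (by simpa using hqs) hT.isBounded (u := moll j u) (F := ℝ) (q := s)
    refine h1.trans (mul_le_mul_right ?_ _)
    have h2 : eLpNorm (fderiv ℝ (moll j u)) q volume ≤
        eLpNorm (∑ k, fun y => ‖moll j (v k) y‖) q volume := by
      refine eLpNorm_mono_real fun y => ?_
      refine (norm_le_sum_apply_coordVec _).trans (le_of_eq ?_)
      rw [Finset.sum_apply]
      exact Finset.sum_congr rfl fun k _ => by rw [← pderiv_moll (huv k)]; rfl
    refine h2.trans ((eLpNorm_sum_le (fun k _ => ?_) hq1).trans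
      (Finset.sum_le_sum fun k _ => ?_))
    · exact (contDiff_moll ((hv k).locallyIntegrable hq1) j).continuous.norm.aestronglyMeasurable
    · rw [eLpNorm_norm]
      exact eLpNorm_moll_le (hv k).1 hq1 (by simp) j
  refine ⟨hu.1, ?_⟩
  -- By Lebesgue differentiation the mollifications converge almost everywhere, and Fatou's lemma
  -- transfers the uniform Lˢ bound to u.
  have hae : ∀ᵐ x, Tendsto (fun j => moll j u x) atTop (𝓝 (u x)) :=
    ContDiffBump.ae_convolution_tendsto_right_of_locallyIntegrable (K := 2) (tendsto_bump_rOut n)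
      (Eventually.of_forall fun j => by simp only [bump]; field_simp; exact le_rfl) lu
  have := Lp.eLpNorm_lim_le_liminf_eLpNorm (p := s)
    (fun j => (contDiff_moll lu j).continuous.aestronglyMeasurable) u hae
  refine this.trans_lt (lt_of_le_of_lt (liminf_le_of_frequently_le'
    (Frequently.of_forall hbound)) ?_)
  exact ENNReal.mul_lt_top ENNReal.coe_lt_top (ENNReal.sum_lt_top.2 fun k _ => (hv k).2)

/-- A first-order pairing `∫ a · ∂u + b u` with `a ∈ Lᵖ_loc`, `b ∈ Lᵗ_loc` that is nonnegative on
nonnegative test functions converges and is nonnegative on nonnegative compactly supported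
`u ∈ W^{1,q} ∩ Lˢ`, where `1/p + 1/q = 1/t + 1/s = 1`. -/
lemma pairing_nonneg_of_test {p q s t : ℝ≥0∞} [ENNReal.HolderConjugate p q]
    [ENNReal.HolderConjugate t s] (hq' : q ≠ ⊤) (hs' : s ≠ ⊤) (hΩ : IsOpen Ω)
    {a : Fin n → Model n → ℝ} {b : Model n → ℝ}
    (ha : ∀ k, MemLpLoc p Ω (a k)) (hb : MemLpLoc t Ω b)
    (htest : ∀ φ : Model n → ℝ, ContDiff ℝ ∞ φ → HasCompactSupport φ → tsupport φ ⊆ Ω →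
      (∀ y, 0 ≤ φ y) → 0 ≤ ∫ y, (∑ k, a k y * pderiv k φ y + b y * φ y))
    {u : Model n → ℝ} {v : Fin n → Model n → ℝ} {K : Set (Model n)} (hK : IsCompact K)
    (hKΩ : K ⊆ Ω) (huK : ∀ y ∉ K, u y = 0) (hvK : ∀ k, ∀ y ∉ K, v k y = 0)
    (hu0 : ∀ᵐ y, 0 ≤ u y)
    (huv : ∀ k, HasWeakPartial univ k u (v k)) (hu : MemLp u q volume)
    (hv : ∀ k, MemLp (v k) q volume) (hus : MemLp u s volume) :
    Integrable (fun y => ∑ k, a k y * v k y + b y * u y) ∧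
      0 ≤ ∫ y, (∑ k, a k y * v k y + b y * u y) := by
  have hq : 1 ≤ q := ENNReal.HolderConjugate.one_le q p
  have hs : 1 ≤ s := ENNReal.HolderConjugate.one_le s t
  obtain ⟨δ, hδ, hδΩ⟩ := hK.exists_cthickening_subset_open hΩ hKΩ
  set L := Metric.cthickening δ K
  have hL : IsCompact L := hK.cthickening
  have hKL : K ⊆ L := Metric.self_subset_cthickening _
  have huc : tsupport u ⊆ K := closure_minimal (fun y hy => by
    by_contra h; exact hy (huK y h)) hK.isClosed
  have hvc : ∀ k, tsupport (v k) ⊆ K := fun k => closure_minimal (fun y hy => by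
    by_contra h; exact hy (hvK k y h)) hK.isClosed
  -- Truncating the coefficients to L makes them globally integrable. Nothing changes in the
  -- pairings, since u, its derivatives and their mollifications at small scale are supported in L.
  set A : Fin n → Model n → ℝ := fun k => L.indicator (a k) with hA
  set B : Model n → ℝ := L.indicator b with hB
  have mA : ∀ k, MemLp (A k) p volume := fun k =>
    (memLp_indicator_iff_restrict hL.measurableSet).2 (ha k L hL hδΩ)
  have mB : MemLp B t volume := (memLp_indicator_iff_restrict hL.measurableSet).2 (hb L hL hδΩ)
  have iAv : ∀ k, Integrable fun y => A k y * v k y := fun k =>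
    memLp_one_iff_integrable.1 ((hv k).mul' (r := 1) (mA k))
  have iBu : Integrable fun y => B y * u y :=
    memLp_one_iff_integrable.1 (hus.mul' (r := 1) mB)
  have heq : (fun y => ∑ k, a k y * v k y + b y * u y) =
      fun y => ∑ k, A k y * v k y + B y * u y := by
    ext y
    by_cases hy : y ∈ L
    · simp [hA, hB, hy]
    · have h1 : u y = 0 := huK y fun h => hy (hKL h)
      have h2 : ∀ k, v k y = 0 := fun k => hvK k y fun h => hy (hKL h)
      simp [h1, h2]
  rw [heq]
  have isum : Integrable fun y => ∑ k, A k y * v k y := integrable_finsetSum _ fun k _ => iAv k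
  refine ⟨isum.add iBu, ?_⟩
  have hlim : Tendsto (fun j => ∑ k, (∫ y, A k y * moll j (v k) y) + ∫ y, B y * moll j u y) atTop
      (𝓝 (∑ k, (∫ y, A k y * v k y) + ∫ y, B y * u y)) := by
    refine (tendsto_finsetSum _ fun k _ => ?_).add ?_
    · exact tendsto_integral_mul (mA k) (hv k) (fun j => memLp_moll hq hq' (hv k) j)
        (tendsto_eLpNorm_moll_sub hq hq' (hv k))
    · exact tendsto_integral_mul mB hus (fun j => memLp_moll hs hs' hus j)
        (tendsto_eLpNorm_moll_sub hs hs' hus)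
  rw [integral_add isum iBu, integral_finsetSum _ fun k _ => iAv k]
  refine ge_of_tendsto hlim ?_
  filter_upwards [(tendsto_bump_rOut n).eventually (gt_mem_nhds hδ)] with j hj
  have hsub : ∀ {f : Model n → ℝ}, tsupport f ⊆ K → tsupport (moll j f) ⊆ L := fun {f} hf =>
    (tsupport_moll_subset j f).trans ((Metric.cthickening_mono hj.le _).trans
      (Metric.cthickening_subset_of_subset _ hf))
  have lu := hu.locallyIntegrable hq
  have hpos := htest (moll j u) (contDiff_moll lu j)
    (hL.of_isClosed_subset (isClosed_tsupport _) (hsub huc)) ((hsub huc).trans hδΩ)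
    (moll_nonneg hu0 j)
  have heq' : (fun y => ∑ k, a k y * pderiv k (moll j u) y + b y * moll j u y) =
      fun y => ∑ k, A k y * moll j (v k) y + B y * moll j u y := by
    ext y
    simp_rw [pderiv_moll (huv _)]
    by_cases hy : y ∈ L
    · simp [hA, hB, hy]
    · have h1 : moll j u y = 0 := image_eq_zero_of_notMem_tsupport fun h => hy (hsub huc h)
      have h2 : ∀ k, moll j (v k) y = 0 := fun k =>
        image_eq_zero_of_notMem_tsupport fun h => hy (hsub (hvc k) h)
      simp [h1, h2]
  have i1 : ∀ k, Integrable fun y => A k y * moll j (v k) y := fun k =>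
    memLp_one_iff_integrable.1 ((memLp_moll hq hq' (hv k) j).mul' (r := 1) (mA k))
  have i2 : Integrable fun y => B y * moll j u y :=
    memLp_one_iff_integrable.1 ((memLp_moll hs hs' hus j).mul' (r := 1) mB)
  rw [heq', integral_add (integrable_finsetSum _ fun k _ => i1 k) i2,
    integral_finsetSum _ fun k _ => i1 k] at hpos
  exact hpos

end Sobolev


/-! ## Cutoff functions near sets of finite Hausdorff measure -/

section Capacity

open scoped NNReal

variable {n : ℕ}

/-- A compact set is covered by finitely many small balls whose radii are controlled by its
Hausdorff measure. -/
lemma exists_ball_cover {K : Set (Model n)} (hK : IsCompact K) {d : ℝ} (hd : 0 < d) {C : ℝ≥0∞}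
    (hC : Measure.hausdorffMeasure d K < C) {δ : ℝ} (hδ : 0 < δ) :
    ∃ (s : Finset ℕ) (x : ℕ → Model n) (r : ℕ → ℝ),
      (∀ i ∈ s, 0 < r i ∧ r i ≤ δ ∧ x i ∈ K) ∧ K ⊆ ⋃ i ∈ s, Metric.ball (x i) (r i) ∧
      ∑ i ∈ s, ENNReal.ofReal (r i) ^ d ≤ 2 ^ d * (C + C) := by
  classical
  have hC0 : C ≠ 0 := (pos_of_gt hC).ne'
  have hδ2 : 0 < ENNReal.ofReal (δ / 2) := ENNReal.ofReal_pos.2 (by linarith)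
  rw [Measure.hausdorffMeasure_apply] at hC
  -- The Hausdorff measure is a supremum over scales, so at scale δ/2 there is a covering whose sum
  -- of d-th powers of diameters is below C.
  have h1 := (le_iSup₂ (f := fun (r : ℝ≥0∞) (_ : 0 < r) =>
    ⨅ (t : ℕ → Set (Model n)) (_ : K ⊆ ⋃ n, t n) (_ : ∀ n, Metric.ediam (t n) ≤ r),
      ∑' n, ⨆ _ : (t n).Nonempty, Metric.ediam (t n) ^ d) _ hδ2).trans_lt hC
  simp only [iInf_lt_iff] at h1
  obtain ⟨t, hKt, htδ, hsum⟩ := h1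
  -- Covering sets may have diameter 0. The summable slack e allows positive radii for them, at a
  -- total cost below a second C.
  obtain ⟨e, he0, hesum⟩ := ENNReal.exists_pos_sum_of_countable' hC0 ℕ
  have hefin : ∀ i, e i ≠ ⊤ := fun i =>
    ((ENNReal.le_tsum i).trans_lt (hesum.trans_le le_top)).ne
  set ε : ℕ → ℝ := fun i => min (δ / 2) ((e i).toReal ^ (1 / d)) with hε
  have hε0 : ∀ i, 0 < ε i := fun i =>
    lt_min (by linarith) (Real.rpow_pos_of_pos (ENNReal.toReal_pos (he0 i).ne' (hefin i)) _)
  have hεe : ∀ i, ENNReal.ofReal (ε i) ^ d ≤ e i := fun i => by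
    calc ENNReal.ofReal (ε i) ^ d ≤ ENNReal.ofReal ((e i).toReal ^ (1 / d)) ^ d := by
          gcongr; exact min_le_right _ _
      _ = e i := by
          rw [← ENNReal.ofReal_rpow_of_pos (ENNReal.toReal_pos (he0 i).ne' (hefin i)),
            ENNReal.ofReal_toReal (hefin i), ← ENNReal.rpow_mul, one_div, inv_mul_cancel₀ hd.ne',
            ENNReal.rpow_one]
  have hfin : ∀ i, Metric.ediam (t i) ≠ ⊤ := fun i =>
    ((htδ i).trans_lt ENNReal.ofReal_lt_top).ne
  have hdiam : ∀ i, (Metric.ediam (t i)).toReal ≤ δ / 2 := fun i =>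
    ENNReal.toReal_le_of_le_ofReal (by linarith) (htδ i)
  -- The factor 2 makes the radius strictly larger than the diameter, so that an open ball centred
  -- at a point of t i contains all of t i. Open balls are needed to extract a finite subcover.
  set r : ℕ → ℝ := fun i => 2 * max (Metric.ediam (t i)).toReal (ε i) with hr
  have hr0 : ∀ i, 0 < r i := fun i => by
    have := (hε0 i).trans_le (le_max_right (Metric.ediam (t i)).toReal (ε i))
    simp only [hr]; linarith
  have hrδ : ∀ i, r i ≤ δ := fun i => by
    have : max (Metric.ediam (t i)).toReal (ε i) ≤ δ / 2 := max_le (hdiam i) (min_le_left _ _)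
    simp only [hr]; linarith
  have hrd : ∀ i, ENNReal.ofReal (r i) ^ d ≤ 2 ^ d * (Metric.ediam (t i) ^ d + e i) := fun i => by
    simp only [hr]
    rw [ENNReal.ofReal_mul (by norm_num), ENNReal.mul_rpow_of_nonneg _ _ hd.le]
    gcongr
    · simp
    · rcases max_cases (Metric.ediam (t i)).toReal (ε i) with h | h
      · rw [h.1, ENNReal.ofReal_toReal (hfin i)]; exact le_self_add
      · rw [h.1]; exact (hεe i).trans le_add_self
  have hx : ∀ i, ∃ x : Model n, (t i ∩ K).Nonempty → x ∈ t i ∩ K := fun i => by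
    by_cases h : (t i ∩ K).Nonempty
    · exact ⟨h.some, fun _ => h.some_mem⟩
    · exact ⟨0, fun h' => (h h').elim⟩
  choose x hx using hx
  obtain ⟨s, hs⟩ := hK.elim_finite_subcover
    (fun i => ⋃ _ : (t i ∩ K).Nonempty, Metric.ball (x i) (r i))
    (fun i => isOpen_iUnion fun _ => Metric.isOpen_ball) (fun y hy => by
      obtain ⟨i, hi⟩ := mem_iUnion.1 (hKt hy)
      have hne : (t i ∩ K).Nonempty := ⟨y, hi, hy⟩
      refine mem_iUnion.2 ⟨i, mem_iUnion.2 ⟨hne, ?_⟩⟩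
      rw [Metric.mem_ball]
      have h1 : dist y (x i) ≤ (Metric.ediam (t i)).toReal := by
        rw [dist_edist]
        exact ENNReal.toReal_mono (hfin i) (Metric.edist_le_ediam_of_mem hi (hx i hne).1)
      have h2 := (hε0 i).trans_le (le_max_right (Metric.ediam (t i)).toReal (ε i))
      have h3 := le_max_left (Metric.ediam (t i)).toReal (ε i)
      simp only [hr]; linarith)
  refine ⟨s.filter fun i => (t i ∩ K).Nonempty, x, r, fun i hi => ?_, fun y hy => ?_, ?_⟩
  · exact ⟨hr0 i, hrδ i, (hx i (Finset.mem_filter.1 hi).2).2⟩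
  · obtain ⟨i, hi, hyi⟩ := mem_iUnion₂.1 (hs hy)
    obtain ⟨hne, hyi⟩ := mem_iUnion.1 hyi
    exact mem_iUnion₂.2 ⟨i, Finset.mem_filter.2 ⟨hi, hne⟩, hyi⟩
  · calc ∑ i ∈ s.filter fun i => (t i ∩ K).Nonempty, ENNReal.ofReal (r i) ^ d
        ≤ ∑ i ∈ s.filter fun i => (t i ∩ K).Nonempty,
            2 ^ d * ((⨆ _ : (t i).Nonempty, Metric.ediam (t i) ^ d) + e i) := by
          refine Finset.sum_le_sum fun i hi => (hrd i).trans ?_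
          have hne : (t i).Nonempty := (Finset.mem_filter.1 hi).2.mono inter_subset_left
          simp [hne]
      _ ≤ ∑' i, 2 ^ d * ((⨆ _ : (t i).Nonempty, Metric.ediam (t i) ^ d) + e i) :=
          ENNReal.sum_le_tsum _
      _ = 2 ^ d * (∑' i, (⨆ _ : (t i).Nonempty, Metric.ediam (t i) ^ d) + ∑' i, e i) := by
          rw [ENNReal.tsum_mul_left, ENNReal.tsum_add]
      _ ≤ _ := by gcongr

/-- The function is a minimum of truncated cones, one for each ball, rising from 0 to 1 between
radius rᵢ and 2rᵢ with slope 1/rᵢ. At a point the local slope of a minimum is at most the largest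
slope among the cones whose doubled ball contains the point, so its q-th power is at most the sum of
the q-th powers. Using a maximum instead of a sum of slopes gives a bound with no control on the
overlap of the balls. -/
lemma exists_lipschitz_cutoff_of_balls {q : ℝ} (hq : 0 < q) (x : ℕ → Model n) (r : ℕ → ℝ)
    (s : Finset ℕ) (hr : ∀ i ∈ s, 0 < r i) :
    ∃ η : Model n → ℝ, (∃ C : ℝ≥0, LipschitzWith C η) ∧ (∀ y, η y ∈ Icc (0 : ℝ) 1) ∧
      (∀ i ∈ s, ∀ y ∈ Metric.ball (x i) (r i), η y = 0) ∧
      (∀ y, (∀ i ∈ s, y ∉ Metric.closedBall (x i) (2 * r i)) → η y = 1) ∧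
      ∀ y, ∃ L : ℝ, 0 ≤ L ∧ L ^ q ≤
        ∑ i ∈ s, (Metric.closedBall (x i) (2 * r i)).indicator (fun _ => (r i)⁻¹ ^ q) y ∧
        ∀ᶠ z in 𝓝 y, ‖η z - η y‖ ≤ L * ‖z - y‖ := by
  classical
  induction s using Finset.induction_on with
  | empty =>
    refine ⟨fun _ => 1, ⟨0, LipschitzWith.const 1⟩, by simp, by simp, by simp, fun y =>
      ⟨0, le_rfl, by simp [Real.zero_rpow hq.ne'], by simp⟩⟩
  | insert i s hi ih =>
    obtain ⟨η, ⟨C, hC⟩, h01, h0, h1, hL⟩ := ih fun j hj => hr j (Finset.mem_insert_of_mem hj)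
    have hri : 0 < r i := hr i (Finset.mem_insert_self _ _)
    set φ : Model n → ℝ := fun y => max 0 (min 1 ((dist y (x i) - r i) * (r i)⁻¹)) with hφ
    have hφL : LipschitzWith (r i)⁻¹.toNNReal φ := by
      refine LipschitzWith.of_dist_le_mul fun y z => ?_
      rw [Real.coe_toNNReal _ (inv_nonneg.2 hri.le), Real.dist_eq]
      calc |φ y - φ z| ≤ max |(0 : ℝ) - 0| |min 1 ((dist y (x i) - r i) * (r i)⁻¹) -
            min 1 ((dist z (x i) - r i) * (r i)⁻¹)| := abs_max_sub_max_le_max _ _ _ _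
        _ ≤ max |(0 : ℝ) - 0| (max |(1 : ℝ) - 1| |(dist y (x i) - r i) * (r i)⁻¹ -
            (dist z (x i) - r i) * (r i)⁻¹|) :=
            max_le_max le_rfl (abs_min_sub_min_le_max _ _ _ _)
        _ ≤ (r i)⁻¹ * dist y z := by
            have : |(dist y (x i) - r i) * (r i)⁻¹ - (dist z (x i) - r i) * (r i)⁻¹| =
                (r i)⁻¹ * |dist y (x i) - dist z (x i)| := by
              rw [← sub_mul, abs_mul, abs_of_pos (inv_pos.2 hri)]; ring_nf
            have h2 : 0 ≤ (r i)⁻¹ * dist y z := by positivity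
            rw [this]
            simp only [sub_self, abs_zero]
            refine max_le h2 (max_le h2 ?_)
            exact mul_le_mul_of_nonneg_left (abs_dist_sub_le _ _ _) (inv_nonneg.2 hri.le)
    have hφ01 : ∀ y, φ y ∈ Icc (0 : ℝ) 1 := fun y =>
      ⟨le_max_left _ _, max_le zero_le_one (min_le_left _ _)⟩
    have hφ1 : ∀ y, y ∉ Metric.closedBall (x i) (2 * r i) → φ y = 1 := fun y hy => by
      rw [Metric.mem_closedBall, not_le] at hy
      have : 1 ≤ (dist y (x i) - r i) * (r i)⁻¹ := by
        rw [← div_eq_mul_inv, le_div_iff₀ hri]; linarith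
      simp [hφ, min_eq_left this]
    refine ⟨fun y => min (η y) (φ y), ⟨_, hC.min hφL⟩, fun y =>
      ⟨le_min (h01 y).1 (hφ01 y).1, (min_le_left _ _).trans (h01 y).2⟩, ?_, ?_, fun y => ?_⟩
    · intro j hj y hy
      rcases Finset.mem_insert.1 hj with rfl | hj
      · have : φ y = 0 := by
          rw [Metric.mem_ball] at hy
          have : (dist y (x j) - r j) * (r j)⁻¹ ≤ 0 :=
            mul_nonpos_of_nonpos_of_nonneg (by linarith) (inv_nonneg.2 hri.le)
          simp only [hφ]
          exact max_eq_left ((min_le_right _ _).trans this)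
        change min (η y) (φ y) = 0
        rw [this]
        exact min_eq_right (h01 y).1
      · change min (η y) (φ y) = 0
        rw [h0 j hj y hy]
        exact min_eq_left (hφ01 y).1
    · intro y hy
      change min (η y) (φ y) = 1
      rw [h1 y fun j hj => hy j (Finset.mem_insert_of_mem hj),
        hφ1 y (hy i (Finset.mem_insert_self _ _)), min_self]
    · obtain ⟨L, hL0, hLq, hLy⟩ := hL y
      rw [Finset.sum_insert hi]
      have hsum0 : 0 ≤ ∑ j ∈ s, (Metric.closedBall (x j) (2 * r j)).indicator
          (fun _ => (r j)⁻¹ ^ q) y := (Real.rpow_nonneg hL0 _).trans hLq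
      -- Outside the closed doubled ball the new cone is identically 1 nearby, so the minimum with
      -- it changes neither the function nor its slope.
      by_cases hy : y ∈ Metric.closedBall (x i) (2 * r i)
      · refine ⟨max L (r i)⁻¹, hL0.trans (le_max_left _ _), ?_, ?_⟩
        · rw [indicator_of_mem hy]
          have : (0 : ℝ) ≤ (r i)⁻¹ ^ q := Real.rpow_nonneg (inv_nonneg.2 hri.le) _
          rcases max_cases L (r i)⁻¹ with h | h
          · rw [h.1]; linarith
          · rw [h.1]; linarith
        · filter_upwards [hLy] with z hz
          rw [Real.norm_eq_abs]
          refine (abs_min_sub_min_le_max _ _ _ _).trans (max_le ?_ ?_)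
          · exact hz.trans (mul_le_mul_of_nonneg_right (le_max_left _ _) (norm_nonneg _))
          · have := hφL.dist_le_mul z y
            rw [Real.coe_toNNReal _ (inv_nonneg.2 hri.le), Real.dist_eq, dist_eq_norm] at this
            exact this.trans (mul_le_mul_of_nonneg_right (le_max_right _ _) (norm_nonneg _))
      · refine ⟨L, hL0, by rw [indicator_of_notMem hy, zero_add]; exact hLq, ?_⟩
        filter_upwards [hLy, Metric.isClosed_closedBall.isOpen_compl.mem_nhds hy] with z hz hz'
        simp only [hφ1 z hz', hφ1 y hy, min_eq_left (h01 _).2]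
        exact hz

end Capacity


/-! ## Removing a set of vanishing capacity -/

section Removal

open scoped NNReal

variable {n : ℕ} {Ω : Set (Model n)}

lemma norm_coordVec (k : Fin n) : ‖(coordVec k : Model n)‖ = 1 := by simp [coordVec]

/-- Lipschitz functions are weakly differentiable. -/
lemma hasWeakPartial_of_lipschitzWith {η : Model n → ℝ} {C : ℝ≥0} (hη : LipschitzWith C η)
    (k : Fin n) : HasWeakPartial univ k η (fun y => lineDeriv ℝ η y (coordVec k)) := by
  refine hasWeakPartial_of_integral_eq (hη.continuous.locallyIntegrable.locallyIntegrableOn _)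
    ((hη.locallyIntegrable_lineDeriv (μ := volume) _).locallyIntegrableOn _) fun φ hφ hc _ => ?_
  obtain ⟨D, hD⟩ := (hφ.of_le (by simp) : ContDiff ℝ 1 φ).lipschitzWith_of_hasCompactSupport hc
    one_ne_zero
  have h1 := LipschitzWith.integral_lineDeriv_mul_eq (μ := volume) hη hD hc (coordVec k : Model n)
  have h2 : ∀ y, lineDeriv ℝ φ y (-coordVec k) = - pderiv k φ y := fun y => by
    rw [(hφ.differentiable (by simp) y).lineDeriv_eq_fderiv, map_neg]; rfl
  simp_rw [h2, neg_mul, integral_neg] at h1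
  rw [h1, neg_neg]
  simp_rw [mul_comm]

/-- Cutoff functions vanishing near a compact set `K` whose gradients are bounded in `Lᵠ` by the
`(n - q)`-dimensional Hausdorff measure of `K`. -/
lemma exists_capacity_cutoff {q : ℝ} (hq : 1 ≤ q) (hqn : q < n) :
    ∃ c : ℝ≥0∞, c ≠ ⊤ ∧ ∀ (K : Set (Model n)) (C : ℝ≥0∞) (δ : ℝ), IsCompact K →
      Measure.hausdorffMeasure (n - q) K < C → 0 < δ →
      ∃ (η : Model n → ℝ) (w : Fin n → Model n → ℝ) (O : Set (Model n)), IsOpen O ∧ K ⊆ O ∧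
        Continuous η ∧ (∀ y, η y ∈ Icc (0 : ℝ) 1) ∧ (∀ y ∈ O, η y = 0) ∧
        (∀ y ∉ Metric.cthickening δ K, η y = 1) ∧ (∀ k, HasWeakPartial univ k η (w k)) ∧
        (∀ k, ∀ y ∉ Metric.cthickening δ K, w k y = 0) ∧ (∀ k, Measurable (w k)) ∧
        ∀ k, ∫⁻ y, ‖w k y‖ₑ ^ q ≤ c * C := by
  have hq0 : 0 < q := by linarith
  set β : ℝ≥0∞ := volume (Metric.ball (0 : Model n) 1) with hβ
  have hβt : β ≠ ⊤ := measure_ball_lt_top.ne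
  -- A doubled ball has volume 2ⁿ β rⁿ and carries a gradient of size at most 1/r, contributing 2ⁿ β
  -- r^{n-q}. The last factor is the constant of the ball covering in dimension n - q.
  refine ⟨2 ^ n * β * (2 ^ ((n : ℝ) - q) * 2), ?_, fun K C δ hK hC hδ => ?_⟩
  · refine ENNReal.mul_ne_top (ENNReal.mul_ne_top (by simp) hβt) (ENNReal.mul_ne_top ?_ (by simp))
    exact ENNReal.rpow_ne_top_of_nonneg (by linarith) (by simp)
  -- Radii at most δ/2 keep the doubled balls, which are centred in K, inside the δ-thickening.
  obtain ⟨s, x, r, hsr, hKs, hsum⟩ := exists_ball_cover hK (sub_pos.2 hqn) hC (half_pos hδ)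
  obtain ⟨η, ⟨D, hD⟩, h01, h0, h1, hL⟩ :=
    exists_lipschitz_cutoff_of_balls hq0 x r s fun i hi => (hsr i hi).1
  have hsub : ∀ i ∈ s, Metric.closedBall (x i) (2 * r i) ⊆ Metric.cthickening δ K := by
    intro i hi y hy
    refine Metric.mem_cthickening_of_dist_le y (x i) _ _ (hsr i hi).2.2 ?_
    have := (hsr i hi).2.1
    exact (Metric.mem_closedBall.1 hy).trans (by linarith)
  have hwL : ∀ (k : Fin n) (y : Model n), |lineDeriv ℝ η y (coordVec k)| ^ q ≤
      ∑ i ∈ s, (Metric.closedBall (x i) (2 * r i)).indicator (fun _ => (r i)⁻¹ ^ q) y := by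
    intro k y
    obtain ⟨L, hL0, hLq, hLy⟩ := hL y
    have := norm_lineDeriv_le_of_lip' ℝ (v := (coordVec k : Model n)) hL0 hLy
    rw [norm_coordVec, mul_one] at this
    exact (Real.rpow_le_rpow (abs_nonneg _) this hq0.le).trans hLq
  refine ⟨η, fun k y => lineDeriv ℝ η y (coordVec k), ⋃ i ∈ s, Metric.ball (x i) (r i),
    isOpen_biUnion fun _ _ => Metric.isOpen_ball, hKs, hD.continuous, h01, ?_, ?_,
    hasWeakPartial_of_lipschitzWith hD, ?_, fun k => measurable_lineDeriv hD.continuous, fun k => ?_⟩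
  · intro y hy
    obtain ⟨i, hi, hyi⟩ := mem_iUnion₂.1 hy
    exact h0 i hi y hyi
  · exact fun y hy => h1 y fun i hi h => hy (hsub i hi h)
  · intro k y hy
    have h2 := hwL k y
    rw [Finset.sum_eq_zero fun i hi => indicator_of_notMem (fun h => hy (hsub i hi h)) _] at h2
    by_contra hne
    exact absurd h2 (not_le.2 (Real.rpow_pos_of_pos (abs_pos.2 hne) _))
  · calc ∫⁻ y, ‖lineDeriv ℝ η y (coordVec k)‖ₑ ^ q
        ≤ ∫⁻ y, ∑ i ∈ s, (Metric.closedBall (x i) (2 * r i)).indicator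
            (fun _ => ENNReal.ofReal ((r i)⁻¹ ^ q)) y := by
          refine lintegral_mono fun y => ?_
          rw [Real.enorm_eq_ofReal_abs, ENNReal.ofReal_rpow_of_nonneg (abs_nonneg _) hq0.le]
          refine (ENNReal.ofReal_le_ofReal (hwL k y)).trans (le_of_eq ?_)
          rw [ENNReal.ofReal_sum_of_nonneg]
          · refine Finset.sum_congr rfl fun i _ => ?_
            by_cases hy : y ∈ Metric.closedBall (x i) (2 * r i) <;> simp [hy]
          · intro i hi
            exact indicator_nonneg (fun _ _ =>
              Real.rpow_nonneg (inv_nonneg.2 (hsr i hi).1.le) _) _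
      _ = ∑ i ∈ s, ENNReal.ofReal ((r i)⁻¹ ^ q) * volume (Metric.closedBall (x i) (2 * r i)) := by
          rw [lintegral_finsetSum _ fun i _ =>
            measurable_const.indicator Metric.isClosed_closedBall.measurableSet]
          refine Finset.sum_congr rfl fun i _ => ?_
          rw [lintegral_indicator_const Metric.isClosed_closedBall.measurableSet]
      _ = ∑ i ∈ s, 2 ^ n * β * ENNReal.ofReal (r i) ^ ((n : ℝ) - q) := by
          refine Finset.sum_congr rfl fun i hi => ?_
          have hri := (hsr i hi).1
          rw [Measure.addHaar_closedBall _ _ (by linarith), finrank_euclideanSpace_fin,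
            ENNReal.ofReal_rpow_of_pos hri, Real.rpow_sub hri, Real.rpow_natCast, mul_pow,
            Real.inv_rpow hri.le, ← mul_assoc, ← ENNReal.ofReal_mul (by positivity),
            show (r i ^ q)⁻¹ * (2 ^ n * r i ^ n) = 2 ^ n * (r i ^ n / r i ^ q) by
              rw [div_eq_mul_inv]; ring,
            ENNReal.ofReal_mul (by positivity), ENNReal.ofReal_pow (by norm_num)]
          simp only [ENNReal.ofReal_ofNat]
          ring
      _ = 2 ^ n * β * ∑ i ∈ s, ENNReal.ofReal (r i) ^ ((n : ℝ) - q) := by rw [Finset.mul_sum]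
      _ ≤ 2 ^ n * β * (2 ^ ((n : ℝ) - q) * (C + C)) := by gcongr
      _ = _ := by ring

/-- Sets of finite Hausdorff measure of codimension more than `0` are Lebesgue null. -/
lemma volume_eq_zero_of_hausdorffMeasure {K : Set (Model n)} {d : ℝ} (hd : d < n)
    (hK : Measure.hausdorffMeasure d K ≠ ⊤) : volume K = 0 := by
  have h1 : Measure.hausdorffMeasure (n : ℝ) K = 0 := by
    rcases Measure.hausdorffMeasure_zero_or_top hd K with h | h
    · exact h
    · exact (hK h).elim
  -- For the sup norm the n-dimensional Hausdorff measure is Lebesgue measure, and the identity from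
  -- the Euclidean to the sup norm is Lipschitz and volume preserving.
  have h2 : Measure.hausdorffMeasure (n : ℝ) ((WithLp.ofLp : Model n → Fin n → ℝ) '' K) = 0 := by
    have := (PiLp.lipschitzWith_ofLp 2 fun _ : Fin n => ℝ).hausdorffMeasure_image_le
      (Nat.cast_nonneg n) K
    rw [h1, mul_zero] at this
    exact le_antisymm this zero_le
  have h3 : volume ((WithLp.ofLp : Model n → Fin n → ℝ) '' K) = 0 := by
    rw [← hausdorffMeasure_pi_real, Fintype.card_fin]
    exact h2
  have h4 := (PiLp.volume_preserving_ofLp (Fin n)).quasiMeasurePreserving.preimage_null h3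
  exact measure_mono_null (subset_preimage_image _ _) h4

end Removal


/-! ### Extending positivity across a small singular set -/

section Removal

variable {n : ℕ} {Ω : Set (Model n)}

/-- Positivity of a first-order pairing extends across a set of vanishing `q`-capacity. -/
lemma pairing_test_nonneg_of_off {p q s t : ℝ≥0∞} [ENNReal.HolderConjugate p q]
    [ENNReal.HolderConjugate t s] (hq' : q ≠ ⊤) (hs' : s ≠ ⊤) (hΩ : IsOpen Ω)
    (hqn : q.toReal < n) {Z : Set (Model n)} (hZ : IsOpen (Ω \ Z))
    (hZ1 : p ≠ ⊤ → Measure.hausdorffMeasure (n - q.toReal) Z ≠ ⊤)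
    (hZ2 : p = ⊤ → Measure.hausdorffMeasure (n - q.toReal) Z = 0)
    {a : Fin n → Model n → ℝ} {b : Model n → ℝ}
    (ha : ∀ k, MemLpLoc p Ω (a k)) (hb : MemLpLoc t Ω b)
    (htest : ∀ φ : Model n → ℝ, ContDiff ℝ ∞ φ → HasCompactSupport φ → tsupport φ ⊆ Ω \ Z →
      (∀ y, 0 ≤ φ y) → 0 ≤ ∫ y, (∑ k, a k y * pderiv k φ y + b y * φ y))
    {φ : Model n → ℝ} (hφ : ContDiff ℝ ∞ φ) (hc : HasCompactSupport φ) (hs : tsupport φ ⊆ Ω)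
    (hφ0 : ∀ y, 0 ≤ φ y) : 0 ≤ ∫ y, (∑ k, a k y * pderiv k φ y + b y * φ y) := by
  have hq : 1 ≤ q := ENNReal.HolderConjugate.one_le q p
  have hp : 1 ≤ p := ENNReal.HolderConjugate.one_le p q
  have ht : 1 ≤ t := ENNReal.HolderConjugate.one_le t s
  have hq1 : 1 ≤ q.toReal := by
    rw [← ENNReal.toReal_one]; exact ENNReal.toReal_mono hq' hq
  have hq0 : q ≠ 0 := (zero_lt_one.trans_le hq).ne'
  have hqr : 0 < q.toReal := by linarith
  set K := tsupport φ ∩ Z with hKdef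
  -- Z need not be closed: K is the compact support of φ minus the open set Ω \ Z.
  have hK : IsCompact K := by
    have : K = tsupport φ \ (Ω \ Z) := by
      ext y; constructor
      · rintro ⟨h1, h2⟩; exact ⟨h1, fun h => h.2 h2⟩
      · rintro ⟨h1, h2⟩; exact ⟨h1, by by_contra h; exact h2 ⟨hs h1, h⟩⟩
    rw [this]
    exact hc.isCompact.diff hZ
  have hKZ : Measure.hausdorffMeasure (n - q.toReal) K ≤ Measure.hausdorffMeasure (n - q.toReal) Z :=
    measure_mono inter_subset_right
  have hKtop : Measure.hausdorffMeasure (n - q.toReal) K ≠ ⊤ := by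
    by_cases h : p = ⊤
    · rw [hZ2 h] at hKZ; exact (hKZ.trans_lt (by simp)).ne
    · exact (hKZ.trans_lt (lt_top_iff_ne_top.2 (hZ1 h))).ne
  have hvol : volume K = 0 := volume_eq_zero_of_hausdorffMeasure (by linarith) hKtop
  obtain ⟨c, hct, hcap⟩ := exists_capacity_cutoff hq1 hqn
  -- admissible bounds for the capacity
  obtain ⟨C, hCK, hCt, hClim⟩ : ∃ C : ℕ → ℝ≥0∞,
      (∀ j, Measure.hausdorffMeasure (n - q.toReal) K < C j) ∧
      (∃ B : ℝ≥0∞, B ≠ ⊤ ∧ ∀ j, C j ≤ B) ∧ (p = ⊤ → Tendsto C atTop (𝓝 0)) := by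
    by_cases h : p = ⊤
    · have h0 : Measure.hausdorffMeasure (n - q.toReal) K = 0 :=
        le_antisymm (by rw [← hZ2 h]; exact hKZ) zero_le
      refine ⟨fun j => ((j : ℝ≥0∞) + 1)⁻¹, fun j => ?_, ⟨1, by simp, fun j => ?_⟩, fun _ => ?_⟩
      · rw [h0]; exact ENNReal.inv_pos.2 (by finiteness)
      · rw [ENNReal.inv_le_one]; exact le_add_self
      · have h1 := (tendsto_add_atTop_iff_nat 1).2 ENNReal.tendsto_inv_nat_nhds_zero
        refine h1.congr fun j => ?_
        push_cast; rfl
    · exact ⟨fun _ => Measure.hausdorffMeasure (n - q.toReal) K + 1,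
        fun _ => ENNReal.lt_add_right hKtop one_ne_zero, ⟨_, by finiteness, fun _ => le_rfl⟩,
        fun h' => (h h').elim⟩
  set δ : ℕ → ℝ := fun j => 1 / ((j : ℝ) + 1) with hδ
  have hδ0 : ∀ j, 0 < δ j := fun j => by positivity
  have hδlim : Tendsto δ atTop (𝓝 0) := tendsto_one_div_add_atTop_nhds_zero_nat
  choose η w O hO hKO hηc hη01 hηO hη1 hηw hw0 hwm hwq using
    fun j => hcap K (C j) (δ j) hK (hCK j) (hδ0 j)
  have hwnorm : ∀ j k, eLpNorm (w j k) q volume ≤ (c * C j) ^ (1 / q.toReal) := fun j k => by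
    rw [eLpNorm_eq_lintegral_rpow_enorm_toReal hq0 hq']
    exact ENNReal.rpow_le_rpow (hwq j k) (by positivity)
  have hcC : ∀ j, c * C j ≠ ⊤ := fun j =>
    ENNReal.mul_ne_top hct ((hCt.choose_spec.2 j).trans_lt
      (lt_top_iff_ne_top.2 hCt.choose_spec.1)).ne
  have hwLq : ∀ j k, MemLp (w j k) q volume := fun j k =>
    ⟨(hwm j k).aestronglyMeasurable, (hwnorm j k).trans_lt
      (lt_top_iff_ne_top.2 (ENNReal.rpow_ne_top_of_nonneg (by positivity) (hcC j)))⟩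
  -- integrability of the pairing
  have lp : ∀ k, MemLp (fun y => φ y * a k y) p volume := fun k =>
    (ha k).memLp_mul hφ.continuous hc hs
  have ia : ∀ k, Integrable fun y => a k y * pderiv k φ y := fun k =>
    integrable_mul_of_locallyIntegrableOn ((ha k).locallyIntegrableOn hΩ hp)
      (contDiff_pderiv hφ k).continuous (hc.pderiv k) ((tsupport_pderiv_subset k φ).trans hs)
  have ib : Integrable fun y => b y * φ y :=
    integrable_mul_of_locallyIntegrableOn (hb.locallyIntegrableOn hΩ ht) hφ.continuous hc hs
  set Ψ : Model n → ℝ := fun y => ∑ k, a k y * pderiv k φ y + b y * φ y with hΨ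
  have iΨ : Integrable Ψ := (integrable_finsetSum _ fun k _ => ia k).add ib
  have iw : ∀ j k, Integrable fun y => φ y * a k y * w j k y := fun j k =>
    memLp_one_iff_integrable.1 ((hwLq j k).mul' (r := 1) (lp k))
  have iηΨ : ∀ j, Integrable fun y => η j y * Ψ y := fun j =>
    integrable_of_bounded_mul (C := 1) (hηc j).aestronglyMeasurable iΨ fun y => by
      rw [abs_of_nonneg (hη01 j y).1]; exact (hη01 j y).2
  -- the cut off functions are admissible
  have hpos : ∀ j, 0 ≤ (∫ y, η j y * Ψ y) + ∑ k, ∫ y, φ y * a k y * w j k y := by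
    intro j
    set L := tsupport φ \ O j with hL
    have hLc : IsCompact L := hc.isCompact.diff (hO j)
    have hφη : ∀ y ∉ L, φ y * η j y = 0 := fun y hy => by
      by_cases h : y ∈ tsupport φ
      · have : y ∈ O j := by by_contra h'; exact hy ⟨h, h'⟩
        rw [hηO j y this, mul_zero]
      · rw [image_eq_zero_of_notMem_tsupport h, zero_mul]
    -- On the open set where η vanishes its weak derivative is 0 only almost everywhere. The
    -- approximation lemma asks for vanishing at every point off a compact set, so the derivative is
    -- then truncated to L.
    have hv0 : ∀ k, ∀ᵐ y, y ∉ L → φ y * w j k y + pderiv k φ y * η j y = 0 := by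
      intro k
      have hw := (hasWeakPartial_of_contDiffOn (hO j)
        ((contDiff_const (c := (0 : ℝ))).contDiffOn.congr fun y hy => hηO j y hy) k).ae_eq (hO j)
        ((hηw j k).mono (subset_univ _))
      rw [ae_restrict_iff' (hO j).measurableSet] at hw
      filter_upwards [hw] with y hy hyL
      by_cases h : y ∈ tsupport φ
      · have hyO : y ∈ O j := by by_contra h'; exact hyL ⟨h, h'⟩
        have h0 : pderiv k (η j) y = 0 := by
          refine pderiv_eq_zero_of_eventually_const (c := 0) ?_ k
          filter_upwards [(hO j).mem_nhds hyO] with z hz using hηO j z hz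
        rw [← hy hyO, h0, hηO j y hyO]; simp
      · have h2 : pderiv k φ y = 0 :=
          image_eq_zero_of_notMem_tsupport fun h' => h (tsupport_pderiv_subset k φ h')
        rw [image_eq_zero_of_notMem_tsupport h, h2]; simp
    have hcut : ∀ k, HasWeakPartial univ k (fun y => φ y * η j y)
        (fun y => φ y * w j k y + pderiv k φ y * η j y) := fun k =>
      (hηw j k).cutoff hφ hc (subset_univ _)
    set V : Fin n → Model n → ℝ := fun k => L.indicator
      (fun y => φ y * w j k y + pderiv k φ y * η j y) with hV
    have hVae : ∀ k, ∀ᵐ y, φ y * w j k y + pderiv k φ y * η j y = V k y := fun k =>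
      (hv0 k).mono fun y hy => by
        by_cases h : y ∈ L
        · simp [hV, h]
        · simp [hV, h, hy h]
    have hηφc : Continuous fun y => φ y * η j y := hφ.continuous.mul (hηc j)
    have hηφs : HasCompactSupport fun y => φ y * η j y := hc.mul_right
    have mv : ∀ k, MemLp (fun y => φ y * w j k y + pderiv k φ y * η j y) q volume := by
      intro k
      refine MemLp.add ?_ ?_
      · exact (hwLq j k).mul' (p := ⊤) (hφ.continuous.memLp_of_hasCompactSupport hc)
      · exact ((contDiff_pderiv hφ k).continuous.mul (hηc j)).memLp_of_hasCompactSupport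
          (hc.pderiv k).mul_right
    -- The product φη is merely Lipschitz, but it is nonnegative and supported in a compact subset
    -- of Ω \ Z, so mollification reduces it to the smooth test functions of `htest`.
    have key := (pairing_nonneg_of_test hq' hs' hZ (fun k => (ha k).mono sdiff_subset)
      (hb.mono sdiff_subset) htest hLc (fun y hy => ⟨hs hy.1, fun h => hy.2 (hKO j ⟨hy.1, h⟩)⟩)
      hφη (fun k y hy => by simp [hV, hy])
      (Eventually.of_forall fun y => mul_nonneg (hφ0 y) (hη01 j y).1)
      (fun k => (hcut k).congr_ae (Eventually.of_forall fun _ => rfl)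
        (by rw [Measure.restrict_univ]; exact hVae k))
      (hηφc.memLp_of_hasCompactSupport hηφs)
      (fun k => (memLp_congr_ae (hVae k)).1 (mv k))
      (hηφc.memLp_of_hasCompactSupport hηφs) (s := s) (t := t)).2
    rw [← integral_finsetSum _ fun k _ => iw j k,
      ← integral_add (iηΨ j) (integrable_finsetSum _ fun k _ => iw j k)]
    refine key.trans_eq (integral_congr_ae ?_)
    filter_upwards [ae_all_iff.2 hVae] with y hy
    simp only [hΨ, ← hy, mul_add, Finset.mul_sum, Finset.sum_add_distrib]
    rw [add_comm (∑ k, a k y * (φ y * w j k y)), add_assoc, add_comm (∑ k, _) (b y * _), ← add_assoc]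
    congr 1
    · congr 1
      · exact Finset.sum_congr rfl fun k _ => by ring
      · ring
    · exact Finset.sum_congr rfl fun k _ => by ring
  -- passage to the limit
  have lim1 : Tendsto (fun j => ∫ y, η j y * Ψ y) atTop (𝓝 (∫ y, Ψ y)) := by
    refine tendsto_integral_of_dominated_convergence (fun y => |Ψ y|)
      (fun j => (hηc j).aestronglyMeasurable.mul iΨ.1) iΨ.abs
      (fun j => Eventually.of_forall fun y => ?_) ?_
    · rw [norm_mul, Real.norm_eq_abs, Real.norm_eq_abs, abs_of_nonneg (hη01 j y).1]
      exact mul_le_of_le_one_left (abs_nonneg _) (hη01 j y).2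
    -- Off the closed null set K a point eventually leaves the shrinking thickenings, after which η
    -- equals 1 there.
    · filter_upwards [measure_eq_zero_iff_ae_notMem.1 hvol] with y hy
      refine tendsto_const_nhds.congr' ?_
      have hy' : y ∈ (⋂ ε > 0, Metric.cthickening ε K)ᶜ := by
        rw [← Metric.closure_eq_iInter_cthickening, hK.isClosed.closure_eq]; exact hy
      simp only [mem_compl_iff, mem_iInter, not_forall] at hy'
      obtain ⟨ε, hε, hyε⟩ := hy'
      filter_upwards [hδlim.eventually (gt_mem_nhds hε)] with j hj
      rw [hη1 j y fun h => hyε (Metric.cthickening_mono hj.le _ h), one_mul]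
  have lim2 : ∀ k, Tendsto (fun j => ∫ y, φ y * a k y * w j k y) atTop (𝓝 0) := by
    intro k
    set A : ℕ → ℝ≥0∞ := fun j => eLpNorm ((Metric.cthickening (δ j) K).indicator
      fun y => φ y * a k y) p volume with hA
    have hAle : ∀ j, A j ≤ eLpNorm (fun y => φ y * a k y) p volume := fun j =>
      eLpNorm_indicator_le _
    -- For p = ∞ the gradient norm tends to 0 because the Hausdorff measure vanishes. For p < ∞ it
    -- is only bounded, but the Lᵖ norm of φa over thickenings of a null set tends to 0; this
    -- absolute continuity fails for p = ∞.
    have hlim : Tendsto (fun j => A j * (c * C j) ^ (1 / q.toReal)) atTop (𝓝 0) := by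
      by_cases hpt : p = ⊤
      · have h1 : Tendsto (fun j => (c * C j) ^ (1 / q.toReal)) atTop (𝓝 0) := by
          have h2 : Tendsto (fun j => c * C j) atTop (𝓝 0) := by
            simpa using ENNReal.Tendsto.const_mul (hClim hpt) (Or.inr hct)
          have h3 := (ENNReal.continuous_rpow_const (y := 1 / q.toReal)).tendsto 0
          rw [ENNReal.zero_rpow_of_pos (by positivity)] at h3
          exact h3.comp h2
        have h4 := ENNReal.Tendsto.const_mul (a := eLpNorm (fun y => φ y * a k y) p volume) h1
          (Or.inr (lp k).2.ne)
        rw [mul_zero] at h4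
        exact tendsto_of_tendsto_of_tendsto_of_le_of_le tendsto_const_nhds h4 (fun _ => zero_le)
          fun j => by gcongr; exact hAle j
      · obtain ⟨B, hBt, hB⟩ := hCt
        have h1 : Tendsto A atTop (𝓝 0) := by
          have hvlim : Tendsto (fun j => volume (Metric.cthickening (δ j) K)) atTop (𝓝 0) := by
            have := (tendsto_measure_cthickening_of_isCompact hK (μ := volume)).comp hδlim
            rwa [hvol] at this
          rw [ENNReal.tendsto_nhds_zero]
          intro ε hε
          by_cases hεt : ε = ⊤
          · simp [hεt]
          obtain ⟨ρ, hρ, H⟩ := (lp k).eLpNorm_indicator_le hp hpt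
            (ENNReal.toReal_pos hε.ne' hεt)
          filter_upwards [(ENNReal.tendsto_nhds_zero.1 hvlim) _ (ENNReal.ofReal_pos.2 hρ)]
            with j hj
          have := H _ Metric.isClosed_cthickening.measurableSet hj
          rwa [ENNReal.ofReal_toReal hεt] at this
        have h2 : Tendsto (fun j => A j * (c * B) ^ (1 / q.toReal)) atTop (𝓝 0) := by
          have := ENNReal.Tendsto.mul_const (b := (c * B) ^ (1 / q.toReal)) h1
            (Or.inr (ENNReal.rpow_ne_top_of_nonneg (by positivity) (ENNReal.mul_ne_top hct hBt)))
          rwa [zero_mul] at this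
        refine tendsto_of_tendsto_of_tendsto_of_le_of_le tendsto_const_nhds h2 (fun _ => zero_le)
          fun j => ?_
        have := hB j
        simp only
        gcongr
    have hlim' := (ENNReal.tendsto_toReal ENNReal.zero_ne_top).comp hlim
    rw [ENNReal.toReal_zero] at hlim'
    refine squeeze_zero_norm (fun j => ?_) hlim'
    set I := (Metric.cthickening (δ j) K).indicator fun y => φ y * a k y with hI
    have hIm : MemLp I p volume := (lp k).indicator Metric.isClosed_cthickening.measurableSet
    -- The gradient of the cutoff lives in the thickening, so Hölder's inequality sees only the part
    -- of φa there.
    have e1 : ∫ y, φ y * a k y * w j k y = ∫ y, (I • w j k) y := by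
      congr 1; ext y
      by_cases hy : y ∈ Metric.cthickening (δ j) K
      · simp [hI, hy]
      · simp [hI, hy, hw0 j k y hy]
    have e2 : eLpNorm (I • w j k) 1 volume ≤ A j * (c * C j) ^ (1 / q.toReal) :=
      (eLpNorm_smul_le_mul_eLpNorm (p := p) (q := q) (hwLq j k).1 hIm.1).trans
        (mul_le_mul' le_rfl (hwnorm j k))
    rw [e1, ← toReal_enorm]
    refine ENNReal.toReal_mono ?_ ?_
    · exact ENNReal.mul_ne_top ((hAle j).trans_lt (lp k).2).ne
        (ENNReal.rpow_ne_top_of_nonneg (by positivity) (hcC j))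
    · refine (enorm_integral_le_lintegral_enorm _).trans ?_
      rw [← eLpNorm_one_eq_lintegral_enorm]
      exact e2
  have lim := lim1.add (tendsto_finsetSum Finset.univ fun k _ => lim2 k)
  simp only [Finset.sum_const_zero, add_zero] at lim
  exact ge_of_tendsto lim (Eventually.of_forall hpos)

end Removal


/-! ## Invariance of tensor contractions under a change of frame -/

section Tensor

variable {n : ℕ}

/-- Rank three arrays of components. -/
abbrev Arr3 (n : ℕ) : Type := Fin n → Fin n → Fin n → ℝ

/-- The components `Γᵏᵢⱼ` built from the inverse metric `N` and the covariant derivative `T`. -/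
def tChr (N : Matrix (Fin n) (Fin n) ℝ) (T : Arr3 n) (k i j : Fin n) : ℝ :=
  (1 / 2) * ∑ l, N k l * (T i j l + T j i l - T l i j)

/-- The covariant derivative of the inverse metric. -/
def tInv (N : Matrix (Fin n) (Fin n) ℝ) (T : Arr3 n) (k i j : Fin n) : ℝ :=
  - ∑ a, ∑ b, N i a * N j b * T k a b

/-- The components of `V` in terms of the difference tensor `A`. -/
def tV (N : Matrix (Fin n) (Fin n) ℝ) (A : Arr3 n) (k : Fin n) : ℝ :=
  ∑ i, ∑ j, (N i j * A k i j - N i k * A j j i)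

/-- The function `F` in terms of the difference tensor `A`, the covariant derivative `E` of the
inverse metric and the background Ricci tensor `R`. -/
def tF (N : Matrix (Fin n) (Fin n) ℝ) (A E : Arr3 n) (R : Matrix (Fin n) (Fin n) ℝ) : ℝ :=
  (∑ i, ∑ j, N i j * R i j) - (∑ k, ∑ i, ∑ j, E k i j * A k i j) +
  (∑ k, ∑ i, ∑ j, E k i k * A j j i) +
  ∑ i, ∑ j, N i j * ∑ k, ∑ l, (A k k l * A l i j - A k j l * A l i k)

/-- The action of two matrices on the two indices of an array. -/
def act2 (R S : Matrix (Fin n) (Fin n) ℝ) (X : Fin n → Fin n → ℝ) (i j : Fin n) : ℝ :=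
  ∑ a, R i a * ∑ b, S j b * X a b

/-- The action of three matrices on the three indices of an array. -/
def act3 (R S U : Matrix (Fin n) (Fin n) ℝ) (X : Arr3 n) (k i j : Fin n) : ℝ :=
  ∑ c, R k c * act2 S U (X c) i j

variable {R S U R' S' U' : Matrix (Fin n) (Fin n) ℝ}

lemma act2_swap (R S : Matrix (Fin n) (Fin n) ℝ) (X : Fin n → Fin n → ℝ) (i j : Fin n) :
    act2 R S X i j = act2 S R (fun b a => X a b) j i := by
  simp only [act2, Finset.mul_sum]
  rw [Finset.sum_comm]
  refine Finset.sum_congr rfl fun b _ => Finset.sum_congr rfl fun a _ => by ring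

lemma act3_eq_act2 (R S U : Matrix (Fin n) (Fin n) ℝ) (X : Arr3 n) (k i j : Fin n) :
    act3 R S U X k i j = act2 R S (fun c a => ∑ b, U j b * X c a b) k i := rfl

lemma act3_swap (R S U : Matrix (Fin n) (Fin n) ℝ) (X : Arr3 n) (k i j : Fin n) :
    act3 R S U X k i j = act3 S R U (fun a c b => X c a b) i k j := by
  rw [act3_eq_act2, act2_swap, act3_eq_act2]

lemma act3_swap' (R S U : Matrix (Fin n) (Fin n) ℝ) (X : Arr3 n) (k i j : Fin n) :
    act3 R S U X k i j = act3 R U S (fun c b a => X c a b) k j i := by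
  simp only [act3]
  exact Finset.sum_congr rfl fun c _ => by rw [act2_swap]

lemma act2_add (R S : Matrix (Fin n) (Fin n) ℝ) (X Y : Fin n → Fin n → ℝ) (i j : Fin n) :
    act2 R S (fun a b => X a b + Y a b) i j = act2 R S X i j + act2 R S Y i j := by
  simp only [act2, mul_add, Finset.sum_add_distrib]

lemma act2_smul (R S : Matrix (Fin n) (Fin n) ℝ) (c : ℝ) (X : Fin n → Fin n → ℝ) (i j : Fin n) :
    act2 R S (fun a b => c * X a b) i j = c * act2 R S X i j := by
  simp only [act2, Finset.mul_sum]
  exact Finset.sum_congr rfl fun a _ => Finset.sum_congr rfl fun b _ => by ring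

lemma act2_sum {ι : Type*} (s : Finset ι) (R S : Matrix (Fin n) (Fin n) ℝ)
    (X : ι → Fin n → Fin n → ℝ) (i j : Fin n) :
    act2 R S (fun a b => ∑ c ∈ s, X c a b) i j = ∑ c ∈ s, act2 R S (X c) i j := by
  classical
  induction s using Finset.induction_on with
  | empty => simp [act2]
  | insert c s hc ih => simp only [Finset.sum_insert hc, act2_add, ih]

lemma sum_comm_pairs (f : Fin n → Fin n → Fin n → Fin n → ℝ) :
    ∑ k, ∑ l, ∑ a, ∑ b, f k l a b = ∑ a, ∑ b, ∑ k, ∑ l, f k l a b := by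
  have h1 : ∀ k, ∑ l, ∑ a, ∑ b, f k l a b = ∑ a, ∑ b, ∑ l, f k l a b := fun k => by
    rw [Finset.sum_comm]
    exact Finset.sum_congr rfl fun a _ => Finset.sum_comm
  simp_rw [h1]
  rw [Finset.sum_comm]
  exact Finset.sum_congr rfl fun a _ => Finset.sum_comm

/-- A vector and a covector index transform by matrices inverse transpose to each other, so their
contraction is invariant. Below, P is the matrix of a new frame and Q its inverse; lower indices
transform by Pᵀ and upper ones by Q. -/
lemma ctr1 (h : Rᵀ * S = 1) (X Y : Fin n → ℝ) :
    ∑ k, (∑ c, R k c * X c) * (∑ c, S k c * Y c) = ∑ c, X c * Y c := by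
  have h1 : (R *ᵥ X) ⬝ᵥ (S *ᵥ Y) = X ⬝ᵥ Y := by
    rw [← Matrix.vecMul_transpose, ← Matrix.dotProduct_mulVec, Matrix.mulVec_mulVec, h,
      Matrix.one_mulVec]
  exact h1

lemma ctr2 (h : Rᵀ * R' = 1) (h' : Sᵀ * S' = 1) (X Y : Fin n → Fin n → ℝ) :
    ∑ i, ∑ j, act2 R S X i j * act2 R' S' Y i j = ∑ a, ∑ b, X a b * Y a b := by
  rw [Finset.sum_comm]
  simp only [act2]
  simp_rw [ctr1 h]
  rw [Finset.sum_comm]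
  exact Finset.sum_congr rfl fun a _ => ctr1 h' _ _

lemma ctr3 (h : Rᵀ * R' = 1) (h' : Sᵀ * S' = 1) (h'' : Uᵀ * U' = 1) (X Y : Arr3 n) :
    ∑ k, ∑ i, ∑ j, act3 R S U X k i j * act3 R' S' U' Y k i j =
      ∑ c, ∑ a, ∑ b, X c a b * Y c a b := by
  have h1 : ∑ k, ∑ i, ∑ j, act3 R S U X k i j * act3 R' S' U' Y k i j =
      ∑ i, ∑ j, ∑ k, act3 R S U X k i j * act3 R' S' U' Y k i j := by
    rw [Finset.sum_comm]
    exact Finset.sum_congr rfl fun i _ => Finset.sum_comm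
  rw [h1]
  simp only [act3]
  simp_rw [ctr1 h]
  have h2 : ∀ i, ∑ j, ∑ c, act2 S U (X c) i j * act2 S' U' (Y c) i j =
      ∑ c, ∑ j, act2 S U (X c) i j * act2 S' U' (Y c) i j := fun i => Finset.sum_comm
  simp_rw [h2]
  rw [Finset.sum_comm]
  exact Finset.sum_congr rfl fun c _ => ctr2 h' h'' _ _

lemma tr2 (h : Rᵀ * S = 1) (X : Fin n → Fin n → ℝ) : ∑ j, act2 R S X j j = ∑ a, X a a := by
  have h1 : ∀ a b, ∑ j, R j a * S j b = if a = b then 1 else 0 := fun a b => by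
    have := congrFun (congrFun h a) b
    rw [Matrix.mul_apply, Matrix.one_apply] at this
    exact this
  calc ∑ j, act2 R S X j j = ∑ a, ∑ b, (∑ j, R j a * S j b) * X a b := by
        simp only [act2, Finset.mul_sum, Finset.sum_mul]
        rw [Finset.sum_comm]
        refine Finset.sum_congr rfl fun a _ => ?_
        rw [Finset.sum_comm]
        exact Finset.sum_congr rfl fun b _ => Finset.sum_congr rfl fun j _ => by ring
    _ = _ := by simp [h1]

variable {N N' Rc Rc' P Q : Matrix (Fin n) (Fin n) ℝ} {T T' A A' E E' : Arr3 n} {w w' : Fin n → ℝ}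

/-- The sum over permuted indices is again a tensor with three lower indices, since all three slots
transform by the same matrix; raising one of them with N replaces its Pᵀ by Q. -/
lemma tChr_act (hPQ : P * Q = 1) (hN : ∀ i j, N' i j = act2 Q Q (fun a b => N a b) i j)
    (hT : ∀ k i j, T' k i j = act3 Pᵀ Pᵀ Pᵀ T k i j) (k i j : Fin n) :
    tChr N' T' k i j = act3 Q Pᵀ Pᵀ (tChr N T) k i j := by
  have hQP : Qᵀ * Pᵀ = 1 := by rw [← Matrix.transpose_mul, hPQ, Matrix.transpose_one]
  set X : Arr3 n := fun l i j => T i j l + T j i l - T l i j with hX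
  have hS : ∀ l, T' i j l + T' j i l - T' l i j = ∑ c, Pᵀ l c * act2 Pᵀ Pᵀ (X c) i j := by
    intro l
    have e1 : T' i j l = act3 Pᵀ Pᵀ Pᵀ (fun l i j => T i j l) l i j := by
      rw [hT, act3_swap', act3_swap]
    have e2 : T' j i l = act3 Pᵀ Pᵀ Pᵀ (fun l i j => T j i l) l i j := by
      rw [hT, act3_swap', act3_swap, act3_swap']
    rw [e1, e2, hT]
    simp only [act3]
    rw [← Finset.sum_add_distrib, ← Finset.sum_sub_distrib]
    refine Finset.sum_congr rfl fun c _ => ?_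
    have : (X c) = fun a b => (T a b c + T b a c) + (-1) * T c a b := by
      ext a b; simp only [hX]; ring
    rw [this, act2_add, act2_add, act2_smul]
    ring
  simp only [tChr, hS]
  have hN' : ∀ l, N' k l = ∑ b, Q l b * ∑ a, Q k a * N a b := fun l => by
    rw [hN, act2_swap]; rfl
  simp_rw [hN', ctr1 hQP, act3]
  rw [Finset.mul_sum, show (∑ c, Q k c * act2 Pᵀ Pᵀ (tChr N T c) i j) =
    ∑ c, Q k c * ((1 / 2) * ∑ l, N c l * act2 Pᵀ Pᵀ (X l) i j) from ?_]
  · simp only [Finset.mul_sum, Finset.sum_mul]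
    rw [Finset.sum_comm]
    exact Finset.sum_congr rfl fun a _ => Finset.sum_congr rfl fun b _ => by ring
  · refine Finset.sum_congr rfl fun c _ => ?_
    congr 1
    have : tChr N T c = fun a b => (1 / 2) * ∑ l, N c l * X l a b := rfl
    rw [this, act2_smul, act2_sum]
    simp_rw [act2_smul]

lemma act3_last (R S U : Matrix (Fin n) (Fin n) ℝ) (X : Arr3 n) (k i j : Fin n) :
    act3 R S U X k i j = ∑ b, U j b * act2 R S (fun c a => X c a b) k i := by
  rw [act3_swap', act3_swap]
  rfl

/-- The index b is contracted with one index of N, and the remaining index of N brings in Q. Only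
the last slot is touched, so the lemma can be iterated after permuting slots. -/
lemma raise_act (hPQ : P * Q = 1) (hN : ∀ i j, N' i j = act2 Q Q (fun a b => N a b) i j)
    (hT : ∀ k i j, T' k i j = act3 R S Pᵀ T k i j) (k i j : Fin n) :
    ∑ b, N' j b * T' k i b = act3 R S Q (fun k i j => ∑ b, N j b * T k i b) k i j := by
  have hQP : Qᵀ * Pᵀ = 1 := by rw [← Matrix.transpose_mul, hPQ, Matrix.transpose_one]
  have hN' : ∀ i l, N' i l = ∑ b, Q l b * ∑ a, Q i a * N a b := fun i l => by
    rw [hN, act2_swap]; rfl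
  simp_rw [hN', hT, act3_last, ctr1 hQP, act2_sum, act2_smul, Finset.sum_mul, Finset.mul_sum]
  rw [Finset.sum_comm]
  exact Finset.sum_congr rfl fun a _ => Finset.sum_congr rfl fun b _ => by ring

/-- Up to sign this is ∇̄g with its last two indices raised one after the other. -/
lemma tInv_act (hPQ : P * Q = 1) (hN : ∀ i j, N' i j = act2 Q Q (fun a b => N a b) i j)
    (hT : ∀ k i j, T' k i j = act3 Pᵀ Pᵀ Pᵀ T k i j) (k i j : Fin n) :
    tInv N' T' k i j = act3 Pᵀ Q Q (tInv N T) k i j := by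
  have e : ∀ (N : Matrix (Fin n) (Fin n) ℝ) (T : Arr3 n) k i j,
      tInv N T k i j = (-1) * ∑ a, N i a * ∑ b, N j b * T k a b := fun N T k i j => by
    simp only [tInv, Finset.mul_sum, neg_mul, one_mul, Finset.sum_neg_distrib, mul_assoc]
  have h1 := raise_act hPQ hN hT
  have h2 := raise_act (T' := fun k j a => ∑ b, N' j b * T' k a b)
    (T := fun k j a => ∑ b, N j b * T k a b) (R := Pᵀ) (S := Q) hPQ hN
    (fun k j a => by rw [h1, act3_swap'])
  rw [e, h2, act3_swap']
  have : tInv N T = fun k i j => (-1) * ∑ a, N i a * ∑ b, N j b * T k a b := by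
    ext k i j; exact e N T k i j
  rw [this]
  simp only [act3]
  rw [Finset.mul_sum]
  refine Finset.sum_congr rfl fun c _ => ?_
  rw [act2_smul, act2_swap]
  ring

lemma trace_first_act (hPQ : P * Q = 1) (hA : ∀ k i j, A' k i j = act3 Q Pᵀ Pᵀ A k i j)
    (i : Fin n) : ∑ j, A' j j i = ∑ b, Pᵀ i b * ∑ a, A a a b := by
  have hQP : Qᵀ * Pᵀ = 1 := by rw [← Matrix.transpose_mul, hPQ, Matrix.transpose_one]
  simp_rw [hA, act3_last]
  rw [Finset.sum_comm]
  exact Finset.sum_congr rfl fun b _ => by rw [← Finset.mul_sum, tr2 hQP]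

lemma trace_inv_act (hPQ : P * Q = 1) (hE : ∀ k i j, E' k i j = act3 Pᵀ Q Q E k i j)
    (i : Fin n) : ∑ k, E' k i k = ∑ a, Q i a * ∑ c, E c a c := by
  have hPQ' : (Pᵀ)ᵀ * Q = 1 := by rw [Matrix.transpose_transpose, hPQ]
  have h : ∀ k, E' k i k = ∑ a, Q i a * act2 Pᵀ Q (fun c b => E c a b) k k := fun k => by
    rw [hE, act3_swap]; rfl
  simp_rw [h]
  rw [Finset.sum_comm]
  exact Finset.sum_congr rfl fun b _ => by rw [← Finset.mul_sum, tr2 hPQ']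

lemma metric_trace_act (hPQ : P * Q = 1)
    (hN : ∀ i j, N' i j = act2 Q Q (fun a b => N a b) i j)
    (hA : ∀ k i j, A' k i j = act3 R Pᵀ Pᵀ A k i j) (k : Fin n) :
    ∑ i, ∑ j, N' i j * A' k i j = ∑ c, R k c * ∑ a, ∑ b, N a b * A c a b := by
  have hQP : Qᵀ * Pᵀ = 1 := by rw [← Matrix.transpose_mul, hPQ, Matrix.transpose_one]
  have h : ∀ c, ∑ i, ∑ j, N' i j * act2 Pᵀ Pᵀ (A c) i j = ∑ a, ∑ b, N a b * A c a b := fun c => by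
    simp_rw [hN]; exact ctr2 hQP hQP _ _
  simp_rw [hA, act3, Finset.mul_sum]
  have : ∀ i, ∑ j, ∑ c, N' i j * (R k c * act2 Pᵀ Pᵀ (A c) i j) =
      ∑ c, ∑ j, N' i j * (R k c * act2 Pᵀ Pᵀ (A c) i j) := fun i => Finset.sum_comm
  simp_rw [this]
  rw [Finset.sum_comm]
  refine Finset.sum_congr rfl fun c _ => ?_
  simp_rw [← Finset.mul_sum, ← h c, Finset.mul_sum]
  exact Finset.sum_congr rfl fun i _ => Finset.sum_congr rfl fun j _ => by ring

/-- For fixed free indices the two factors are matrices in (k, l) with opposite variance in each of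
these indices, so the double contraction is invariant and only the free indices transform. -/
lemma quad_act (hPQ : P * Q = 1) (hA : ∀ k i j, A' k i j = act3 Q Pᵀ Pᵀ A k i j) (i j : Fin n) :
    ∑ k, ∑ l, A' k j l * A' l i k =
      act2 Pᵀ Pᵀ (fun a b => ∑ k, ∑ l, A k b l * A l a k) i j := by
  have hQP : Qᵀ * Pᵀ = 1 := by rw [← Matrix.transpose_mul, hPQ, Matrix.transpose_one]
  have hPQ' : (Pᵀ)ᵀ * Q = 1 := by rw [Matrix.transpose_transpose, hPQ]
  have h1 : ∀ k l, A' k j l = ∑ b, Pᵀ j b * act2 Q Pᵀ (fun c d => A c b d) k l := fun k l => by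
    rw [hA, act3_swap]; rfl
  have h2 : ∀ k l, A' l i k = ∑ a, Pᵀ i a * act2 Pᵀ Q (fun c d => A d a c) k l := fun k l => by
    rw [hA, act3_swap]
    simp only [act3]
    exact Finset.sum_congr rfl fun a _ => by rw [act2_swap]
  have h3 : ∀ a b, ∑ k, ∑ l, act2 Q Pᵀ (fun c d => A c b d) k l * act2 Pᵀ Q (fun c d => A d a c) k l
      = ∑ k, ∑ l, A k b l * A l a k := fun a b => ctr2 hQP hPQ' _ _
  calc ∑ k, ∑ l, A' k j l * A' l i k
      = ∑ k, ∑ l, ∑ a, ∑ b, Pᵀ i a * (Pᵀ j b * (act2 Q Pᵀ (fun c d => A c b d) k l *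
          act2 Pᵀ Q (fun c d => A d a c) k l)) := by
        refine Finset.sum_congr rfl fun k _ => Finset.sum_congr rfl fun l _ => ?_
        rw [h1, h2, Finset.sum_mul_sum, Finset.sum_comm]
        exact Finset.sum_congr rfl fun a _ => Finset.sum_congr rfl fun b _ => by ring
    _ = ∑ a, ∑ b, ∑ k, ∑ l, Pᵀ i a * (Pᵀ j b * (act2 Q Pᵀ (fun c d => A c b d) k l *
          act2 Pᵀ Q (fun c d => A d a c) k l)) := sum_comm_pairs _
    _ = _ := by
        simp_rw [← Finset.mul_sum, h3]
        rfl

lemma tV_eq (N : Matrix (Fin n) (Fin n) ℝ) (A : Arr3 n) (k : Fin n) :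
    tV N A k = (∑ i, ∑ j, N i j * A k i j) - ∑ i, N i k * ∑ j, A j j i := by
  simp only [tV, Finset.sum_sub_distrib, Finset.mul_sum]

/-- Sums are regrouped so that every term is a contraction of tensors with known transformation
laws: the traces of E and A, the metric trace of A, and the quadratic expression in A. -/
lemma tF_eq (N : Matrix (Fin n) (Fin n) ℝ) (A E : Arr3 n) (R : Matrix (Fin n) (Fin n) ℝ) :
    tF N A E R = (∑ i, ∑ j, N i j * R i j) - (∑ k, ∑ i, ∑ j, E k i j * A k i j) +
      (∑ i, (∑ k, E k i k) * ∑ j, A j j i) +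
      ((∑ l, (∑ k, A k k l) * ∑ i, ∑ j, N i j * A l i j) -
        ∑ i, ∑ j, N i j * ∑ k, ∑ l, A k j l * A l i k) := by
  rw [tF]
  congr 1
  · congr 1
    rw [Finset.sum_comm]
    refine Finset.sum_congr rfl fun i _ => ?_
    rw [Finset.sum_mul_sum]
  · simp only [Finset.sum_sub_distrib, mul_sub]
    congr 1
    simp only [Finset.mul_sum, Finset.sum_mul]
    have : ∀ i, ∑ j, ∑ k, ∑ l, N i j * (A k k l * A l i j) =
        ∑ l, ∑ k, ∑ j, N i j * (A k k l * A l i j) := fun i => by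
      rw [Finset.sum_comm]
      have : ∀ k, ∑ j, ∑ l, N i j * (A k k l * A l i j) = ∑ l, ∑ j, N i j * (A k k l * A l i j) :=
        fun k => Finset.sum_comm
      simp_rw [this]
      exact Finset.sum_comm
    simp_rw [this]
    rw [Finset.sum_comm]
    refine Finset.sum_congr rfl fun l _ => ?_
    refine Finset.sum_congr rfl fun i _ => ?_
    rw [Finset.sum_comm]
    exact Finset.sum_congr rfl fun j _ => Finset.sum_congr rfl fun k _ => by ring

/-- Invariance of `V · w`. -/
lemma sum_tV_act (hPQ : P * Q = 1) (hN : ∀ i j, N' i j = act2 Q Q (fun a b => N a b) i j)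
    (hA : ∀ k i j, A' k i j = act3 Q Pᵀ Pᵀ A k i j)
    (hw : ∀ k, w' k = ∑ a, Pᵀ k a * w a) :
    ∑ k, tV N' A' k * w' k = ∑ k, tV N A k * w k := by
  have hQP : Qᵀ * Pᵀ = 1 := by rw [← Matrix.transpose_mul, hPQ, Matrix.transpose_one]
  have h : ∀ k, tV N' A' k = ∑ c, Q k c * tV N A c := fun k => by
    simp only [tV_eq, mul_sub, Finset.sum_sub_distrib]
    rw [metric_trace_act hPQ hN hA]
    congr 1
    simp_rw [trace_first_act hPQ hA]
    have hN' : ∀ i, N' i k = ∑ a, Q i a * ∑ b, Q k b * N a b := fun i => hN i k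
    simp_rw [hN', ctr1 hQP, Finset.sum_mul, Finset.mul_sum]
    rw [Finset.sum_comm]
    refine Finset.sum_congr rfl fun b _ => Finset.sum_congr rfl fun a _ =>
      Finset.sum_congr rfl fun c _ => by ring
  simp_rw [h, hw, ctr1 hQP]

/-- Invariance of `F`. -/
lemma tF_act (hPQ : P * Q = 1) (hN : ∀ i j, N' i j = act2 Q Q (fun a b => N a b) i j)
    (hA : ∀ k i j, A' k i j = act3 Q Pᵀ Pᵀ A k i j)
    (hE : ∀ k i j, E' k i j = act3 Pᵀ Q Q E k i j)
    (hR : ∀ i j, Rc' i j = act2 Pᵀ Pᵀ (fun a b => Rc a b) i j) :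
    tF N' A' E' Rc' = tF N A E Rc := by
  have hQP : Qᵀ * Pᵀ = 1 := by rw [← Matrix.transpose_mul, hPQ, Matrix.transpose_one]
  have hPQ' : (Pᵀ)ᵀ * Q = 1 := by rw [Matrix.transpose_transpose, hPQ]
  simp only [tF_eq]
  congr 1
  · congr 1
    · congr 1
      · simp_rw [hN, hR]; exact ctr2 hQP hQP _ _
      · simp_rw [hE, hA]; exact ctr3 hPQ' hQP hQP _ _
    · simp_rw [trace_inv_act hPQ hE, trace_first_act hPQ hA]
      exact ctr1 hQP _ _
  · congr 1
    · simp_rw [metric_trace_act hPQ hN hA, trace_first_act hPQ hA]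
      exact ctr1 hPQ' _ _
    · simp_rw [quad_act hPQ hA, hN]
      exact ctr2 hQP hQP _ _

/-- Invariance of the metric trace of a bilinear form. -/
lemma metric_trace_bilin_act (hPQ : P * Q = 1)
    (hN : ∀ i j, N' i j = act2 Q Q (fun a b => N a b) i j)
    (hR : ∀ i j, Rc' i j = act2 Pᵀ Pᵀ (fun a b => Rc a b) i j) :
    ∑ i, ∑ j, N' i j * Rc' i j = ∑ i, ∑ j, N i j * Rc i j := by
  have hQP : Qᵀ * Pᵀ = 1 := by rw [← Matrix.transpose_mul, hPQ, Matrix.transpose_one]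
  simp_rw [hN, hR]; exact ctr2 hQP hQP _ _

end Tensor


/-! ## Coordinate metrics, Christoffel symbols and the Ricci tensor -/

section CoordMetric

variable {n : ℕ}

/-- `G` is a smooth coordinate metric on `W`. -/
structure IsCoordMetricOn (G : Model n → Matrix (Fin n) (Fin n) ℝ) (W : Set (Model n)) : Prop where
  symm : ∀ y ∈ W, (G y)ᵀ = G y
  det_pos : ∀ y ∈ W, 0 < (G y).det
  smooth : ∀ i j, ContDiffOn ℝ ∞ (fun y => G y i j) W

variable {W W' : Set (Model n)} {G G' : Model n → Matrix (Fin n) (Fin n) ℝ}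

lemma contDiffOn_det {m : ℕ∞ω} {G : Model n → Matrix (Fin n) (Fin n) ℝ}
    (h : ∀ i j, ContDiffOn ℝ m (fun y => G y i j) W) : ContDiffOn ℝ m (fun y => (G y).det) W := by
  simp only [Matrix.det_apply]
  refine ContDiffOn.sum fun σ _ => ?_
  simp only [Units.smul_def, zsmul_eq_mul]
  exact contDiffOn_const.mul (contDiffOn_prod fun i _ => h _ _)

lemma contDiffOn_inv {m : ℕ∞ω} {G : Model n → Matrix (Fin n) (Fin n) ℝ}
    (h : ∀ i j, ContDiffOn ℝ m (fun y => G y i j) W) (hdet : ∀ y ∈ W, (G y).det ≠ 0)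
    (i j : Fin n) : ContDiffOn ℝ m (fun y => (G y)⁻¹ i j) W := by
  have : (fun y => (G y)⁻¹ i j) = fun y => ((G y).det)⁻¹ * (G y).adjugate i j := by
    ext y
    rw [Matrix.inv_def, Matrix.smul_apply, Ring.inverse_eq_inv', smul_eq_mul]
  rw [this]
  refine ((contDiffOn_det h).inv hdet).mul ?_
  simp only [Matrix.adjugate_apply]
  refine contDiffOn_det fun a b => ?_
  simp only [Matrix.updateRow_apply]
  split_ifs
  · exact contDiffOn_const
  · exact h _ _

lemma contDiffOn_pderiv {f : Model n → ℝ} (hW : IsOpen W) (hf : ContDiffOn ℝ ∞ f W) (k : Fin n) :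
    ContDiffOn ℝ ∞ (pderiv k f) W :=
  (hf.fderiv_of_isOpen hW (m := ∞) (by simp)).clm_apply contDiffOn_const

lemma _root_.ContDiffOn.differentiableAt_of_isOpen {f : Model n → ℝ} (hW : IsOpen W)
    (hf : ContDiffOn ℝ ∞ f W) {y : Model n} (hy : y ∈ W) : DifferentiableAt ℝ f y :=
  (hf.contDiffAt (hW.mem_nhds hy)).differentiableAt (by simp)

namespace IsCoordMetricOn

lemma mono (h : IsCoordMetricOn G W) (hs : W' ⊆ W) : IsCoordMetricOn G W' :=
  ⟨fun y hy => h.symm y (hs hy), fun y hy => h.det_pos y (hs hy), fun i j => (h.smooth i j).mono hs⟩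

lemma det_ne (h : IsCoordMetricOn G W) : ∀ y ∈ W, (G y).det ≠ 0 := fun y hy => (h.det_pos y hy).ne'

lemma smooth_inv (h : IsCoordMetricOn G W) (i j : Fin n) :
    ContDiffOn ℝ ∞ (fun y => (G y)⁻¹ i j) W := contDiffOn_inv h.smooth h.det_ne i j

lemma symm_apply (h : IsCoordMetricOn G W) {y : Model n} (hy : y ∈ W) (i j : Fin n) :
    G y i j = G y j i := congrFun (congrFun (h.symm y hy) j) i

lemma inv_symm (h : IsCoordMetricOn G W) {y : Model n} (hy : y ∈ W) (i j : Fin n) :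
    (G y)⁻¹ i j = (G y)⁻¹ j i := by
  have : ((G y)⁻¹)ᵀ = (G y)⁻¹ := by rw [Matrix.transpose_nonsing_inv, h.symm y hy]
  exact congrFun (congrFun this j) i

lemma mul_inv (h : IsCoordMetricOn G W) {y : Model n} (hy : y ∈ W) : G y * (G y)⁻¹ = 1 :=
  Matrix.mul_nonsing_inv _ (isUnit_iff_ne_zero.2 (h.det_ne y hy))

lemma inv_mul (h : IsCoordMetricOn G W) {y : Model n} (hy : y ∈ W) : (G y)⁻¹ * G y = 1 :=
  Matrix.nonsing_inv_mul _ (isUnit_iff_ne_zero.2 (h.det_ne y hy))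

lemma smooth_christoffel (hW : IsOpen W) (h : IsCoordMetricOn G W) (k i j : Fin n) :
    ContDiffOn ℝ ∞ (coordChristoffel G k i j) W := by
  unfold coordChristoffel
  refine contDiffOn_const.mul (ContDiffOn.sum fun l _ => (h.smooth_inv k l).mul ?_)
  exact ((contDiffOn_pderiv hW (h.smooth j l) i).add (contDiffOn_pderiv hW (h.smooth i l) j)).sub
    (contDiffOn_pderiv hW (h.smooth i j) l)

lemma pderiv_symm (hW : IsOpen W) (h : IsCoordMetricOn G W) {y : Model n} (hy : y ∈ W)
    (k i j : Fin n) : pderiv k (fun z => G z i j) y = pderiv k (fun z => G z j i) y :=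
  pderiv_congr (by filter_upwards [hW.mem_nhds hy] with z hz using h.symm_apply hz i j) k

lemma christoffel_symm (hW : IsOpen W) (h : IsCoordMetricOn G W) {y : Model n} (hy : y ∈ W)
    (k i j : Fin n) : coordChristoffel G k i j y = coordChristoffel G k j i y := by
  simp only [coordChristoffel]
  congr 1
  refine Finset.sum_congr rfl fun l _ => ?_
  rw [h.pderiv_symm hW hy l i j]
  ring

end IsCoordMetricOn

lemma coordChristoffel_eq_tChr (G : Model n → Matrix (Fin n) (Fin n) ℝ) (y : Model n)
    (k i j : Fin n) : coordChristoffel G k i j y =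
      tChr (G y)⁻¹ (fun k i j => pderiv k (fun z => G z i j) y) k i j := rfl

/-- The partial derivatives of a smooth function commute. -/
lemma pderiv_comm {f : Model n → ℝ} (hW : IsOpen W) (hf : ContDiffOn ℝ ∞ f W) {y : Model n}
    (hy : y ∈ W) (k i : Fin n) : pderiv k (pderiv i f) y = pderiv i (pderiv k f) y := by
  have hc : ContDiffAt ℝ ∞ f y := hf.contDiffAt (hW.mem_nhds hy)
  have hs : IsSymmSndFDerivAt ℝ f y := hc.isSymmSndFDerivAt (by
    simp only [minSmoothness_of_isRCLikeNormedField]; exact WithTop.coe_le_coe.2 (le_top : (2 : ℕ∞) ≤ ⊤))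
  have hd : DifferentiableAt ℝ (fderiv ℝ f) y :=
    (hc.fderiv_right (m := ∞) (by simp)).differentiableAt (by simp)
  have h : ∀ a b : Fin n, pderiv a (pderiv b f) y =
      fderiv ℝ (fderiv ℝ f) y (coordVec a) (coordVec b) := by
    intro a b
    have : HasFDerivAt (pderiv b f)
        ((ContinuousLinearMap.apply ℝ ℝ (coordVec b : Model n)).comp (fderiv ℝ (fderiv ℝ f) y)) y :=
      ((ContinuousLinearMap.apply ℝ ℝ (coordVec b : Model n)).hasFDerivAt).comp y hd.hasFDerivAt
    rw [pderiv, this.fderiv]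
    rfl
  rw [h, h]
  exact hs _ _

/-- The Jacobian matrix `Jᵃᵢ = ∂ᵢ ψᵃ`. -/
def jacobian (ψ : Model n → Model n) (y : Model n) : Matrix (Fin n) (Fin n) ℝ :=
  Matrix.of fun a i => pderiv i (fun z => ψ z a) y

lemma fderiv_coordVec_apply {ψ : Model n → Model n} {y : Model n} (h : DifferentiableAt ℝ ψ y)
    (i a : Fin n) : fderiv ℝ ψ y (coordVec i) a = jacobian ψ y a i := by
  have : HasFDerivAt (fun z => ψ z a) ((EuclideanSpace.proj a : Model n →L[ℝ] ℝ).comp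
      (fderiv ℝ ψ y)) y :=
    ((EuclideanSpace.proj a : Model n →L[ℝ] ℝ).hasFDerivAt).comp y h.hasFDerivAt
  simp [jacobian, pderiv, this.fderiv]

lemma sum_coordVec (x : Model n) : x = ∑ a, x a • (coordVec a : Model n) := by
  ext i
  simp [coordVec, Pi.single_apply]

/-- The chain rule for partial derivatives. -/
lemma pderiv_comp_map {ψ : Model n → Model n} {f : Model n → ℝ} {y : Model n}
    (hf : DifferentiableAt ℝ f (ψ y)) (hψ : DifferentiableAt ℝ ψ y) (k : Fin n) :
    pderiv k (fun z => f (ψ z)) y = ∑ a, jacobian ψ y a k * pderiv a f (ψ y) := by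
  have h := (hf.hasFDerivAt.comp y hψ.hasFDerivAt).fderiv
  rw [pderiv]
  change fderiv ℝ (f ∘ ψ) y (coordVec k) = _
  rw [h, ContinuousLinearMap.comp_apply, sum_coordVec (fderiv ℝ ψ y (coordVec k)), map_sum]
  refine Finset.sum_congr rfl fun a _ => ?_
  rw [map_smul, fderiv_coordVec_apply hψ]
  rfl

lemma contDiffOn_jacobian {ψ : Model n → Model n} (hW : IsOpen W) (hψ : ContDiffOn ℝ ∞ ψ W)
    (a i : Fin n) : ContDiffOn ℝ ∞ (fun y => jacobian ψ y a i) W :=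
  contDiffOn_pderiv hW ((EuclideanSpace.proj a : Model n →L[ℝ] ℝ).contDiff.comp_contDiffOn hψ) i

lemma pderiv_jacobian_comm {ψ : Model n → Model n} (hW : IsOpen W) (hψ : ContDiffOn ℝ ∞ ψ W)
    {y : Model n} (hy : y ∈ W) (a k i : Fin n) :
    pderiv k (fun z => jacobian ψ z a i) y = pderiv i (fun z => jacobian ψ z a k) y :=
  pderiv_comm hW ((EuclideanSpace.proj a : Model n →L[ℝ] ℝ).contDiff.comp_contDiffOn hψ) hy k i

/-- In the Koszul combination a part symmetric in its first two indices appears twice with equal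
sign and cancels elsewhere. This algebra yields both the transformation law of Christoffel symbols,
with H from second derivatives of ψ, and the difference of two connections, with H a lowered
Christoffel symbol. -/
lemma tChr_add_symm {N : Matrix (Fin n) (Fin n) ℝ} {H D T : Arr3 n}
    (hH : ∀ k i j, H k i j = H i k j) (hT : ∀ k i j, T k i j = H k i j + H k j i + D k i j)
    (k i j : Fin n) : tChr N T k i j = (∑ l, N k l * H i j l) + tChr N D k i j := by
  simp only [tChr, hT, Finset.mul_sum]
  rw [← Finset.sum_add_distrib]
  refine Finset.sum_congr rfl fun l _ => ?_
  rw [hH j i l, hH l i j, hH l j i]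
  ring

/-- `G` on `W` is the pullback of `G'` on `W'` by `ψ`. -/
structure IsPullback (ψ : Model n → Model n) (G G' : Model n → Matrix (Fin n) (Fin n) ℝ)
    (W W' : Set (Model n)) : Prop where
  open_source : IsOpen W
  open_target : IsOpen W'
  mapsTo : MapsTo ψ W W'
  smooth : ContDiffOn ℝ ∞ ψ W
  metric : IsCoordMetricOn G W
  metric' : IsCoordMetricOn G' W'
  pullback : ∀ y ∈ W, G y = (jacobian ψ y)ᵀ * G' (ψ y) * jacobian ψ y

namespace IsPullback

variable {ψ : Model n → Model n} {y : Model n}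

lemma differentiableAt (h : IsPullback ψ G G' W W') (hy : y ∈ W) : DifferentiableAt ℝ ψ y :=
  (h.smooth.contDiffAt (h.open_source.mem_nhds hy)).differentiableAt (by simp)

/-- Invertibility of Dψ need not be assumed: a singular Jacobian would make the pulled back metric
degenerate. -/
lemma det_jacobian_ne (h : IsPullback ψ G G' W W') (hy : y ∈ W) : (jacobian ψ y).det ≠ 0 := by
  intro h0
  have := h.metric.det_ne y hy
  rw [h.pullback y hy, Matrix.det_mul, h0, mul_zero] at this
  exact this rfl

lemma jacobian_mul_inv (h : IsPullback ψ G G' W W') (hy : y ∈ W) : jacobian ψ y * (jacobian ψ y)⁻¹ = 1 :=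
  Matrix.mul_nonsing_inv _ (isUnit_iff_ne_zero.2 (h.det_jacobian_ne hy))

lemma inv_mul_jacobian (h : IsPullback ψ G G' W W') (hy : y ∈ W) : (jacobian ψ y)⁻¹ * jacobian ψ y = 1 :=
  Matrix.nonsing_inv_mul _ (isUnit_iff_ne_zero.2 (h.det_jacobian_ne hy))

lemma inv_eq (h : IsPullback ψ G G' W W') (hy : y ∈ W) : (G y)⁻¹ = (jacobian ψ y)⁻¹ * (G' (ψ y))⁻¹ * ((jacobian ψ y)⁻¹)ᵀ := by
  rw [h.pullback y hy, Matrix.mul_inv_rev, Matrix.mul_inv_rev, Matrix.transpose_nonsing_inv,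
    Matrix.mul_assoc]

lemma _root_.RoughMetric.mul_mul_transpose_apply (R N : Matrix (Fin n) (Fin n) ℝ) (i j : Fin n) :
    (R * N * Rᵀ) i j = act2 R R (fun a b => N a b) i j := by
  rw [act2_swap]
  simp only [Matrix.mul_apply, act2, Matrix.transpose_apply]
  exact Finset.sum_congr rfl fun a _ => mul_comm _ _

lemma inv_apply (h : IsPullback ψ G G' W W') (hy : y ∈ W) (i j : Fin n) :
    (G y)⁻¹ i j = act2 (jacobian ψ y)⁻¹ (jacobian ψ y)⁻¹ (fun a b => (G' (ψ y))⁻¹ a b) i j := by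
  rw [h.inv_eq hy, mul_mul_transpose_apply]

lemma apply (h : IsPullback ψ G G' W W') (hy : y ∈ W) (i j : Fin n) :
    G y i j = ∑ a, ∑ b, jacobian ψ y a i * (jacobian ψ y b j * G' (ψ y) a b) := by
  rw [h.pullback y hy]
  have := mul_mul_transpose_apply (jacobian ψ y)ᵀ (G' (ψ y)) i j
  rw [Matrix.transpose_transpose] at this
  rw [this]
  simp only [act2, Matrix.transpose_apply, Finset.mul_sum]

/-- The product rule, sorted into the shape required by `tChr_add_symm`: two terms with second
derivatives of ψ, exchanged by i ↔ j, and a tensorial rest. -/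
lemma pderiv_metric (h : IsPullback ψ G G' W W') (hy : y ∈ W) (k i j : Fin n) : pderiv k (fun z => G z i j) y =
    (∑ a, ∑ b, pderiv k (fun z => jacobian ψ z a i) y * (jacobian ψ y b j * G' (ψ y) a b)) +
    (∑ a, ∑ b, pderiv k (fun z => jacobian ψ z a j) y * (jacobian ψ y b i * G' (ψ y) a b)) +
    act3 (jacobian ψ y)ᵀ (jacobian ψ y)ᵀ (jacobian ψ y)ᵀ
      (fun c a b => pderiv c (fun z => G' z a b) (ψ y)) k i j := by
  have hW := h.open_source
  have dJ : ∀ a i, DifferentiableAt ℝ (fun z => jacobian ψ z a i) y := fun a i =>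
    (contDiffOn_jacobian hW h.smooth a i).differentiableAt_of_isOpen hW hy
  have dG' : ∀ a b, DifferentiableAt ℝ (fun z => G' z a b) (ψ y) := fun a b =>
    (h.metric'.smooth a b).differentiableAt_of_isOpen h.open_target (h.mapsTo hy)
  have dψ := h.differentiableAt hy
  have dGψ : ∀ a b, DifferentiableAt ℝ (fun z => G' (ψ z) a b) y := fun a b =>
    (dG' a b).comp y dψ
  have e1 : pderiv k (fun z => G z i j) y = pderiv k
      (fun z => ∑ a, ∑ b, jacobian ψ z a i * (jacobian ψ z b j * G' (ψ z) a b)) y :=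
    pderiv_congr (by filter_upwards [hW.mem_nhds hy] with z hz using h.apply hz i j) k
  have d1 : ∀ a b, DifferentiableAt ℝ
      (fun z => jacobian ψ z a i * (jacobian ψ z b j * G' (ψ z) a b)) y := fun a b =>
    (dJ a i).mul ((dJ b j).mul (dGψ a b))
  rw [e1, pderiv_sum _ fun a _ => DifferentiableAt.fun_sum fun b _ => d1 a b]
  have e2 : ∀ a b, pderiv k (fun z => jacobian ψ z a i * (jacobian ψ z b j * G' (ψ z) a b)) y =
      pderiv k (fun z => jacobian ψ z a i) y * (jacobian ψ y b j * G' (ψ y) a b) +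
      pderiv k (fun z => jacobian ψ z b j) y * (jacobian ψ y a i * G' (ψ y) b a) +
      ∑ c, jacobian ψ y c k * (jacobian ψ y a i * (jacobian ψ y b j *
        pderiv c (fun z => G' z a b) (ψ y))) := by
    intro a b
    have dm : DifferentiableAt ℝ (fun z => jacobian ψ z b j * G' (ψ z) a b) y :=
      (dJ b j).mul (dGψ a b)
    rw [pderiv_mul (dJ a i) dm, pderiv_mul (dJ b j) (dGψ a b),
      pderiv_comp_map (dG' a b) dψ, h.metric'.symm_apply (h.mapsTo hy) b a]
    have : ∑ c, jacobian ψ y c k * (jacobian ψ y a i * (jacobian ψ y b j *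
        pderiv c (fun z => G' z a b) (ψ y))) = jacobian ψ y a i * (jacobian ψ y b j *
        ∑ c, jacobian ψ y c k * pderiv c (fun z => G' z a b) (ψ y)) := by
      simp only [Finset.mul_sum]
      exact Finset.sum_congr rfl fun c _ => by ring
    rw [this]
    ring
  have e3 : ∀ a, pderiv k
      (fun z => ∑ b, jacobian ψ z a i * (jacobian ψ z b j * G' (ψ z) a b)) y =
      ∑ b, pderiv k (fun z => jacobian ψ z a i * (jacobian ψ z b j * G' (ψ z) a b)) y := fun a =>
    pderiv_sum _ (fun b _ => d1 a b) k
  simp_rw [e3, e2, Finset.sum_add_distrib]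
  congr 1
  · congr 1
    exact Finset.sum_comm
  · simp only [act3, act2, Matrix.transpose_apply, Finset.mul_sum]
    have : ∀ a, ∑ b, ∑ c, jacobian ψ y c k * (jacobian ψ y a i * (jacobian ψ y b j *
        pderiv c (fun z => G' z a b) (ψ y))) = ∑ c, ∑ b, jacobian ψ y c k * (jacobian ψ y a i *
        (jacobian ψ y b j * pderiv c (fun z => G' z a b) (ψ y))) := fun a => Finset.sum_comm
    simp_rw [this]
    exact Finset.sum_comm

/-- The transformation law of Christoffel symbols. -/
lemma christoffel (h : IsPullback ψ G G' W W') (hy : y ∈ W) (k i j : Fin n) : coordChristoffel G k i j y =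
    ∑ c, (jacobian ψ y)⁻¹ k c * (pderiv i (fun z => jacobian ψ z c j) y +
      act2 (jacobian ψ y)ᵀ (jacobian ψ y)ᵀ (fun a b => coordChristoffel G' c a b (ψ y)) i j) := by
  have hW := h.open_source
  have hPQ := h.jacobian_mul_inv hy
  have hQP : ((jacobian ψ y)⁻¹)ᵀ * (jacobian ψ y)ᵀ = 1 := by
    rw [← Matrix.transpose_mul, hPQ, Matrix.transpose_one]
  rw [coordChristoffel_eq_tChr, tChr_add_symm (fun k i j => ?_) (h.pderiv_metric hy)]
  · rw [tChr_act hPQ (h.inv_apply hy) (fun _ _ _ => rfl)]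
    simp only [mul_add, Finset.sum_add_distrib]
    congr 1
    have e1 : ∀ l, ∑ a, ∑ b, pderiv i (fun z => jacobian ψ z a j) y *
        (jacobian ψ y b l * G' (ψ y) a b) = ∑ b, (jacobian ψ y)ᵀ l b *
        ∑ a, G' (ψ y) a b * pderiv i (fun z => jacobian ψ z a j) y := by
      intro l
      rw [Finset.sum_comm]
      simp only [Finset.mul_sum, Matrix.transpose_apply]
      exact Finset.sum_congr rfl fun b _ => Finset.sum_congr rfl fun a _ => by ring
    have e2 : ∀ l, (G y)⁻¹ k l = ∑ b, (jacobian ψ y)⁻¹ l b *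
        ∑ a, (jacobian ψ y)⁻¹ k a * (G' (ψ y))⁻¹ a b := fun l => by
      rw [h.inv_apply hy, act2_swap]; rfl
    simp_rw [e1, e2, ctr1 hQP, Finset.sum_mul]
    rw [Finset.sum_comm]
    refine Finset.sum_congr rfl fun c _ => ?_
    simp_rw [mul_assoc, ← Finset.mul_sum]
    congr 1
    have e3 : ∀ a, ∑ b, (G' (ψ y))⁻¹ c b * G' (ψ y) a b = if c = a then 1 else 0 := by
      intro a
      have := congrFun (congrFun (h.metric'.inv_mul (h.mapsTo hy)) c) a
      rw [Matrix.mul_apply, Matrix.one_apply] at this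
      rw [← this]
      exact Finset.sum_congr rfl fun b _ => by rw [h.metric'.symm_apply (h.mapsTo hy)]
    calc ∑ b, (G' (ψ y))⁻¹ c b * ∑ a, G' (ψ y) a b * pderiv i (fun z => jacobian ψ z a j) y
        = ∑ a, (∑ b, (G' (ψ y))⁻¹ c b * G' (ψ y) a b) * pderiv i (fun z => jacobian ψ z a j) y := by
          simp only [Finset.mul_sum, Finset.sum_mul]
          rw [Finset.sum_comm]
          exact Finset.sum_congr rfl fun b _ => Finset.sum_congr rfl fun a _ => by ring
      _ = _ := by simp [e3]
  · refine Finset.sum_congr rfl fun a _ => Finset.sum_congr rfl fun b _ => ?_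
    rw [pderiv_jacobian_comm hW h.smooth hy]

end IsPullback

end CoordMetric



/-! ### Connection and curvature matrices; the Ricci tensor under coordinate changes -/

section Curvature

variable {n : ℕ}

/-- The entrywise partial derivative of a matrix valued function. -/
def pderivMatrix (k : Fin n) (A : Model n → Matrix (Fin n) (Fin n) ℝ) (y : Model n) :
    Matrix (Fin n) (Fin n) ℝ :=
  Matrix.of fun i j => pderiv k (fun z => A z i j) y

lemma pderivMatrix_mul {A B : Model n → Matrix (Fin n) (Fin n) ℝ} {y : Model n}
    (hA : ∀ i j, DifferentiableAt ℝ (fun z => A z i j) y)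
    (hB : ∀ i j, DifferentiableAt ℝ (fun z => B z i j) y) (k : Fin n) :
    pderivMatrix k (fun z => A z * B z) y =
      pderivMatrix k A y * B y + A y * pderivMatrix k B y := by
  ext i j
  simp only [pderivMatrix, Matrix.of_apply, Matrix.add_apply, Matrix.mul_apply]
  rw [pderiv_sum _ fun l _ => (hA i l).fun_mul (hB l j), ← Finset.sum_add_distrib]
  refine Finset.sum_congr rfl fun l _ => ?_
  rw [pderiv_mul (hA i l) (hB l j), add_comm]

lemma pderivMatrix_add {A B : Model n → Matrix (Fin n) (Fin n) ℝ} {y : Model n}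
    (hA : ∀ i j, DifferentiableAt ℝ (fun z => A z i j) y)
    (hB : ∀ i j, DifferentiableAt ℝ (fun z => B z i j) y) (k : Fin n) :
    pderivMatrix k (fun z => A z + B z) y = pderivMatrix k A y + pderivMatrix k B y := by
  ext i j
  simp only [pderivMatrix, Matrix.of_apply, Matrix.add_apply]
  exact pderiv_add (hA i j) (hB i j) k

lemma pderivMatrix_congr {A B : Model n → Matrix (Fin n) (Fin n) ℝ} {y : Model n}
    (h : A =ᶠ[𝓝 y] B) (k : Fin n) : pderivMatrix k A y = pderivMatrix k B y := by
  ext i j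
  exact pderiv_congr (h.mono fun z hz => by rw [hz]) k

/-- The connection matrix `(Γᵢ)ᵏⱼ = Γᵏᵢⱼ`. -/
def connMatrix (G : Model n → Matrix (Fin n) (Fin n) ℝ) (i : Fin n) (y : Model n) :
    Matrix (Fin n) (Fin n) ℝ :=
  Matrix.of fun k j => coordChristoffel G k i j y

/-- The curvature matrix `∂ₗ Γᵢ - ∂ᵢ Γₗ + Γₗ Γᵢ - Γᵢ Γₗ`. -/
def curvMatrix (G : Model n → Matrix (Fin n) (Fin n) ℝ) (l i : Fin n) (y : Model n) :
    Matrix (Fin n) (Fin n) ℝ :=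
  pderivMatrix l (connMatrix G i) y - pderivMatrix i (connMatrix G l) y +
    connMatrix G l y * connMatrix G i y - connMatrix G i y * connMatrix G l y

variable {W W' : Set (Model n)} {G G' : Model n → Matrix (Fin n) (Fin n) ℝ}

/-- The symmetry of the Christoffel symbols lets the lower indices be reordered until the expression
is a trace of curvature matrices, for which the change of coordinates is a gauge transformation. -/
lemma IsCoordMetricOn.coordRicci_eq (hW : IsOpen W) (h : IsCoordMetricOn G W) {y : Model n}
    (hy : y ∈ W) (i j : Fin n) : coordRicci G i j y = ∑ k, curvMatrix G k j y k i := by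
  have hs := fun k i j => h.christoffel_symm hW hy k i j
  have hp : ∀ a k i j, pderiv a (coordChristoffel G k i j) y =
      pderiv a (coordChristoffel G k j i) y := fun a k i j =>
    pderiv_congr (by filter_upwards [hW.mem_nhds hy] with z hz using
      h.christoffel_symm hW hz k i j) a
  simp only [coordRicci, curvMatrix, Matrix.sub_apply, Matrix.add_apply, Matrix.mul_apply,
    pderivMatrix, connMatrix, Matrix.of_apply]
  rw [← Finset.sum_add_distrib]
  refine Finset.sum_congr rfl fun k _ => ?_
  rw [Finset.sum_sub_distrib, hp k k i j, hp j k i k]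
  simp_rw [hs _ i _]
  change _ = pderiv k (coordChristoffel G k j i) y - pderiv j (coordChristoffel G k k i) y + _ - _
  ring

namespace IsPullback

variable {ψ : Model n → Model n} {y : Model n}

/-- The gauge transformation law. Keeping the Jacobian on the left avoids differentiating its
inverse later. -/
lemma connMatrix_eq (h : IsPullback ψ G G' W W') (hy : y ∈ W) (i : Fin n) :
    jacobian ψ y * connMatrix G i y = pderivMatrix i (jacobian ψ) y +
      (∑ b, jacobian ψ y b i • connMatrix G' b (ψ y)) * jacobian ψ y := by
  have : connMatrix G i y = (jacobian ψ y)⁻¹ * (pderivMatrix i (jacobian ψ) y +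
      (∑ b, jacobian ψ y b i • connMatrix G' b (ψ y)) * jacobian ψ y) := by
    ext k j
    rw [Matrix.mul_apply]
    change coordChristoffel G k i j y = _
    rw [h.christoffel hy]
    refine Finset.sum_congr rfl fun c _ => ?_
    congr 1
    rw [Matrix.add_apply]
    congr 1
    simp only [act2, Matrix.mul_apply, Matrix.sum_apply, Matrix.smul_apply, Matrix.transpose_apply,
      smul_eq_mul, Finset.mul_sum, Finset.sum_mul, connMatrix, Matrix.of_apply]
    rw [Finset.sum_comm]
    exact Finset.sum_congr rfl fun b _ => Finset.sum_congr rfl fun a _ => by ring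
  rw [this, ← Matrix.mul_assoc, h.jacobian_mul_inv hy, Matrix.one_mul]

lemma pderivMatrix_pulled (h : IsPullback ψ G G' W W') (hy : y ∈ W) (l i : Fin n) :
    pderivMatrix l (fun z => ∑ b, jacobian ψ z b i • connMatrix G' b (ψ z)) y =
      (∑ b, pderiv l (fun z => jacobian ψ z b i) y • connMatrix G' b (ψ y)) +
      ∑ d, ∑ b, (jacobian ψ y d l * jacobian ψ y b i) •
        pderivMatrix d (connMatrix G' b) (ψ y) := by
  have hW := h.open_source
  have dJ : ∀ a i, DifferentiableAt ℝ (fun z => jacobian ψ z a i) y := fun a i =>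
    (contDiffOn_jacobian hW h.smooth a i).differentiableAt_of_isOpen hW hy
  have dC : ∀ a b c, DifferentiableAt ℝ (coordChristoffel G' a b c) (ψ y) := fun a b c =>
    (h.metric'.smooth_christoffel h.open_target a b c).differentiableAt_of_isOpen
      h.open_target (h.mapsTo hy)
  have dψ := h.differentiableAt hy
  have dCψ : ∀ a b c, DifferentiableAt ℝ (fun z => coordChristoffel G' a b c (ψ z)) y :=
    fun a b c => (dC a b c).comp y dψ
  ext p q
  simp only [pderivMatrix, Matrix.of_apply, Matrix.add_apply, Matrix.sum_apply, Matrix.smul_apply,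
    smul_eq_mul, connMatrix]
  rw [pderiv_sum _ fun b _ => (dJ b i).fun_mul (dCψ p b q), add_comm, Finset.sum_comm,
    ← Finset.sum_add_distrib]
  refine Finset.sum_congr rfl fun b _ => ?_
  rw [pderiv_mul (dJ b i) (dCψ p b q), pderiv_comp_map (dC p b q) dψ, Finset.mul_sum]
  congr 1
  exact Finset.sum_congr rfl fun a _ => by
    rw [← mul_assoc, mul_comm (jacobian ψ y b i)]

/-- The gauge law is differentiated and antisymmetrised in l and i. Second derivatives of J drop
out, and its first derivatives cancel against those produced by the products of connection matrices.
What remains is the curvature of the pulled back connection. -/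
lemma curvMatrix_eq (h : IsPullback ψ G G' W W') (hy : y ∈ W) (l i : Fin n) :
    jacobian ψ y * curvMatrix G l i y = (∑ d, ∑ b, (jacobian ψ y d l * jacobian ψ y b i) •
      curvMatrix G' d b (ψ y)) * jacobian ψ y := by
  have hW := h.open_source
  have dJ : ∀ a i, DifferentiableAt ℝ (fun z => jacobian ψ z a i) y := fun a i =>
    (contDiffOn_jacobian hW h.smooth a i).differentiableAt_of_isOpen hW hy
  have ddJ : ∀ i a b, DifferentiableAt ℝ (fun z => pderivMatrix i (jacobian ψ) z a b) y :=
    fun i a b => (contDiffOn_pderiv hW (contDiffOn_jacobian hW h.smooth a b) i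
      ).differentiableAt_of_isOpen hW hy
  have dC : ∀ a b c, DifferentiableAt ℝ (fun z => connMatrix G a z b c) y := fun a b c =>
    (h.metric.smooth_christoffel hW b a c).differentiableAt_of_isOpen hW hy
  set Γ : Fin n → Model n → Matrix (Fin n) (Fin n) ℝ :=
    fun i z => ∑ b, jacobian ψ z b i • connMatrix G' b (ψ z) with hΓ
  have dΓ : ∀ i a b, DifferentiableAt ℝ (fun z => Γ i z a b) y := by
    intro i a b
    simp only [hΓ, Matrix.sum_apply, Matrix.smul_apply, smul_eq_mul]
    exact DifferentiableAt.fun_sum fun c _ => (dJ c i).mul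
      (((h.metric'.smooth_christoffel h.open_target a c b).differentiableAt_of_isOpen
      h.open_target (h.mapsTo hy)).comp y (h.differentiableAt hy))
  have dΓJ : ∀ i a b, DifferentiableAt ℝ (fun z => (Γ i z * jacobian ψ z) a b) y := by
    intro i a b
    simp only [Matrix.mul_apply]
    exact DifferentiableAt.fun_sum fun c _ => (dΓ i a c).mul (dJ c b)
  have key : ∀ l i, pderivMatrix l (jacobian ψ) y * connMatrix G i y +
      jacobian ψ y * pderivMatrix l (connMatrix G i) y =
      pderivMatrix l (pderivMatrix i (jacobian ψ)) y + (pderivMatrix l (Γ i) y * jacobian ψ y +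
        Γ i y * pderivMatrix l (jacobian ψ) y) := by
    intro l i
    rw [← pderivMatrix_mul dJ (dC i), ← pderivMatrix_mul (dΓ i) dJ,
      ← pderivMatrix_add (ddJ i) (dΓJ i)]
    exact pderivMatrix_congr (by
      filter_upwards [hW.mem_nhds hy] with z hz using h.connMatrix_eq hz i) l
  have hc : ∀ i, jacobian ψ y * connMatrix G i y =
      pderivMatrix i (jacobian ψ) y + Γ i y * jacobian ψ y := h.connMatrix_eq hy
  have hcomm : pderivMatrix l (pderivMatrix i (jacobian ψ)) y =
      pderivMatrix i (pderivMatrix l (jacobian ψ)) y := by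
    ext a b
    exact pderiv_comm hW (contDiffOn_jacobian hW h.smooth a b) hy l i
  have step1 : jacobian ψ y * curvMatrix G l i y =
      (pderivMatrix l (Γ i) y - pderivMatrix i (Γ l) y + Γ l y * Γ i y - Γ i y * Γ l y) *
        jacobian ψ y := by
    have k1 := key l i
    have k2 := key i l
    have e1 : jacobian ψ y * (connMatrix G l y * connMatrix G i y) =
        pderivMatrix l (jacobian ψ) y * connMatrix G i y +
          Γ l y * (pderivMatrix i (jacobian ψ) y + Γ i y * jacobian ψ y) := by
      rw [← Matrix.mul_assoc, hc, Matrix.add_mul, Matrix.mul_assoc (Γ l y), hc]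
    have e2 : jacobian ψ y * (connMatrix G i y * connMatrix G l y) =
        pderivMatrix i (jacobian ψ) y * connMatrix G l y +
          Γ i y * (pderivMatrix l (jacobian ψ) y + Γ l y * jacobian ψ y) := by
      rw [← Matrix.mul_assoc, hc, Matrix.add_mul, Matrix.mul_assoc (Γ i y), hc]
    have k1' := eq_sub_of_add_eq' k1
    have k2' := eq_sub_of_add_eq' k2
    rw [curvMatrix, Matrix.mul_sub, Matrix.mul_add, Matrix.mul_sub, e1, e2, k1', k2', hcomm]
    noncomm_ring
  rw [step1]
  congr 1
  rw [hΓ]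
  simp only
  rw [h.pderivMatrix_pulled hy, h.pderivMatrix_pulled hy]
  -- Derivatives of the coefficients of the pulled back connection are second derivatives of ψ,
  -- symmetric in l and i, and cancel in the antisymmetrisation.
  have s1 : ∀ b, pderiv l (fun z => jacobian ψ z b i) y = pderiv i (fun z => jacobian ψ z b l) y :=
    fun b => pderiv_jacobian_comm hW h.smooth hy b l i
  simp_rw [s1]
  have s2 : ∑ d, ∑ b, (jacobian ψ y d i * jacobian ψ y b l) • pderivMatrix d (connMatrix G' b) (ψ y)
      = ∑ d, ∑ b, (jacobian ψ y d l * jacobian ψ y b i) •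
        pderivMatrix b (connMatrix G' d) (ψ y) := by
    rw [Finset.sum_comm]
    exact Finset.sum_congr rfl fun d _ => Finset.sum_congr rfl fun b _ => by rw [mul_comm]
  have s3 : (∑ b, jacobian ψ y b i • connMatrix G' b (ψ y)) *
      (∑ b, jacobian ψ y b l • connMatrix G' b (ψ y)) = ∑ d, ∑ b,
        (jacobian ψ y d l * jacobian ψ y b i) • (connMatrix G' b (ψ y) * connMatrix G' d (ψ y)) := by
    rw [Finset.sum_mul_sum, Finset.sum_comm]
    exact Finset.sum_congr rfl fun d _ => Finset.sum_congr rfl fun b _ => by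
      rw [smul_mul_smul_comm, mul_comm]
  have s4 : (∑ b, jacobian ψ y b l • connMatrix G' b (ψ y)) *
      (∑ b, jacobian ψ y b i • connMatrix G' b (ψ y)) = ∑ d, ∑ b,
        (jacobian ψ y d l * jacobian ψ y b i) • (connMatrix G' d (ψ y) * connMatrix G' b (ψ y)) := by
    rw [Finset.sum_mul_sum]
    exact Finset.sum_congr rfl fun d _ => Finset.sum_congr rfl fun b _ => by
      rw [smul_mul_smul_comm]
  rw [s2, s3, s4]
  simp only [curvMatrix, smul_sub, smul_add, Finset.sum_add_distrib, Finset.sum_sub_distrib]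
  abel

/-- The Ricci curvature is a tensor. -/
lemma coordRicci_eq (h : IsPullback ψ G G' W W') (hy : y ∈ W) (i j : Fin n) :
    coordRicci G i j y = act2 (jacobian ψ y)ᵀ (jacobian ψ y)ᵀ
      (fun a b => coordRicci G' a b (ψ y)) i j := by
  have e : ∀ k, curvMatrix G k j y = (jacobian ψ y)⁻¹ * ((∑ d, ∑ b,
      (jacobian ψ y d k * jacobian ψ y b j) • curvMatrix G' d b (ψ y)) * jacobian ψ y) := fun k => by
    rw [← h.curvMatrix_eq hy, ← Matrix.mul_assoc, h.inv_mul_jacobian hy, Matrix.one_mul]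
  -- In the trace over k the inverse Jacobian meets the Jacobian of the first form index, which
  -- turns the trace for G into the trace for G'.
  have hJ : ∀ d c, ∑ k, jacobian ψ y d k * (jacobian ψ y)⁻¹ k c = if d = c then 1 else 0 :=
    fun d c => by
    have := congrFun (congrFun (h.jacobian_mul_inv hy) d) c
    rw [Matrix.mul_apply, Matrix.one_apply] at this
    exact this
  rw [h.metric.coordRicci_eq h.open_source hy]
  simp_rw [h.metric'.coordRicci_eq h.open_target (h.mapsTo hy), e]
  have e1 : ∀ k c a, ((∑ d, ∑ b, (jacobian ψ y d k * jacobian ψ y b j) •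
      curvMatrix G' d b (ψ y)) * jacobian ψ y) c a = ∑ d, jacobian ψ y d k *
        ∑ b, jacobian ψ y b j * (curvMatrix G' d b (ψ y) * jacobian ψ y) c a := by
    intro k c a
    simp only [Finset.sum_mul, Matrix.sum_apply, Matrix.smul_mul, Matrix.smul_apply, smul_eq_mul,
      Finset.mul_sum, mul_assoc]
  simp_rw [Matrix.mul_apply (M := (jacobian ψ y)⁻¹), e1]
  set X : Fin n → Fin n → ℝ := fun c d =>
    ∑ b, jacobian ψ y b j * (curvMatrix G' d b (ψ y) * jacobian ψ y) c i with hX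
  calc ∑ k, ∑ c, (jacobian ψ y)⁻¹ k c * ∑ d, jacobian ψ y d k * X c d
      = ∑ c, ∑ d, (∑ k, jacobian ψ y d k * (jacobian ψ y)⁻¹ k c) * X c d := by
        rw [Finset.sum_comm]
        refine Finset.sum_congr rfl fun c _ => ?_
        simp only [Finset.mul_sum, Finset.sum_mul]
        rw [Finset.sum_comm]
        exact Finset.sum_congr rfl fun d _ => Finset.sum_congr rfl fun k _ => by ring
    _ = ∑ c, X c c := by simp [hJ]
    _ = _ := by
        rw [act2_swap]
        simp only [hX, act2, Matrix.transpose_apply, Matrix.mul_apply]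
        rw [Finset.sum_comm]
        refine Finset.sum_congr rfl fun b _ => ?_
        rw [← Finset.mul_sum]
        congr 1
        rw [Finset.sum_comm]
        refine Finset.sum_congr rfl fun a _ => ?_
        rw [Finset.mul_sum]
        exact Finset.sum_congr rfl fun c _ => mul_comm _ _

end IsPullback

end Curvature



/-! ### The algebra of div V + F = R -/

section ScalarIdentity

variable {n : ℕ}

lemma sum4_comm12 (f : Fin n → Fin n → Fin n → Fin n → ℝ) :
    ∑ a, ∑ b, ∑ c, ∑ d, f a b c d = ∑ b, ∑ a, ∑ c, ∑ d, f a b c d := Finset.sum_comm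

lemma sum4_comm23 (f : Fin n → Fin n → Fin n → Fin n → ℝ) :
    ∑ a, ∑ b, ∑ c, ∑ d, f a b c d = ∑ a, ∑ c, ∑ b, ∑ d, f a b c d :=
  Finset.sum_congr rfl fun _ _ => Finset.sum_comm

lemma sum4_comm34 (f : Fin n → Fin n → Fin n → Fin n → ℝ) :
    ∑ a, ∑ b, ∑ c, ∑ d, f a b c d = ∑ a, ∑ b, ∑ d, ∑ c, f a b c d :=
  Finset.sum_congr rfl fun _ _ => Finset.sum_congr rfl fun _ _ => Finset.sum_comm

lemma sum3_comm12 (f : Fin n → Fin n → Fin n → ℝ) :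
    ∑ a, ∑ b, ∑ c, f a b c = ∑ b, ∑ a, ∑ c, f a b c := Finset.sum_comm

lemma sum3_comm23 (f : Fin n → Fin n → Fin n → ℝ) :
    ∑ a, ∑ b, ∑ c, f a b c = ∑ a, ∑ c, ∑ b, f a b c :=
  Finset.sum_congr rfl fun _ _ => Finset.sum_comm

lemma sum4_congr {f g : Fin n → Fin n → Fin n → Fin n → ℝ} (h : ∀ a b c d, f a b c d = g a b c d) :
    ∑ a, ∑ b, ∑ c, ∑ d, f a b c d = ∑ a, ∑ b, ∑ c, ∑ d, g a b c d := by
  simp_rw [h]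

lemma sum3_congr {f g : Fin n → Fin n → Fin n → ℝ} (h : ∀ a b c, f a b c = g a b c) :
    ∑ a, ∑ b, ∑ c, f a b c = ∑ a, ∑ b, ∑ c, g a b c := by
  simp_rw [h]

/-- The algebraic part of the identity `div V + F = R`. -/
lemma scalar_identity {N R : Matrix (Fin n) (Fin n) ℝ} {C A E dN : Arr3 n}
    {dC dA : Fin n → Arr3 n}
    (hN : ∀ i j, N i j = N j i) (hC : ∀ k i j, C k i j = C k j i)
    (hA : ∀ k i j, A k i j = A k j i) (hdA : ∀ m k i j, dA m k i j = dA m k j i)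
    (hdN : ∀ k i j, dN k i j = E k i j - (∑ l, C i k l * N l j) - ∑ l, C j k l * N i l)
    (hR : ∀ i j, R i j = ∑ k, (dC k k i j - dC j k i k) +
      ∑ k, ∑ l, (C k k l * C l i j - C k j l * C l i k)) :
    (∑ k, ((∑ i, ∑ j, ((N i j * dA k k i j + dN k i j * A k i j) -
      (N i k * dA k j j i + dN k i k * A j j i))) + tV N A k * ∑ l, C l l k)) + tF N A E R =
    ∑ i, ∑ j, N i j * (∑ k, ((dC k k i j + dA k k i j) - (dC j k i k + dA j k i k)) +
      ∑ k, ∑ l, ((C k k l + A k k l) * (C l i j + A l i j) -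
        (C k j l + A k j l) * (C l i k + A l i k))) := by
  -- Here C is the background connection, A the difference tensor, C + A the connection of g, and E
  -- the covariant derivative of the inverse metric. The products E·A of the divergence will cancel
  -- those in F.
  have h1 : (∑ k, ((∑ i, ∑ j, ((N i j * dA k k i j + dN k i j * A k i j) -
      (N i k * dA k j j i + dN k i k * A j j i))) + tV N A k * ∑ l, C l l k)) =
      (∑ k, ∑ i, ∑ j, N i j * dA k k i j) + (∑ k, ∑ i, ∑ j, E k i j * A k i j)
      - (∑ k, ∑ i, ∑ j, ∑ l, C i k l * N l j * A k i j)
      - (∑ k, ∑ i, ∑ j, ∑ l, C j k l * N i l * A k i j)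
      - (∑ k, ∑ i, ∑ j, N i k * dA k j j i) - (∑ k, ∑ i, ∑ j, E k i k * A j j i)
      + (∑ k, ∑ i, ∑ j, ∑ l, C i k l * N l k * A j j i)
      + (∑ k, ∑ i, ∑ j, ∑ l, C k k l * N i l * A j j i)
      + (∑ k, ∑ l, ∑ i, ∑ j, N i j * A k i j * C l l k)
      - (∑ k, ∑ l, ∑ i, ∑ j, N i k * A j j i * C l l k) := by
    simp only [tV, hdN, sub_mul, Finset.sum_mul, Finset.mul_sum, Finset.sum_add_distrib,
      Finset.sum_sub_distrib]
    ring
  have h2 : (∑ i, ∑ j, N i j * (∑ k, ((dC k k i j + dA k k i j) - (dC j k i k + dA j k i k)) +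
      ∑ k, ∑ l, ((C k k l + A k k l) * (C l i j + A l i j) -
        (C k j l + A k j l) * (C l i k + A l i k)))) =
      (∑ i, ∑ j, N i j * R i j) + (∑ i, ∑ j, ∑ k, N i j * dA k k i j)
      - (∑ i, ∑ j, ∑ k, N i j * dA j k i k)
      + (∑ i, ∑ j, N i j * ∑ k, ∑ l, (A k k l * A l i j - A k j l * A l i k))
      + (∑ i, ∑ j, ∑ k, ∑ l, N i j * (C k k l * A l i j))
      + (∑ i, ∑ j, ∑ k, ∑ l, N i j * (A k k l * C l i j))
      - (∑ i, ∑ j, ∑ k, ∑ l, N i j * (C k j l * A l i k))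
      - (∑ i, ∑ j, ∑ k, ∑ l, N i j * (A k j l * C l i k)) := by
    simp only [hR, ← Finset.mul_sum, ← Finset.sum_add_distrib, ← Finset.sum_sub_distrib, ← mul_add,
      ← mul_sub]
    refine Finset.sum_congr rfl fun i _ => Finset.sum_congr rfl fun j _ => ?_
    congr 1
    simp only [mul_add, add_mul, Finset.sum_add_distrib, Finset.sum_sub_distrib]
    ring
  -- The p's match the derivatives of A. The q's match the mixed products of C and A on both sides,
  -- except `q4`, by which two mixed terms of the divergence cancel each other.
  have p1 : (∑ k, ∑ i, ∑ j, N i j * dA k k i j) = ∑ i, ∑ j, ∑ k, N i j * dA k k i j := by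
    rw [sum3_comm12, sum3_comm23]
  have p2 : (∑ k, ∑ i, ∑ j, N i k * dA k j j i) = ∑ i, ∑ j, ∑ k, N i j * dA j k i k := by
    rw [sum3_comm12]
    exact sum3_congr fun a b c => by rw [hdA b c c a]
  have q1 : (∑ k, ∑ i, ∑ j, ∑ l, C i k l * N l j * A k i j) =
      ∑ i, ∑ j, ∑ k, ∑ l, N i j * (C k j l * A l i k) := by
    rw [sum4_comm23, sum4_comm12, sum4_comm34, sum4_comm23, sum4_comm34]
    exact sum4_congr fun a b c d => by rw [hC c d b, hA d c a, hN b a]; ring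
  have q2 : (∑ k, ∑ i, ∑ j, ∑ l, C j k l * N i l * A k i j) =
      ∑ i, ∑ j, ∑ k, ∑ l, N i j * (A k j l * C l i k) := by
    rw [sum4_comm34, sum4_comm23, sum4_comm12, sum4_comm23]
    exact sum4_congr fun a b c d => by rw [hC d c a, hN b a]; ring
  have q3 : (∑ k, ∑ i, ∑ j, ∑ l, C i k l * N l k * A j j i) =
      ∑ i, ∑ j, ∑ k, ∑ l, N i j * (A k k l * C l i j) := by
    rw [sum4_comm34, sum4_comm23, sum4_comm34]
    exact sum4_congr fun a b c d => by rw [hN b a]; ring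
  have q4 : (∑ k, ∑ i, ∑ j, ∑ l, C k k l * N i l * A j j i) =
      ∑ k, ∑ l, ∑ i, ∑ j, N i k * A j j i * C l l k := by
    rw [sum4_comm34, sum4_comm23, sum4_comm12]
    exact sum4_congr fun a b c d => by ring
  have q5 : (∑ k, ∑ l, ∑ i, ∑ j, N i j * A k i j * C l l k) =
      ∑ i, ∑ j, ∑ k, ∑ l, N i j * (C k k l * A l i j) := by
    rw [sum4_comm23, sum4_comm12, sum4_comm34, sum4_comm23, sum4_comm34]
    exact sum4_congr fun a b c d => by ring
  rw [h1, h2, p1, p2, q1, q2, q3, q4, q5, tF]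
  ring

end ScalarIdentity



/-! ### Derivatives of the Riemannian density -/

section Density

variable {n : ℕ}

/-- The function `√(det m)` of the entries of a matrix. -/
def sqrtDet (m : Fin n × Fin n → ℝ) : ℝ := Real.sqrt (Matrix.of fun i j => m (i, j)).det

lemma contDiff_det_of : ContDiff ℝ ∞
    (fun m : Fin n × Fin n → ℝ => (Matrix.of fun i j => m (i, j)).det) := by
  simp only [Matrix.det_apply]
  refine ContDiff.sum fun σ _ => ?_
  simp only [Units.smul_def, zsmul_eq_mul]
  exact contDiff_const.mul (contDiff_prod fun i _ => contDiff_apply ℝ ℝ _)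

lemma isOpen_det_pos : IsOpen {m : Fin n × Fin n → ℝ | 0 < (Matrix.of fun i j => m (i, j)).det} :=
  isOpen_lt continuous_const contDiff_det_of.continuous

lemma contDiffOn_sqrtDet : ContDiffOn ℝ ∞ (sqrtDet (n := n))
    {m : Fin n × Fin n → ℝ | 0 < (Matrix.of fun i j => m (i, j)).det} :=
  contDiff_det_of.contDiffOn.sqrt fun _ hm => (ne_of_gt hm)

/-- The determinant is affine in each single entry, with the cofactor as slope; Jacobi's formula is
read off from this. -/
lemma det_add_single (M : Matrix (Fin n) (Fin n) ℝ) (a b : Fin n) (t : ℝ) :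
    (M + t • Matrix.of fun i j => if i = a ∧ j = b then (1 : ℝ) else 0).det =
      M.det + t * M.adjugate b a := by
  have h : (M + t • Matrix.of fun i j => if i = a ∧ j = b then (1 : ℝ) else 0) =
      M.updateRow a (M a + t • Pi.single b 1) := by
    ext i j
    by_cases hi : i = a
    · subst hi
      by_cases hj : j = b
      · subst hj; simp
      · simp [hj]
    · simp [hi]
  rw [h, Matrix.det_updateRow_add, Matrix.det_updateRow_smul, Matrix.updateRow_eq_self,
    Matrix.adjugate_apply]

lemma fderiv_det_single (m : Fin n × Fin n → ℝ) (a b : Fin n) :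
    fderiv ℝ (fun m : Fin n × Fin n → ℝ => (Matrix.of fun i j => m (i, j)).det) m
      (Pi.single (a, b) 1) = (Matrix.of fun i j => m (i, j)).adjugate b a := by
  have hd : DifferentiableAt ℝ
      (fun m : Fin n × Fin n → ℝ => (Matrix.of fun i j => m (i, j)).det) m :=
    contDiff_det_of.differentiable (by simp) m
  rw [← hd.lineDeriv_eq_fderiv, lineDeriv]
  have e : (fun t : ℝ => (Matrix.of fun i j => (m + t • (Pi.single (a, b) (1 : ℝ) : Fin n × Fin n → ℝ)) (i, j)).det) =
      fun t => (Matrix.of fun i j => m (i, j)).det +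
        t * (Matrix.of fun i j => m (i, j)).adjugate b a := by
    ext t
    rw [← det_add_single]
    congr 1
    ext i j
    simp [Pi.single_apply]
  rw [e]
  simp

lemma fderiv_sqrtDet_single {m : Fin n × Fin n → ℝ}
    (hm : 0 < (Matrix.of fun i j => m (i, j)).det) (a b : Fin n) :
    fderiv ℝ sqrtDet m (Pi.single (a, b) 1) =
      (1 / 2) * sqrtDet m * (Matrix.of fun i j => m (i, j))⁻¹ b a := by
  have hd : DifferentiableAt ℝ
      (fun m : Fin n × Fin n → ℝ => (Matrix.of fun i j => m (i, j)).det) m :=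
    contDiff_det_of.differentiable (by simp) m
  have h := (hd.hasFDerivAt.sqrt hm.ne').fderiv
  have h' : fderiv ℝ sqrtDet m = _ := h
  rw [h', _root_.smul_apply, fderiv_det_single, Matrix.inv_def, Matrix.smul_apply,
    Ring.inverse_eq_inv', smul_eq_mul, smul_eq_mul, sqrtDet]
  have hs := Real.sqrt_pos.2 hm
  have h2 := Real.mul_self_sqrt hm.le
  field_simp
  rw [pow_two, h2, mul_comm]

variable {W : Set (Model n)} {G H : Model n → Matrix (Fin n) (Fin n) ℝ}

/-- Two of the three Koszul terms cancel in the trace by the symmetry of N. -/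
lemma tChr_trace {N : Matrix (Fin n) (Fin n) ℝ} {T : Arr3 n} (hN : ∀ i j, N i j = N j i)
    (hT : ∀ k i j, T k i j = T k j i) (k : Fin n) :
    ∑ l, tChr N T l l k = (1 / 2) * ∑ a, ∑ b, N a b * T k a b := by
  simp only [tChr, ← Finset.mul_sum]
  congr 1
  have h : ∑ l, ∑ m, N l m * T m l k = ∑ l, ∑ m, N l m * T l k m := by
    rw [Finset.sum_comm]
    exact Finset.sum_congr rfl fun a _ => Finset.sum_congr rfl fun b _ => by rw [hN, hT a b k]
  simp only [mul_sub, mul_add, Finset.sum_add_distrib, Finset.sum_sub_distrib, h]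
  ring

lemma IsCoordMetricOn.pderiv_sqrt_det (hW : IsOpen W) (h : IsCoordMetricOn G W) {y : Model n}
    (hy : y ∈ W) (k : Fin n) : pderiv k (fun z => Real.sqrt (G z).det) y =
      Real.sqrt (G y).det * ∑ l, coordChristoffel G l l k y := by
  have hm : 0 < (Matrix.of fun i j => (fun a : Fin n × Fin n => G y a.1 a.2) (i, j)).det :=
    h.det_pos y hy
  have hd : ∀ a : Fin n × Fin n, DifferentiableAt ℝ (fun z => G z a.1 a.2) y := fun a =>
    (h.smooth a.1 a.2).differentiableAt_of_isOpen hW hy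
  have h1 := pderiv_comp (F := sqrtDet) (f := fun (a : Fin n × Fin n) z => G z a.1 a.2)
    ((contDiffOn_sqrtDet.contDiffAt (isOpen_det_pos.mem_nhds hm)).differentiableAt (by simp)) hd k
  change pderiv k (fun z => Real.sqrt (G z).det) y = _ at h1
  simp_rw [coordChristoffel_eq_tChr]
  rw [h1, tChr_trace (h.inv_symm hy) (h.pderiv_symm hW hy), Fintype.sum_prod_type]
  simp only [Finset.mul_sum]
  refine Finset.sum_congr rfl fun a _ => Finset.sum_congr rfl fun b _ => ?_
  rw [fderiv_sqrtDet_single hm, h.inv_symm hy a b]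
  change (1 / 2) * Real.sqrt (G y).det * (G y)⁻¹ b a * pderiv k (fun z => G z a b) y = _
  ring

lemma HasWeakPartial.sqrt_det (hW : IsOpen W) {k : Fin n} {v : Fin n → Fin n → Model n → ℝ}
    (hG : ∀ i j, HasWeakPartial W k (fun y => G y i j) (v i j))
    (hc : ∀ i j, ContinuousOn (fun y => G y i j) W) (hpos : ∀ y ∈ W, 0 < (G y).det) :
    HasWeakPartial W k (fun y => Real.sqrt (G y).det)
      (fun y => (1 / 2) * Real.sqrt (G y).det * ∑ a, ∑ b, (G y)⁻¹ b a * v a b y) := by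
  have h := HasWeakPartial.comp (F := sqrtDet) (f := fun (a : Fin n × Fin n) z => G z a.1 a.2)
    (v := fun a => v a.1 a.2) hW (fun a => hG a.1 a.2) (fun a => hc a.1 a.2) isOpen_det_pos
    (contDiffOn_sqrtDet.of_le (by simp)) hpos
  refine h.congr_ae (Eventually.of_forall fun _ => rfl) ?_
  refine (ae_restrict_iff' hW.measurableSet).2 (Eventually.of_forall fun y hy => ?_)
  have hm : 0 < (Matrix.of fun i j => (fun a : Fin n × Fin n => G y a.1 a.2) (i, j)).det := hpos y hy
  rw [Fintype.sum_prod_type]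
  simp only [Finset.mul_sum]
  refine Finset.sum_congr rfl fun a _ => Finset.sum_congr rfl fun b _ => ?_
  rw [fderiv_sqrtDet_single hm]
  change (1 / 2) * Real.sqrt (G y).det * (G y)⁻¹ b a * v a b y = _
  ring

end Density



/-! ### The divergence identity for two smooth metrics in a chart -/

section ChartIdentity

variable {n : ℕ} {W : Set (Model n)} {G H : Model n → Matrix (Fin n) (Fin n) ℝ}

/-- The covariant derivative of `G` with respect to the Levi-Civita connection of `H`. -/
def coordCovDeriv (G H : Model n → Matrix (Fin n) (Fin n) ℝ) (y : Model n) : Arr3 n :=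
  fun k i j => pderiv k (fun z => G z i j) y -
    ∑ l, (coordChristoffel H l k i y * G y l j + coordChristoffel H l k j y * G y i l)

/-- The difference of the Christoffel symbols of `G` and `H`. -/
def coordDiff (G H : Model n → Matrix (Fin n) (Fin n) ℝ) (y : Model n) : Arr3 n :=
  tChr (G y)⁻¹ (coordCovDeriv G H y)

/-- The scalar curvature of a coordinate metric. -/
def coordScalar (G : Model n → Matrix (Fin n) (Fin n) ℝ) (y : Model n) : ℝ :=
  ∑ i, ∑ j, (G y)⁻¹ i j * coordRicci G i j y

/-- Metric compatibility in algebraic form. Applied once to partial and once to covariant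
derivatives of G, it expresses the difference of the two derivatives of the inverse metric through
the background connection. -/
lemma tInv_eq {N : Matrix (Fin n) (Fin n) ℝ} {T : Arr3 n} (hN : ∀ i j, N i j = N j i)
    (hT : ∀ k i j, T k i j = T k j i) (k i j : Fin n) :
    tInv N T k i j = - (∑ l, tChr N T i k l * N l j) - ∑ l, tChr N T j k l * N i l := by
  have e1 : ∑ l, tChr N T i k l * N l j = (1 / 2) * ∑ a, ∑ b, N i a * N j b *
      (T k b a + T b k a - T a k b) := by
    simp only [tChr, Finset.mul_sum, Finset.sum_mul]
    rw [Finset.sum_comm]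
    exact Finset.sum_congr rfl fun a _ => Finset.sum_congr rfl fun b _ => by rw [hN b j]; ring
  have e2 : ∑ l, tChr N T j k l * N i l = (1 / 2) * ∑ a, ∑ b, N i a * N j b *
      (T k a b + T a k b - T b k a) := by
    simp only [tChr, Finset.mul_sum, Finset.sum_mul]
    exact Finset.sum_congr rfl fun a _ => Finset.sum_congr rfl fun b _ => by ring
  rw [e1, e2, tInv]
  have : ∑ a, ∑ b, N i a * N j b * T k a b =
      (1 / 2) * (∑ a, ∑ b, N i a * N j b * (T k b a + T b k a - T a k b)) +
      (1 / 2) * ∑ a, ∑ b, N i a * N j b * (T k a b + T a k b - T b k a) := by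
    simp only [Finset.mul_sum, ← Finset.sum_add_distrib]
    exact Finset.sum_congr rfl fun a _ => Finset.sum_congr rfl fun b _ => by rw [hT k b a]; ring
  rw [this]
  ring

lemma tChr_symm {N : Matrix (Fin n) (Fin n) ℝ} {T : Arr3 n} (hT : ∀ k i j, T k i j = T k j i)
    (k i j : Fin n) : tChr N T k i j = tChr N T k j i := by
  simp only [tChr]
  congr 1
  exact Finset.sum_congr rfl fun l _ => by rw [hT l i j]; ring

/-- Differentiation of G⁻¹G = 1. -/
lemma IsCoordMetricOn.pderiv_inv (hW : IsOpen W) (h : IsCoordMetricOn G W) {y : Model n}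
    (hy : y ∈ W) (k i j : Fin n) : pderiv k (fun z => (G z)⁻¹ i j) y =
      tInv (G y)⁻¹ (fun k i j => pderiv k (fun z => G z i j) y) k i j := by
  have dG : ∀ i j, DifferentiableAt ℝ (fun z => G z i j) y := fun i j =>
    (h.smooth i j).differentiableAt_of_isOpen hW hy
  have dN : ∀ i j, DifferentiableAt ℝ (fun z => (G z)⁻¹ i j) y := fun i j =>
    (h.smooth_inv i j).differentiableAt_of_isOpen hW hy
  have h1 : pderivMatrix k (fun z => (G z)⁻¹ * G z) y = 0 := by
    rw [pderivMatrix_congr (B := fun _ => 1) (by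
      filter_upwards [hW.mem_nhds hy] with z hz using h.inv_mul hz)]
    ext a b
    simp [pderivMatrix, pderiv]
  rw [pderivMatrix_mul dN dG] at h1
  have h2 : pderivMatrix k (fun z => (G z)⁻¹) y = - ((G y)⁻¹ * pderivMatrix k G y * (G y)⁻¹) := by
    have h3 := congrArg (· * (G y)⁻¹) h1
    simp only [Matrix.add_mul, Matrix.mul_assoc, h.mul_inv hy, Matrix.mul_one,
      Matrix.zero_mul] at h3
    rw [eq_neg_of_add_eq_zero_left h3, Matrix.mul_assoc]
  have h4 := congrFun (congrFun h2 i) j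
  simp only [pderivMatrix, Matrix.of_apply, Matrix.neg_apply, Matrix.mul_apply,
    Finset.sum_mul] at h4
  rw [h4, tInv, Finset.sum_comm]
  congr 1
  exact Finset.sum_congr rfl fun a _ => Finset.sum_congr rfl fun b _ => by
    rw [h.inv_symm hy j b]; ring

lemma coordCovDeriv_symm (hW : IsOpen W) (hG : IsCoordMetricOn G W)
    {y : Model n} (hy : y ∈ W) (k i j : Fin n) :
    coordCovDeriv G H y k i j = coordCovDeriv G H y k j i := by
  simp only [coordCovDeriv]
  rw [hG.pderiv_symm hW hy]
  congr 1
  refine Finset.sum_congr rfl fun l _ => ?_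
  rw [hG.symm_apply hy i l, hG.symm_apply hy j l]
  ring

lemma coordDiff_symm (hW : IsOpen W) (hG : IsCoordMetricOn G W)
    {y : Model n} (hy : y ∈ W) (k i j : Fin n) :
    coordDiff G H y k i j = coordDiff G H y k j i :=
  tChr_symm (coordCovDeriv_symm hW hG hy) k i j

/-- The partial derivatives of G are its covariant derivatives plus two terms in the lowered symbols
of H, which are symmetric as `tChr_add_symm` requires; raising the index again gives back the
symbols of H. -/
lemma coordDiff_eq (hW : IsOpen W) (hG : IsCoordMetricOn G W) (hH : IsCoordMetricOn H W)
    {y : Model n} (hy : y ∈ W) (k i j : Fin n) :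
    coordChristoffel G k i j y = coordChristoffel H k i j y + coordDiff G H y k i j := by
  rw [coordChristoffel_eq_tChr, tChr_add_symm
    (H := fun k i j => ∑ l, coordChristoffel H l k i y * G y l j) (D := coordCovDeriv G H y)]
  · congr 1
    have e : ∀ m, ∑ l, (G y)⁻¹ k l * G y m l = if k = m then 1 else 0 := by
      intro m
      have := congrFun (congrFun (hG.inv_mul hy) k) m
      rw [Matrix.mul_apply, Matrix.one_apply] at this
      rw [← this]
      exact Finset.sum_congr rfl fun b _ => by rw [hG.symm_apply hy]
    calc ∑ l, (G y)⁻¹ k l * ∑ m, coordChristoffel H m i j y * G y m l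
        = ∑ m, (∑ l, (G y)⁻¹ k l * G y m l) * coordChristoffel H m i j y := by
          simp only [Finset.mul_sum, Finset.sum_mul]
          rw [Finset.sum_comm]
          exact Finset.sum_congr rfl fun m _ => Finset.sum_congr rfl fun l _ => by ring
      _ = _ := by simp [e]
  · intro k i j
    exact Finset.sum_congr rfl fun l _ => by rw [hH.christoffel_symm hW hy]
  · intro k i j
    simp only [coordCovDeriv, Finset.sum_add_distrib]
    have : ∀ l, G y i l = G y l i := fun l => hG.symm_apply hy i l
    simp_rw [this]
    ring

lemma coordDiff_smooth (hW : IsOpen W) (hG : IsCoordMetricOn G W) (hH : IsCoordMetricOn H W)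
    (k i j : Fin n) : ContDiffOn ℝ ∞ (fun y => coordDiff G H y k i j) W :=
  ((hG.smooth_christoffel hW k i j).sub (hH.smooth_christoffel hW k i j)).congr fun y hy => by
    rw [coordDiff_eq hW hG hH hy]; ring

lemma tV_smooth (hW : IsOpen W) (hG : IsCoordMetricOn G W) (hH : IsCoordMetricOn H W)
    (k : Fin n) : ContDiffOn ℝ ∞ (fun y => tV (G y)⁻¹ (coordDiff G H y) k) W := by
  have hA := coordDiff_smooth hW hG hH
  exact ContDiffOn.sum fun i _ => ContDiffOn.sum fun j _ =>
    ((hG.smooth_inv i j).mul (hA k i j)).sub ((hG.smooth_inv i k).mul (hA j j i))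

/-- The identity `div V + F = R`. -/
lemma div_add_scalar (hW : IsOpen W) (hG : IsCoordMetricOn G W) (hH : IsCoordMetricOn H W)
    {y : Model n} (hy : y ∈ W) :
    (∑ k, (pderiv k (fun z => tV (G z)⁻¹ (coordDiff G H z) k) y +
      tV (G y)⁻¹ (coordDiff G H y) k * ∑ l, coordChristoffel H l l k y)) +
      tF (G y)⁻¹ (coordDiff G H y) (tInv (G y)⁻¹ (coordCovDeriv G H y))
        (Matrix.of fun i j => coordRicci H i j y) = coordScalar G y := by
  have dA : ∀ k i j, DifferentiableAt ℝ (fun z => coordDiff G H z k i j) y := fun k i j =>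
    (coordDiff_smooth hW hG hH k i j).differentiableAt_of_isOpen hW hy
  have dC : ∀ k i j, DifferentiableAt ℝ (coordChristoffel H k i j) y := fun k i j =>
    (hH.smooth_christoffel hW k i j).differentiableAt_of_isOpen hW hy
  have dN : ∀ i j, DifferentiableAt ℝ (fun z => (G z)⁻¹ i j) y := fun i j =>
    (hG.smooth_inv i j).differentiableAt_of_isOpen hW hy
  have hV : ∀ k, pderiv k (fun z => tV (G z)⁻¹ (coordDiff G H z) k) y =
      ∑ i, ∑ j, (((G y)⁻¹ i j * pderiv k (fun z => coordDiff G H z k i j) y +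
        pderiv k (fun z => (G z)⁻¹ i j) y * coordDiff G H y k i j) -
      ((G y)⁻¹ i k * pderiv k (fun z => coordDiff G H z j j i) y +
        pderiv k (fun z => (G z)⁻¹ i k) y * coordDiff G H y j j i)) := by
    intro k
    simp only [tV]
    have d1 : ∀ i j, DifferentiableAt ℝ (fun z => (G z)⁻¹ i j * coordDiff G H z k i j) y :=
      fun i j => (dN i j).mul (dA k i j)
    have d2 : ∀ i j, DifferentiableAt ℝ (fun z => (G z)⁻¹ i k * coordDiff G H z j j i) y :=
      fun i j => (dN i k).mul (dA j j i)
    have d3 : ∀ i j, DifferentiableAt ℝ (fun z => (G z)⁻¹ i j * coordDiff G H z k i j -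
      (G z)⁻¹ i k * coordDiff G H z j j i) y := fun i j => (d1 i j).sub (d2 i j)
    rw [pderiv_sum _ fun i _ => DifferentiableAt.fun_sum fun j _ => d3 i j]
    refine Finset.sum_congr rfl fun i _ => ?_
    rw [pderiv_sum _ fun j _ => d3 i j]
    refine Finset.sum_congr rfl fun j _ => ?_
    rw [pderiv_sub (d1 i j) (d2 i j), pderiv_mul (dN i j) (dA k i j),
      pderiv_mul (dN i k) (dA j j i)]
  simp_rw [hV]
  rw [scalar_identity (C := fun k i j => coordChristoffel H k i j y)
    (dC := fun m k i j => pderiv m (coordChristoffel H k i j) y)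
    (dA := fun m k i j => pderiv m (fun z => coordDiff G H z k i j) y)
    (dN := fun m i j => pderiv m (fun z => (G z)⁻¹ i j) y)
    (hG.inv_symm hy) (hH.christoffel_symm hW hy) (coordDiff_symm hW hG hy)]
  · refine Finset.sum_congr rfl fun i _ => Finset.sum_congr rfl fun j _ => ?_
    have e : ∀ m k i j, pderiv m (coordChristoffel G k i j) y =
        pderiv m (coordChristoffel H k i j) y + pderiv m (fun z => coordDiff G H z k i j) y := by
      intro m k i j
      rw [← pderiv_add (dC k i j) (dA k i j)]
      exact pderiv_congr (by
        filter_upwards [hW.mem_nhds hy] with z hz using coordDiff_eq hW hG hH hz k i j) m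
    simp only [coordRicci, e, coordDiff_eq hW hG hH hy]
  · intro m k i j
    exact pderiv_congr (by
      filter_upwards [hW.mem_nhds hy] with z hz using coordDiff_symm hW hG hz k i j) m
  · intro k i j
    rw [hG.pderiv_inv hW hy, tInv_eq (hG.inv_symm hy) (hG.pderiv_symm hW hy),
      tInv_eq (hG.inv_symm hy) (coordCovDeriv_symm hW hG hy)]
    simp_rw [← coordChristoffel_eq_tChr, coordDiff_eq hW hG hH hy, add_mul,
      Finset.sum_add_distrib]
    simp only [coordDiff]
    ring
  · intro i j
    rfl

/-- The curvature pairing is a divergence up to the scalar curvature. -/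
lemma pairing_eq_div (hW : IsOpen W) (hG : IsCoordMetricOn G W) (hH : IsCoordMetricOn H W)
    {y : Model n} (hy : y ∈ W) {f : Model n → ℝ} (hf : DifferentiableAt ℝ f y) :
    (-(∑ k, tV (G y)⁻¹ (coordDiff G H y) k * pderiv k f y) +
      tF (G y)⁻¹ (coordDiff G H y) (tInv (G y)⁻¹ (coordCovDeriv G H y))
        (Matrix.of fun i j => coordRicci H i j y) * f y) * Real.sqrt (H y).det =
    -(∑ k, pderiv k (fun z => tV (G z)⁻¹ (coordDiff G H z) k * Real.sqrt (H z).det * f z) y) +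
      coordScalar G y * f y * Real.sqrt (H y).det := by
  have dV : ∀ k, DifferentiableAt ℝ (fun z => tV (G z)⁻¹ (coordDiff G H z) k) y := fun k =>
    (tV_smooth hW hG hH k).differentiableAt_of_isOpen hW hy
  have dH : DifferentiableAt ℝ (fun z => Real.sqrt (H z).det) y :=
    ((contDiffOn_det hH.smooth).sqrt hH.det_ne).differentiableAt_of_isOpen hW hy
  have dVH : ∀ k, DifferentiableAt ℝ
      (fun z => tV (G z)⁻¹ (coordDiff G H z) k * Real.sqrt (H z).det) y := fun k =>
    (dV k).mul dH
  -- The derivative of the weight √(det H) supplies exactly the trace of Christoffel symbols in the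
  -- covariant divergence of V.
  have e : ∀ k, pderiv k (fun z => tV (G z)⁻¹ (coordDiff G H z) k * Real.sqrt (H z).det * f z) y =
      Real.sqrt (H y).det * (tV (G y)⁻¹ (coordDiff G H y) k * pderiv k f y) +
      Real.sqrt (H y).det * f y * (pderiv k (fun z => tV (G z)⁻¹ (coordDiff G H z) k) y +
      tV (G y)⁻¹ (coordDiff G H y) k * ∑ l, coordChristoffel H l l k y) := by
    intro k
    rw [pderiv_mul (dVH k) hf, pderiv_mul (dV k) dH, hH.pderiv_sqrt_det hW hy]
    ring
  simp_rw [e]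
  rw [Finset.sum_add_distrib, ← Finset.mul_sum, ← Finset.mul_sum, ← div_add_scalar hW hG hH hy]
  ring

end ChartIdentity



/-! ### Coordinate frames and transition maps -/

section Frames

variable {n : ℕ} {M : Type*} [TopologicalSpace M] [ChartedSpace (Model n) M]

lemma isOpen_overlap {M : Type*} [TopologicalSpace M] (e e' : OpenPartialHomeomorph M (Model n)) :
    IsOpen (e.target ∩ e.symm ⁻¹' e'.source) := (e.symm.trans e').open_source

/-- A field of bilinear forms, read on the model space. -/
def bilinAt (B : BilinField n M) (x : M) : Model n →L[ℝ] Model n →L[ℝ] ℝ := B x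

/-- A field of trilinear forms, read on the model space. -/
def trilinAt (T : TrilinField n M) (x : M) : Model n →L[ℝ] Model n →L[ℝ] Model n →L[ℝ] ℝ := T x

/-- A one-form, read on the model space. -/
def oneFormAt (w : OneForm n M) (x : M) : Model n →L[ℝ] ℝ := w x

/-- The derivative of the inverse of a chart, read on the model space. -/
def chartSymmDeriv (e : OpenPartialHomeomorph M (Model n)) (y : Model n) : Model n →L[ℝ] Model n :=
  mfderiv (𝓡 n) (𝓡 n) e.symm y

/-- The matrix of the coordinate frame of the chart `e` in the coordinate frame of the preferred
chart. -/
def frameMatrix (e : OpenPartialHomeomorph M (Model n)) (y : Model n) :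
    Matrix (Fin n) (Fin n) ℝ :=
  Matrix.of fun a i => chartSymmDeriv e y (coordVec i) a

lemma chartSymmDeriv_coordVec (e : OpenPartialHomeomorph M (Model n)) (y : Model n) (i : Fin n) :
    chartSymmDeriv e y (coordVec i) = ∑ a, frameMatrix e y a i • (coordVec a : Model n) :=
  sum_coordVec _

variable [IsManifold (𝓡 n) ∞ M]

lemma isManifold_one : IsManifold (𝓡 n) 1 M := IsManifold.of_le (n := ∞) (by norm_num)

variable {e e' : OpenPartialHomeomorph M (Model n)}

/-- The transition map between two charts. -/
def transition (e e' : OpenPartialHomeomorph M (Model n)) (y : Model n) : Model n := e' (e.symm y)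

lemma contDiffOn_transition (he : e ∈ atlas (Model n) M) (he' : e' ∈ atlas (Model n) M) :
    ContDiffOn ℝ ∞ (transition e e') (e.target ∩ e.symm ⁻¹' e'.source) := by
  have h := (contDiffGroupoid ∞ (𝓡 n)).compatible he he'
  rw [contDiffGroupoid, mem_groupoid_of_pregroupoid] at h
  have h1 := h.1
  simp only [contDiffPregroupoid] at h1
  have : ContDiffOn ℝ ∞ (e.symm.trans e') (e.symm.trans e').source := by
    simpa [ContDiffOn] using h1
  exact this

lemma chartSymmDeriv_change (he : e ∈ atlas (Model n) M) (he' : e' ∈ atlas (Model n) M)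
    {y : Model n} (hy : y ∈ e.target) (hy' : e.symm y ∈ e'.source) :
    chartSymmDeriv e y = (chartSymmDeriv e' (transition e e' y)).comp
      (fderiv ℝ (transition e e') y) := by
  have := isManifold_one (n := n) (M := M)
  have hmem : y ∈ e.target ∩ e.symm ⁻¹' e'.source := ⟨hy, hy'⟩
  have hd : DifferentiableAt ℝ (transition e e') y :=
    ((contDiffOn_transition he he').contDiffAt ((isOpen_overlap e e').mem_nhds hmem)).differentiableAt
      (by simp)
  have hm : MDifferentiableAt (𝓡 n) (𝓡 n) e'.symm (transition e e' y) :=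
    mdifferentiableAt_atlas_symm he' (e'.map_source hy')
  have h1 : e.symm =ᶠ[𝓝 y] e'.symm ∘ transition e e' := by
    filter_upwards [(isOpen_overlap e e').mem_nhds hmem] with z hz
    exact (e'.left_inv hz.2).symm
  have h2 : HasMFDerivAt (𝓡 n) (𝓡 n) (e'.symm ∘ transition e e') y _ :=
    hm.hasMFDerivAt.comp y hd.hasFDerivAt.hasMFDerivAt
  exact (h2.congr_of_eventuallyEq h1).mfderiv

/-- The tangent space at x is identified with ℝⁿ through the preferred chart at x, so the derivative
there is the identity. Hence `matrixAt`, written in the standard basis, is the coordinate matrix of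
that chart at x. -/
lemma chartSymmDeriv_chartAt (x : M) :
    chartSymmDeriv (chartAt (Model n) x) (chartAt (Model n) x x) =
      ContinuousLinearMap.id ℝ (Model n) := by
  have := isManifold_one (n := n) (M := M)
  have h := mfderivWithin_range_extChartAt_symm (I := 𝓡 n) (x := x)
  rw [ModelWithCorners.range_eq_univ, mfderivWithin_univ] at h
  exact h

end Frames



/-! ### Components of tensors in chart frames -/

section FrameComponents

variable {n : ℕ} {M : Type*} [TopologicalSpace M] [ChartedSpace (Model n) M]
  {e e' : OpenPartialHomeomorph M (Model n)} {y : Model n}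

lemma bilin_sum (t : Model n →L[ℝ] Model n →L[ℝ] ℝ) (R S : Matrix (Fin n) (Fin n) ℝ)
    (i j : Fin n) : t (∑ a, R i a • (coordVec a : Model n)) (∑ b, S j b • (coordVec b : Model n)) =
      act2 R S (fun a b => t (coordVec a) (coordVec b)) i j := by
  rw [map_sum t, _root_.sum_apply]
  refine Finset.sum_congr rfl fun a _ => ?_
  rw [map_smul, _root_.smul_apply, smul_eq_mul, map_sum]
  congr 1
  exact Finset.sum_congr rfl fun b _ => by rw [map_smul, smul_eq_mul]

set_option synthInstance.maxHeartbeats 400000 in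
lemma trilin_sum (t : Model n →L[ℝ] Model n →L[ℝ] Model n →L[ℝ] ℝ)
    (Q R S : Matrix (Fin n) (Fin n) ℝ) (k i j : Fin n) :
    t (∑ c, Q k c • (coordVec c : Model n)) (∑ a, R i a • (coordVec a : Model n))
      (∑ b, S j b • (coordVec b : Model n)) =
      act3 Q R S (fun c a b => t (coordVec c) (coordVec a) (coordVec b)) k i j := by
  rw [map_sum t, _root_.sum_apply, _root_.sum_apply]
  refine Finset.sum_congr rfl fun a _ => ?_
  rw [map_smul, _root_.smul_apply, _root_.smul_apply, smul_eq_mul, bilin_sum]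

lemma trilinAt_frame (T : TrilinField n M) (k i j : Fin n) :
    T (e.symm y) (chartFrame e y k) (chartFrame e y i) (chartFrame e y j) =
      act3 (frameMatrix e y)ᵀ (frameMatrix e y)ᵀ (frameMatrix e y)ᵀ
        (fun c a b => T (e.symm y) (coordVec c : Model n) (coordVec a : Model n)
          (coordVec b : Model n)) k i j := by
  change trilinAt T (e.symm y) (chartSymmDeriv e y (coordVec k)) (chartSymmDeriv e y (coordVec i))
    (chartSymmDeriv e y (coordVec j)) = act3 _ _ _ (fun c a b => trilinAt T (e.symm y)
      (coordVec c) (coordVec a) (coordVec b)) k i j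
  simp only [chartSymmDeriv_coordVec]
  exact trilin_sum _ (frameMatrix e y)ᵀ (frameMatrix e y)ᵀ (frameMatrix e y)ᵀ k i j

lemma bilinAt_frame (B : BilinField n M) : chartMatrix B e y =
    (frameMatrix e y)ᵀ * matrixAt B (e.symm y) * frameMatrix e y := by
  ext i j
  have h := mul_mul_transpose_apply (frameMatrix e y)ᵀ (matrixAt B (e.symm y)) i j
  rw [Matrix.transpose_transpose] at h
  rw [h]
  change bilinAt B (e.symm y) (chartSymmDeriv e y (coordVec i)) (chartSymmDeriv e y (coordVec j)) =
    act2 _ _ (fun a b => bilinAt B (e.symm y) (coordVec a) (coordVec b)) i j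
  simp only [chartSymmDeriv_coordVec]
  exact bilin_sum _ (frameMatrix e y)ᵀ (frameMatrix e y)ᵀ i j

lemma oneFormAt_frame (w : OneForm n M) (k : Fin n) : w (e.symm y) (chartFrame e y k) =
    ∑ a, (frameMatrix e y)ᵀ k a * w (e.symm y) (coordVec a : Model n) := by
  change oneFormAt w (e.symm y) (chartSymmDeriv e y (coordVec k)) =
    ∑ a, (frameMatrix e y)ᵀ k a * oneFormAt w (e.symm y) (coordVec a)
  generalize oneFormAt w (e.symm y) = t
  simp only [chartSymmDeriv_coordVec, map_sum, map_smul, Matrix.transpose_apply, smul_eq_mul]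

/-- A field of inner products. -/
structure IsMetricField (B : BilinField n M) : Prop where
  symm : ∀ x (v w : Model n), bilinAt B x v w = bilinAt B x w v
  pos : ∀ x (v : Model n), v ≠ 0 → 0 < bilinAt B x v v

lemma IsMetricField.matrixAt_posDef {B : BilinField n M} (h : IsMetricField B) (x : M) :
    (matrixAt B x).PosDef := by
  refine Matrix.PosDef.of_dotProduct_mulVec_pos ?_ ?_
  · ext i j
    exact h.symm x _ _
  · intro v hv
    have e1 : star v ⬝ᵥ (matrixAt B x *ᵥ v) = bilinAt B x (∑ a, v a • (coordVec a : Model n))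
        (∑ a, v a • (coordVec a : Model n)) := by
      have h1 := bilin_sum (bilinAt B x) (Matrix.of fun _ a => v a) (Matrix.of fun _ a => v a)
      -- The vector v is stored as the rows of a matrix, so a row index is needed to extract the
      -- formula; for n = 0 both sides vanish.
      by_cases hn : Nonempty (Fin n)
      · obtain ⟨i⟩ := hn
        refine Eq.trans ?_ (h1 i i).symm
        simp only [dotProduct, Matrix.mulVec, act2, Matrix.of_apply, star_trivial]
        exact Finset.sum_congr rfl fun a _ => congrArg _ <| Finset.sum_congr rfl fun b _ =>
          mul_comm _ _
      · have := not_nonempty_iff.1 hn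
        simp [dotProduct]
    rw [e1]
    refine h.pos x _ fun h0 => hv ?_
    ext i
    have := congrArg (fun z : Model n => z i) h0
    simpa [coordVec, Pi.single_apply] using this

lemma IsMetricField.chartMatrix_transpose {B : BilinField n M} (h : IsMetricField B) (y : Model n) :
    (chartMatrix B e y)ᵀ = chartMatrix B e y := by
  ext i j
  exact h.symm _ _ _

lemma det_chartMatrix {B : BilinField n M} (y : Model n) :
    (chartMatrix B e y).det = (frameMatrix e y).det ^ 2 * (matrixAt B (e.symm y)).det := by
  rw [bilinAt_frame, Matrix.det_mul, Matrix.det_mul, Matrix.det_transpose]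
  ring

variable [IsManifold (𝓡 n) ∞ M]

lemma SmoothMetric.isMetricField (h : SmoothMetric n M) : IsMetricField h.inner :=
  ⟨h.symm, h.pos⟩

lemma ContMetric.isMetricField (g : ContMetric n M) : IsMetricField g.inner :=
  ⟨g.symm, g.pos⟩

lemma frameMatrix_change (he : e ∈ atlas (Model n) M) (he' : e' ∈ atlas (Model n) M)
    (hy : y ∈ e.target) (hy' : e.symm y ∈ e'.source) :
    frameMatrix e y = frameMatrix e' (transition e e' y) * jacobian (transition e e') y := by
  have hd : DifferentiableAt ℝ (transition e e') y :=
    ((contDiffOn_transition he he').contDiffAt ((isOpen_overlap e e').mem_nhds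
      ⟨hy, hy'⟩)).differentiableAt (by simp)
  ext a i
  rw [Matrix.mul_apply]
  change chartSymmDeriv e y (coordVec i) a = _
  rw [chartSymmDeriv_change he he' hy hy', ContinuousLinearMap.comp_apply,
    sum_coordVec (fderiv ℝ (transition e e') y (coordVec i)), map_sum]
  simp only [map_smul, fderiv_coordVec_apply hd]
  rw [show (∑ b, jacobian (transition e e') y b i •
    chartSymmDeriv e' (transition e e' y) (coordVec b)) a = ∑ b, (jacobian (transition e e') y b i •
    chartSymmDeriv e' (transition e e' y) (coordVec b)) a by simp]
  exact Finset.sum_congr rfl fun b _ => mul_comm _ _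

lemma frameMatrix_chartAt (x : M) :
    frameMatrix (chartAt (Model n) x) (chartAt (Model n) x x) = 1 := by
  ext a i
  change chartSymmDeriv _ _ (coordVec i) a = _
  rw [chartSymmDeriv_chartAt]
  simp [coordVec, Matrix.one_apply]

/-- The preferred chart depends on the point, so this is a pointwise identity: at each y the
transition map goes to a different chart. It links the pointwise frames to the coordinate
transformation laws. -/
lemma frameMatrix_eq_jacobian (he : e ∈ atlas (Model n) M) (hy : y ∈ e.target) :
    frameMatrix e y = jacobian (transition e (chartAt (Model n) (e.symm y))) y := by
  rw [frameMatrix_change he (chart_mem_atlas (Model n) (e.symm y)) hy (mem_chart_source _ _)]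
  have : transition e (chartAt (Model n) (e.symm y)) y = chartAt (Model n) (e.symm y) (e.symm y) :=
    rfl
  rw [this, frameMatrix_chartAt, Matrix.one_mul]

lemma det_frameMatrix_ne (he : e ∈ atlas (Model n) M) (hy : y ∈ e.target) :
    (frameMatrix e y).det ≠ 0 := by
  set x := e.symm y with hx
  have h := frameMatrix_change (chart_mem_atlas (Model n) x) he
    (mem_chart_target (Model n) x) (by
      rw [(chartAt (Model n) x).left_inv (mem_chart_source _ _)]; exact e.map_target hy)
  have h2 : transition (chartAt (Model n) x) e (chartAt (Model n) x x) = y := by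
    rw [transition, (chartAt (Model n) x).left_inv (mem_chart_source _ _), hx, e.right_inv hy]
  rw [frameMatrix_chartAt, h2] at h
  intro h0
  have := congrArg Matrix.det h
  rw [Matrix.det_one, Matrix.det_mul, h0, zero_mul] at this
  exact one_ne_zero this

lemma IsMetricField.det_chartMatrix_pos {B : BilinField n M} (h : IsMetricField B)
    (he : e ∈ atlas (Model n) M) (hy : y ∈ e.target) : 0 < (chartMatrix B e y).det := by
  rw [det_chartMatrix]
  have := (h.matrixAt_posDef (e.symm y)).det_pos
  have := det_frameMatrix_ne he hy
  positivity

/-- Regularity of a field of bilinear forms on a set. -/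
def BilinField.ContMDiffOn (m : ℕ∞ω) (B : BilinField n M) (U : Set M) : Prop :=
  _root_.ContMDiffOn (𝓡 n) ((𝓡 n).prod 𝓘(ℝ, Model n →L[ℝ] Model n →L[ℝ] ℝ)) m
    (fun x : M => TotalSpace.mk' (Model n →L[ℝ] Model n →L[ℝ] ℝ)
      (E := fun x : M => TangentSpace (𝓡 n) x →L[ℝ] TangentSpace (𝓡 n) x →L[ℝ] ℝ)
      x (B x)) U

lemma contMDiffOn_chartFrame (he : e ∈ atlas (Model n) M) (i : Fin n) :
    _root_.ContMDiffOn (𝓡 n) (𝓡 n).tangent ∞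
      (fun y => TotalSpace.mk' (Model n) (E := fun x : M => TangentSpace (𝓡 n) x)
        (e.symm y) (chartFrame e y i)) e.target := by
  have h1 : _root_.ContMDiffOn (𝓡 n) (𝓡 n) ∞ e.symm e.target := contMDiffOn_symm_of_mem_maximalAtlas
    (IsManifold.subset_maximalAtlas he)
  have h2 := h1.contMDiffOn_tangentMapWithin (m := (∞ : ℕ∞ω)) (by simp) e.open_target.uniqueMDiffOn
  have h3 : ContMDiff (𝓡 n) (𝓡 n).tangent ∞ (fun y : Model n => TotalSpace.mk' (Model n)
      (E := fun x : Model n => TangentSpace (𝓡 n) x) y (coordVec i : Model n)) := by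
    intro z
    exact contMDiffAt_vectorSpace_iff_contDiffAt.2 contDiffAt_const
  refine (h2.comp h3.contMDiffOn (fun y hy => hy)).congr fun y hy => ?_
  simp only [Function.comp, tangentMapWithin]
  rw [mfderivWithin_of_isOpen e.open_target hy]
  rfl

lemma contDiffOn_chartMatrix {m : ℕ∞ω} (hm : m ≤ (∞ : ℕ∞ω)) {B : BilinField n M} {U : Set M}
    (hB : B.ContMDiffOn m U) (he : e ∈ atlas (Model n) M) (i j : Fin n) :
    ContDiffOn ℝ m (fun y => chartMatrix B e y i j) (e.target ∩ e.symm ⁻¹' U) := by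
  have h1 : _root_.ContMDiffOn (𝓡 n) (𝓡 n) ∞ e.symm e.target := contMDiffOn_symm_of_mem_maximalAtlas
    (IsManifold.subset_maximalAtlas he)
  have hv := fun i => ((contMDiffOn_chartFrame he i).of_le hm).mono
    (inter_subset_left (t := e.symm ⁻¹' U))
  have hc := hB.comp ((h1.of_le hm).mono (inter_subset_left (t := e.symm ⁻¹' U)))
    (fun y hy => hy.2)
  have : _root_.ContMDiffOn (𝓡 n) ((𝓡 n).prod 𝓘(ℝ)) m
      (fun y ↦ TotalSpace.mk' ℝ (E := Bundle.Trivial M ℝ) (e.symm y)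
        (B (e.symm y) (chartFrame e y i) (chartFrame e y j))) (e.target ∩ e.symm ⁻¹' U) := by
    apply ContMDiffOn.clm_bundle_apply₂ (F₁ := Model n) (F₂ := Model n)
    · exact hc
    · exact hv i
    · exact hv j
  intro y hy
  have := this y hy
  simp only [contMDiffWithinAt_totalSpace] at this
  exact this.2.contDiffWithinAt

end FrameComponents



/-! ### The curvature integrand in a fixed chart -/

section ChartFormula

variable {n : ℕ} {M : Type*} [TopologicalSpace M] [ChartedSpace (Model n) M]
  [IsManifold (𝓡 n) ∞ M] {e e' : OpenPartialHomeomorph M (Model n)} {y : Model n}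

lemma IsMetricField.isCoordMetricOn {B : BilinField n M} (h : IsMetricField B) {U : Set M}
    (hB : B.ContMDiffOn ∞ U) (he : e ∈ atlas (Model n) M) :
    IsCoordMetricOn (chartMatrix B e) (e.target ∩ e.symm ⁻¹' U) :=
  ⟨fun y _ => h.chartMatrix_transpose y, fun _ hy => h.det_chartMatrix_pos he hy.1,
    contDiffOn_chartMatrix le_rfl hB he⟩

lemma IsMetricField.isPullback {B : BilinField n M} (h : IsMetricField B) {U : Set M}
    (hU : IsOpen U) (hB : B.ContMDiffOn ∞ U) (he : e ∈ atlas (Model n) M)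
    (he' : e' ∈ atlas (Model n) M) :
    IsPullback (transition e e') (chartMatrix B e) (chartMatrix B e')
      (e.target ∩ e.symm ⁻¹' (e'.source ∩ U)) (e'.target ∩ e'.symm ⁻¹' U) where
  open_source := e.isOpen_inter_preimage_symm (e'.open_source.inter hU)
  open_target := e'.isOpen_inter_preimage_symm hU
  mapsTo := fun y hy => ⟨e'.map_source hy.2.1, by
    change e'.symm (e' (e.symm y)) ∈ U
    rw [e'.left_inv hy.2.1]
    exact hy.2.2⟩
  smooth := (contDiffOn_transition he he').mono fun y hy => ⟨hy.1, hy.2.1⟩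
  metric := (h.isCoordMetricOn hB he).mono fun y hy => ⟨hy.1, hy.2.2⟩
  metric' := h.isCoordMetricOn hB he'
  pullback := fun y hy => by
    have hx : e'.symm (transition e e' y) = e.symm y := e'.left_inv hy.2.1
    rw [bilinAt_frame, bilinAt_frame (e := e'), hx, frameMatrix_change he he' hy.1 hy.2.1,
      Matrix.transpose_mul]
    simp only [Matrix.mul_assoc]

/-- Tensoriality of Ricci for the transition from e to the preferred chart at the point under
consideration, whose Jacobian there is the frame matrix. -/
lemma IsMetricField.coordRicci_chart {B : BilinField n M} (h : IsMetricField B) {U : Set M}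
    (hU : IsOpen U) (hB : B.ContMDiffOn ∞ U) (he : e ∈ atlas (Model n) M) (hy : y ∈ e.target)
    (hyU : e.symm y ∈ U) (i j : Fin n) :
    coordRicci (chartMatrix B e) i j y = act2 (frameMatrix e y)ᵀ (frameMatrix e y)ᵀ
      (fun a b => ricciAt B (e.symm y) a b) i j := by
  rw [(h.isPullback hU hB he (chart_mem_atlas (Model n) (e.symm y))).coordRicci_eq
    ⟨hy, mem_chart_source _ _, hyU⟩, ← frameMatrix_eq_jacobian he hy]
  rfl

lemma frameMatrix_mul_inv (he : e ∈ atlas (Model n) M) (hy : y ∈ e.target) :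
    frameMatrix e y * (frameMatrix e y)⁻¹ = 1 :=
  Matrix.mul_nonsing_inv _ (isUnit_iff_ne_zero.2 (det_frameMatrix_ne he hy))

lemma inv_chartMatrix_apply (B : BilinField n M) (i j : Fin n) :
    (chartMatrix B e y)⁻¹ i j = act2 (frameMatrix e y)⁻¹ (frameMatrix e y)⁻¹
      (fun a b => (matrixAt B (e.symm y))⁻¹ a b) i j := by
  rw [← mul_mul_transpose_apply, bilinAt_frame, Matrix.mul_inv_rev, Matrix.mul_inv_rev,
    Matrix.transpose_nonsing_inv, Matrix.mul_assoc]

/-- The scalar curvature in a chart. -/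
lemma IsMetricField.coordScalar_chart {B : BilinField n M} (h : IsMetricField B) {U : Set M}
    (hU : IsOpen U) (hB : B.ContMDiffOn ∞ U) (he : e ∈ atlas (Model n) M) (hy : y ∈ e.target)
    (hyU : e.symm y ∈ U) :
    coordScalar (chartMatrix B e) y = scalarCurvature B (e.symm y) :=
  metric_trace_bilin_act (Rc := Matrix.of fun a b => ricciAt B (e.symm y) a b)
    (Rc' := Matrix.of fun a b => coordRicci (chartMatrix B e) a b y)
    (frameMatrix_mul_inv he hy) (inv_chartMatrix_apply B)
    (h.coordRicci_chart hU hB he hy hyU)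

/-- The components of a trilinear form in a chart. -/
def chartTrilin (T : TrilinField n M) (e : OpenPartialHomeomorph M (Model n)) (y : Model n) :
    Arr3 n :=
  fun k i j => T (e.symm y) (chartFrame e y k) (chartFrame e y i) (chartFrame e y j)

/-- The density `√(det G) / √(det H)`. -/
def coordRatio (G H : Model n → Matrix (Fin n) (Fin n) ℝ) (y : Model n) : ℝ :=
  Real.sqrt (G y).det / Real.sqrt (H y).det

lemma SmoothMetric.contMDiffOn (h : SmoothMetric n M) : BilinField.ContMDiffOn ∞ h.inner univ :=
  h.contMDiff.contMDiffOn

lemma ContMetric.contMDiffOn (g : ContMetric n M) : BilinField.ContMDiffOn 0 g.inner univ :=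
  (contMDiff_zero_iff.2 g.continuous).contMDiffOn

variable (h : SmoothMetric n M) (g : ContMetric n M)

/-- Both determinants acquire the same squared factor under a change of frame, so their quotient is
invariant. -/
lemma volumeRatio_chart (he : e ∈ atlas (Model n) M) (hy : y ∈ e.target) :
    volumeRatio h g (e.symm y) = coordRatio (chartMatrix g.inner e) (chartMatrix h.inner e) y := by
  have h0 := det_frameMatrix_ne he hy
  rw [coordRatio, det_chartMatrix, det_chartMatrix, Real.sqrt_mul (sq_nonneg _),
    Real.sqrt_mul (sq_nonneg _), mul_div_mul_left _ _ (by positivity)]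
  rfl

/-- The vector `V` in a chart. -/
def chartV (e : OpenPartialHomeomorph M (Model n)) (y : Model n) (k : Fin n) : ℝ :=
  tV (chartMatrix g.inner e y)⁻¹
    (tChr (chartMatrix g.inner e y)⁻¹ (chartTrilin (weakCovDeriv h g) e y)) k

/-- The function `F` in a chart. -/
def chartF (e : OpenPartialHomeomorph M (Model n)) (y : Model n) : ℝ :=
  tF (chartMatrix g.inner e y)⁻¹
    (tChr (chartMatrix g.inner e y)⁻¹ (chartTrilin (weakCovDeriv h g) e y))
    (tInv (chartMatrix g.inner e y)⁻¹ (chartTrilin (weakCovDeriv h g) e y))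
    (Matrix.of fun i j => coordRicci (chartMatrix h.inner e) i j y)

/-- The curvature integrand in a chart. -/
lemma curvatureIntegrand_chart (u : M → ℝ) (he : e ∈ atlas (Model n) M) (hy : y ∈ e.target) :
    curvatureIntegrand h g u (e.symm y) = - (∑ k, chartV h g e y k *
      weakDifferential (fun z => u z * volumeRatio h g z) (e.symm y) (chartFrame e y k)) +
      chartF h g e y * (u (e.symm y) * volumeRatio h g (e.symm y)) := by
  have hPQ := frameMatrix_mul_inv he hy
  have hN := inv_chartMatrix_apply (e := e) (y := y) g.inner
  have hT : ∀ k i j, chartTrilin (weakCovDeriv h g) e y k i j =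
      act3 (frameMatrix e y)ᵀ (frameMatrix e y)ᵀ (frameMatrix e y)ᵀ
        (covDerivMetric h g (e.symm y)) k i j := fun k i j => trilinAt_frame _ k i j
  have hA := tChr_act hPQ hN hT
  have hE := tInv_act hPQ hN hT
  have h1 : scalarF h g (e.symm y) = chartF h g e y :=
    (tF_act (Rc := Matrix.of fun a b => ricciAt h.inner (e.symm y) a b) hPQ hN hA hE
      (h.isMetricField.coordRicci_chart isOpen_univ h.contMDiffOn he hy (mem_univ _))).symm
  have h2 := sum_tV_act hPQ hN hA
    (w := fun a => weakDifferential (fun z => u z * volumeRatio h g z) (e.symm y)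
      (coordVec a : Model n)) (fun k => oneFormAt_frame _ k)
  rw [curvatureIntegrand, h1]
  congr 2
  exact h2.symm

end ChartFormula



/-! ### The Riemannian measure in charts -/

section Measure

variable {n : ℕ} {M : Type*} [TopologicalSpace M] [ChartedSpace (Model n) M]
  {e e' : OpenPartialHomeomorph M (Model n)}

lemma det_fderiv_eq {ψ : Model n → Model n} {y : Model n} (hψ : DifferentiableAt ℝ ψ y) :
    (fderiv ℝ ψ y).det = (jacobian ψ y).det := by
  rw [ContinuousLinearMap.det, ← LinearMap.det_toMatrix (EuclideanSpace.basisFun (Fin n) ℝ).toBasis]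
  congr 1
  ext a i
  rw [LinearMap.toMatrix_apply]
  simp only [OrthonormalBasis.coe_toBasis, EuclideanSpace.basisFun_apply,
    OrthonormalBasis.coe_toBasis_repr_apply, EuclideanSpace.basisFun_repr]
  exact fderiv_coordVec_apply hψ i a

/-- The density of the Riemannian measure in a chart. -/
def chartDensity (B : BilinField n M) (e : OpenPartialHomeomorph M (Model n)) : Measure (Model n) :=
  (volume.restrict e.target).withDensity
    fun y => ENNReal.ofReal (Real.sqrt (chartMatrix B e y).det)

variable [MeasurableSpace M] [BorelSpace M]

lemma aemeasurable_chart_symm (B : BilinField n M) (e : OpenPartialHomeomorph M (Model n)) :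
    AEMeasurable e.symm (chartDensity B e) :=
  (e.continuousOn_symm.aemeasurable e.open_target.measurableSet).mono_ac
    (withDensity_absolutelyContinuous _ _)

lemma chartVolume_apply (B : BilinField n M) (e : OpenPartialHomeomorph M (Model n)) {s : Set M}
    (hs : MeasurableSet s) : chartVolume B e s = ∫⁻ y in e.symm ⁻¹' s ∩ e.target,
      ENNReal.ofReal (Real.sqrt (chartMatrix B e y).det) := by
  change (chartDensity B e).map e.symm s = _
  rw [Measure.map_apply_of_aemeasurable (aemeasurable_chart_symm B e) hs, chartDensity,
    withDensity_apply', Measure.restrict_restrict' e.open_target.measurableSet]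

lemma chartVolume_compl_source (B : BilinField n M) (e : OpenPartialHomeomorph M (Model n)) :
    chartVolume B e e.sourceᶜ = 0 := by
  rw [chartVolume_apply B e e.open_source.measurableSet.compl]
  have : e.symm ⁻¹' e.sourceᶜ ∩ e.target = ∅ := by
    ext y
    simp only [mem_inter_iff, mem_preimage, mem_compl_iff, mem_empty_iff_false, iff_false, not_and]
    exact fun h1 h2 => h1 (e.map_target h2)
  rw [this]
  simp

lemma measurableSet_chart_preimage (e : OpenPartialHomeomorph M (Model n)) {s : Set M}
    (hs : MeasurableSet s) : MeasurableSet (e.symm ⁻¹' s ∩ e.target) := by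
  have h1 : AEMeasurable e.symm (volume.restrict e.target) :=
    e.continuousOn_symm.aemeasurable e.open_target.measurableSet
  have h2 : Measurable (e.target.domRestrict e.symm) :=
    (continuousOn_iff_continuous_domRestrict.1 e.continuousOn_symm).measurable
  have h3 := (MeasurableEmbedding.subtype_coe e.open_target.measurableSet).measurableSet_image.2
    (h2 hs)
  convert h3 using 1
  ext y
  simp only [mem_inter_iff, mem_preimage, mem_image, Subtype.exists,
    exists_and_right, exists_eq_right]
  exact ⟨fun h => ⟨h.2, h.1⟩, fun ⟨h, h'⟩ => ⟨h', h⟩⟩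

variable [IsManifold (𝓡 n) ∞ M]

/-- The change of variables formula: the Jacobian determinant of the transition map is the quotient
of the determinants of the two frames. -/
lemma chartVolume_overlap {B : BilinField n M} (he : e ∈ atlas (Model n) M)
    (he' : e' ∈ atlas (Model n) M) {s : Set M} (hs : MeasurableSet s) (h1 : s ⊆ e.source)
    (h2 : s ⊆ e'.source) : chartVolume B e' s = chartVolume B e s := by
  rw [chartVolume_apply B e hs, chartVolume_apply B e' hs]
  set A := e.symm ⁻¹' s ∩ e.target with hA
  have himg : transition e e' '' A = e'.symm ⁻¹' s ∩ e'.target := by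
    ext z
    constructor
    · rintro ⟨y, ⟨hy1, hy2⟩, rfl⟩
      refine ⟨?_, e'.map_source (h2 hy1)⟩
      change e'.symm (e' (e.symm y)) ∈ s
      rwa [e'.left_inv (h2 hy1)]
    · rintro ⟨hz1, hz2⟩
      have hz3 : e'.symm z ∈ s := hz1
      refine ⟨e (e'.symm z), ⟨?_, e.map_source (h1 hz3)⟩, ?_⟩
      · change e.symm (e (e'.symm z)) ∈ s
        rwa [e.left_inv (h1 hz3)]
      · rw [transition, e.left_inv (h1 hz3), e'.right_inv hz2]
  have hAm : MeasurableSet A := measurableSet_chart_preimage e hs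
  have hd : ∀ y ∈ A, DifferentiableAt ℝ (transition e e') y := fun y hy =>
    ((contDiffOn_transition he he').contDiffAt ((isOpen_overlap e e').mem_nhds
      ⟨hy.2, h2 hy.1⟩)).differentiableAt (by simp)
  have hinj : InjOn (transition e e') A := by
    intro y hy z hz hyz
    have h3 : e.symm y = e.symm z := e'.injOn (h2 hy.1) (h2 hz.1) hyz
    exact e.symm.injOn hy.2 hz.2 h3
  rw [← himg, lintegral_image_eq_lintegral_abs_det_fderiv_mul volume hAm
    (fun y hy => (hd y hy).hasFDerivAt.hasFDerivWithinAt) hinj]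
  refine setLIntegral_congr_fun hAm fun y hy => ?_
  have hx : e'.symm (transition e e' y) = e.symm y := e'.left_inv (h2 hy.1)
  rw [det_fderiv_eq (hd y hy), ← ENNReal.ofReal_mul (abs_nonneg _), det_chartMatrix,
    det_chartMatrix (e := e), hx, frameMatrix_change he he' hy.2 (h2 hy.1), Matrix.det_mul,
    Real.sqrt_mul (sq_nonneg _), Real.sqrt_mul (sq_nonneg _), Real.sqrt_sq_eq_abs,
    Real.sqrt_sq_eq_abs, abs_mul]
  congr 1
  ring

lemma chartVolume_le (B : BilinField n M) (he : e ∈ atlas (Model n) M) :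
    chartVolume B e ≤ riemannianMeasure B := le_iSup₂ (f := fun e _ => chartVolume B e) e he

variable [T2Space M]

/-- The Riemannian measure restricts to the chart measures. -/
lemma riemannianMeasure_restrict (B : BilinField n M) (he : e ∈ atlas (Model n) M) :
    (riemannianMeasure B).restrict e.source = chartVolume B e := by
  have hself : (chartVolume B e).restrict e.source = chartVolume B e :=
    Measure.restrict_eq_self_of_ae_mem (by
      rw [ae_iff]
      exact chartVolume_compl_source B e)
  refine le_antisymm ?_ ?_
  -- A supremum of measures is not computed set by set, so it is bounded by a single measure
  -- dominating every chart volume: the one of e plus infinitely many copies of counting measure off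
  -- the domain of e. The latter disappears on restriction.
  · have hle : riemannianMeasure B ≤
        chartVolume B e + (⊤ : ℝ≥0∞) • (Measure.count.restrict e.sourceᶜ : Measure M) := by
      refine iSup₂_le fun e' he' => Measure.le_iff.2 fun s hs => ?_
      rw [Measure.add_apply, Measure.smul_apply, Measure.restrict_apply hs, smul_eq_mul]
      by_cases hse : (s ∩ e.sourceᶜ).Nonempty
      · rw [ENNReal.top_mul (Measure.count_ne_zero hse), add_top]
        exact le_top
      · have hsub : s ⊆ e.source := fun x hx => by
          by_contra hx'
          exact hse ⟨x, hx, hx'⟩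
        calc chartVolume B e' s ≤ chartVolume B e' (s ∩ e'.source) +
              chartVolume B e' e'.sourceᶜ := by
              refine (measure_mono ?_).trans (measure_union_le _ _)
              intro x hx
              by_cases h : x ∈ e'.source
              · exact Or.inl ⟨hx, h⟩
              · exact Or.inr h
          _ = chartVolume B e (s ∩ e'.source) := by
              rw [chartVolume_compl_source, add_zero]
              exact chartVolume_overlap he he' (hs.inter e'.open_source.measurableSet)
                (inter_subset_left.trans hsub) inter_subset_right
          _ ≤ chartVolume B e s := measure_mono inter_subset_left
          _ ≤ _ := le_self_add
    refine (Measure.restrict_mono le_rfl hle).trans ?_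
    rw [Measure.restrict_add, hself, Measure.restrict_smul, Measure.restrict_restrict
      e.open_source.measurableSet, inter_compl_self, Measure.restrict_empty, smul_zero, add_zero]
  · calc chartVolume B e = (chartVolume B e).restrict e.source := hself.symm
      _ ≤ _ := Measure.restrict_mono le_rfl (chartVolume_le B he)

lemma aemeasurable_chart (B : BilinField n M) (e : OpenPartialHomeomorph M (Model n)) :
    AEMeasurable e (chartVolume B e) := by
  have hself : (chartVolume B e).restrict e.source = chartVolume B e :=
    Measure.restrict_eq_self_of_ae_mem (by
      rw [ae_iff]
      exact chartVolume_compl_source B e)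
  rw [← hself]
  exact e.continuousOn.aemeasurable e.open_source.measurableSet

lemma chartVolume_map (B : BilinField n M) (e : OpenPartialHomeomorph M (Model n)) :
    (chartVolume B e).map e = chartDensity B e := by
  have h := AEMeasurable.map_map_of_aemeasurable (aemeasurable_chart B e)
    (aemeasurable_chart_symm B e)
  change (chartVolume B e).map e = _ at h
  rw [h]
  have : (e ∘ e.symm) =ᵐ[chartDensity B e] id :=
    (withDensity_absolutelyContinuous _ _).ae_le
      ((ae_restrict_iff' e.open_target.measurableSet).2
        (Eventually.of_forall fun y hy => e.right_inv hy))
  exact (Measure.map_congr this).trans Measure.map_id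

lemma ae_restrict_source_of_chart (B : BilinField n M) (he : e ∈ atlas (Model n) M) {P : M → Prop}
    (hP : ∀ᵐ y ∂volume.restrict e.target, P (e.symm y)) :
    ∀ᵐ x ∂(riemannianMeasure B).restrict e.source, P x := by
  have h1 : ∀ᵐ y ∂(chartVolume B e).map e, P (e.symm y) := by
    rw [chartVolume_map]
    exact (withDensity_absolutelyContinuous _ _).ae_le hP
  have h2 := ae_of_ae_map (aemeasurable_chart B e) h1
  rw [← riemannianMeasure_restrict B he] at h2
  filter_upwards [h2, ae_restrict_mem e.open_source.measurableSet] with x hx hx'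
  rwa [e.left_inv hx'] at hx

lemma ae_of_ae_chart [SecondCountableTopology M] (B : BilinField n M) {P : M → Prop}
    (hP : ∀ e ∈ atlas (Model n) M, ∀ᵐ y ∂volume.restrict e.target, P (e.symm y)) :
    ∀ᵐ x ∂riemannianMeasure B, P x := by
  obtain ⟨s, hs, hu⟩ := TopologicalSpace.countable_cover_nhds
    (fun x : M => chart_source_mem_nhds (Model n) x)
  rw [← Measure.restrict_univ (μ := riemannianMeasure B), ← hu, ae_restrict_biUnion_iff _ hs]
  exact fun x _ => ae_restrict_source_of_chart B (chart_mem_atlas _ _) (hP _ (chart_mem_atlas _ _))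

variable {B : BilinField n M}

lemma aemeasurable_density (hc : ∀ i j, ContinuousOn (fun y => chartMatrix B e y i j) e.target) :
    AEMeasurable (fun y => ENNReal.ofReal (Real.sqrt (chartMatrix B e y).det))
      (volume.restrict e.target) := by
  have h1 : ContinuousOn (fun y => (chartMatrix B e y).det) e.target :=
    contDiffOn_zero.1 (contDiffOn_det fun i j => contDiffOn_zero.2 (hc i j))
  exact (ENNReal.continuous_ofReal.comp_continuousOn h1.sqrt).aemeasurable
    e.open_target.measurableSet

/-- The density is strictly positive on the chart, so Riemannian null sets are Lebesgue null in
coordinates. -/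
lemma ae_chart_of_ae (hB : IsMetricField B) (he : e ∈ atlas (Model n) M)
    (hc : ∀ i j, ContinuousOn (fun y => chartMatrix B e y i j) e.target) {P : M → Prop}
    (hP : ∀ᵐ x ∂riemannianMeasure B, P x) :
    ∀ᵐ y ∂volume.restrict e.target, P (e.symm y) := by
  have h1 : ∀ᵐ x ∂(chartDensity B e).map e.symm, P x :=
    (Measure.absolutelyContinuous_of_le (chartVolume_le B he)).ae_le hP
  have h2 := ae_of_ae_map (aemeasurable_chart_symm B e) h1
  rw [chartDensity, ae_withDensity_iff' (aemeasurable_density hc)] at h2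
  filter_upwards [h2, ae_restrict_mem e.open_target.measurableSet] with y hy hy'
  refine hy ?_
  rw [Ne, ENNReal.ofReal_eq_zero, not_le]
  exact Real.sqrt_pos.2 (hB.det_chartMatrix_pos he hy')

/-- Integrals over a chart domain. -/
lemma integral_source_eq (he : e ∈ atlas (Model n) M)
    (hc : ∀ i j, ContinuousOn (fun y => chartMatrix B e y i j) e.target) {f : M → ℝ}
    (hf : IntegrableOn (fun y => Real.sqrt (chartMatrix B e y).det * f (e.symm y)) e.target) :
    IntegrableOn f e.source (riemannianMeasure B) ∧ ∫ x in e.source, f x ∂riemannianMeasure B =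
      ∫ y in e.target, Real.sqrt (chartMatrix B e y).det * f (e.symm y) := by
  have hm := aemeasurable_density hc
  have hfin : ∀ᵐ y ∂volume.restrict e.target,
      ENNReal.ofReal (Real.sqrt (chartMatrix B e y).det) < ⊤ :=
    Eventually.of_forall fun y => ENNReal.ofReal_lt_top
  have hi : Integrable (fun y => f (e.symm y)) (chartDensity B e) := by
    rw [chartDensity, integrable_withDensity_iff_integrable_smul₀' hm hfin]
    simp only [ENNReal.toReal_ofReal (Real.sqrt_nonneg _), smul_eq_mul]
    exact hf
  have hfm : AEStronglyMeasurable f (chartVolume B e) := by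
    have h1 : AEStronglyMeasurable (fun y => f (e.symm y)) ((chartVolume B e).map e) := by
      rw [chartVolume_map]; exact hi.aestronglyMeasurable
    refine (h1.comp_aemeasurable (aemeasurable_chart B e)).congr ?_
    rw [← riemannianMeasure_restrict B he]
    filter_upwards [ae_restrict_mem e.open_source.measurableSet] with x hx
    simp [e.left_inv hx]
  rw [IntegrableOn, riemannianMeasure_restrict B he]
  refine ⟨(integrable_map_measure hfm (aemeasurable_chart_symm B e)).2 hi, ?_⟩
  have h2 := integral_map (aemeasurable_chart_symm B e) hfm
  change ∫ x, f x ∂(chartVolume B e) = _ at h2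
  rw [h2, chartDensity, integral_withDensity_eq_integral_toReal_smul₀ hm hfin]
  simp only [ENNReal.toReal_ofReal (Real.sqrt_nonneg _), smul_eq_mul]

end Measure



/-! ### Weak differentials on the manifold and the weak derivative of the density -/

section WeakDifferential

variable {n : ℕ} {M : Type*} [TopologicalSpace M] [ChartedSpace (Model n) M]
  {e e' : OpenPartialHomeomorph M (Model n)} {y : Model n} {f f' : M → ℝ} {w w' : OneForm n M}

lemma HasWeakDifferential.weakDifferential (h : HasWeakDifferential f w) :
    HasWeakDifferential f (weakDifferential f : OneForm n M) := by
  have H : ∃ w : OneForm n M, HasWeakDifferential f w := ⟨w, h⟩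
  rw [RoughMetric.weakDifferential, dif_pos H]
  exact H.choose_spec

lemma HasWeakDifferential.ae_eq (h : HasWeakDifferential f w) (h' : HasWeakDifferential f w')
    (he : e ∈ atlas (Model n) M) (k : Fin n) : ∀ᵐ y ∂volume.restrict e.target,
      w (e.symm y) (chartFrame e y k) = w' (e.symm y) (chartFrame e y k) :=
  (h e he k).ae_eq e.open_target (h' e he k)

variable [IsManifold (𝓡 n) ∞ M]

lemma contDiffOn_comp_chart {χ : M → ℝ} (hχ : ContMDiff (𝓡 n) 𝓘(ℝ) ∞ χ)
    (he : e ∈ atlas (Model n) M) : ContDiffOn ℝ ∞ (fun y => χ (e.symm y)) e.target :=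
  (hχ.comp_contMDiffOn (contMDiffOn_symm_of_mem_maximalAtlas
    (IsManifold.subset_maximalAtlas he))).contDiffOn

/-- The differential of a smooth function. -/
def smoothDifferential (χ : M → ℝ) (x : M) : TangentSpace (𝓡 n) x →L[ℝ] ℝ :=
  mfderiv (𝓡 n) 𝓘(ℝ) χ x

lemma smoothDifferential_frame {χ : M → ℝ} (hχ : ContMDiff (𝓡 n) 𝓘(ℝ) ∞ χ)
    (he : e ∈ atlas (Model n) M) (hy : y ∈ e.target) (k : Fin n) :
    smoothDifferential χ (e.symm y) (chartFrame e y k) = pderiv k (fun z => χ (e.symm z)) y := by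
  have := isManifold_one (n := n) (M := M)
  have h1 : MDifferentiableAt (𝓡 n) (𝓡 n) e.symm y := mdifferentiableAt_atlas_symm he hy
  have h2 : MDifferentiableAt (𝓡 n) 𝓘(ℝ) χ (e.symm y) := hχ.mdifferentiableAt (by simp)
  have h3 : HasMFDerivAt (𝓡 n) 𝓘(ℝ) (χ ∘ e.symm) y _ := h2.hasMFDerivAt.comp y h1.hasMFDerivAt
  have h4 := h3.mfderiv
  rw [mfderiv_eq_fderiv] at h4
  have h5 := congrArg (fun L : Model n →L[ℝ] ℝ => L (coordVec k)) h4
  exact h5.symm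

lemma MemSobolevLoc.smooth_mul {p q : ℝ≥0∞} [ENNReal.HolderConjugate p q] (hq : q ≠ ⊤) {u : M → ℝ}
    (hu : MemSobolevLoc n q u) {χ : M → ℝ} (hχ : ContMDiff (𝓡 n) 𝓘(ℝ) ∞ χ) :
    MemSobolevLoc n q (fun x => χ x * u x) := by
  obtain ⟨w, hw, hL⟩ := hu
  have hc : ∀ e ∈ atlas (Model n) M, ∀ k, ∀ᵐ y ∂volume.restrict e.target,
      w (e.symm y) (chartFrame e y k) * χ (e.symm y) +
        u (e.symm y) * pderiv k (fun z => χ (e.symm z)) y =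
      (χ (e.symm y) • w (e.symm y) + u (e.symm y) • smoothDifferential χ (e.symm y) :
        TangentSpace (𝓡 n) (e.symm y) →L[ℝ] ℝ) (chartFrame e y k) := by
    intro e he k
    refine (ae_restrict_iff' e.open_target.measurableSet).2 (Eventually.of_forall fun y hy => ?_)
    rw [← smoothDifferential_frame hχ he hy, mul_comm (w _ _)]
    rfl
  refine ⟨fun x => χ x • w x + u x • smoothDifferential χ x, fun e he k => ?_, fun e he => ?_⟩
  · have hs := contDiffOn_comp_chart hχ he
    have h1 := (hw e he k).mul (p := p) (q := q) e.open_target hq (hL e he).1 ((hL e he).2 k)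
      (hasWeakPartial_of_contDiffOn e.open_target (hs.of_le (by simp)) k) hs.continuousOn
      (contDiffOn_pderiv e.open_target hs k).continuousOn.memLpLoc
    exact h1.congr_ae (Eventually.of_forall fun y => mul_comm _ _) (hc e he k)
  · have hs := contDiffOn_comp_chart hχ he
    refine ⟨MemLpLoc.continuousOn_mul hs.continuousOn (hL e he).1, fun k => ?_⟩
    refine MemLpLoc.congr_ae (MemLpLoc.add (MemLpLoc.continuousOn_mul hs.continuousOn
      ((hL e he).2 k)) (MemLpLoc.continuousOn_mul
      (contDiffOn_pderiv e.open_target hs k).continuousOn (hL e he).1)) ?_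
    filter_upwards [hc e he k] with y hy
    rw [← hy]
    ring

variable {h : SmoothMetric n M} {g : ContMetric n M}

lemma HasWeakCovDeriv.weakCovDeriv {T : TrilinField n M} (hT : HasWeakCovDeriv h g T) :
    HasWeakCovDeriv h g (weakCovDeriv h g) := by
  have H : ∃ T : TrilinField n M, HasWeakCovDeriv h g T := ⟨T, hT⟩
  rw [RoughMetric.weakCovDeriv, dif_pos H]
  exact H.choose_spec

lemma MetricMemSobolevLoc.hasWeakCovDeriv {p : ℝ≥0∞} (hg : MetricMemSobolevLoc h p g) :
    HasWeakCovDeriv h g (weakCovDeriv h g) := hg.choose_spec.1.weakCovDeriv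

/-- Integrability is assumed for some weak covariant derivative, while `weakCovDeriv` is a choice;
uniqueness up to null sets transfers it. -/
lemma MetricMemSobolevLoc.memLpLoc {p : ℝ≥0∞} (hg : MetricMemSobolevLoc h p g)
    (he : e ∈ atlas (Model n) M) (k i j : Fin n) :
    MemLpLoc p e.target (fun y => chartTrilin (weakCovDeriv h g) e y k i j) := by
  obtain ⟨T, hT, hL⟩ := hg
  refine (hL e he k i j).congr_ae ?_
  filter_upwards [(hT e he k i j).ae_eq e.open_target (hT.weakCovDeriv e he k i j)] with y hy
  exact add_right_cancel hy

lemma SmoothMetric.isCoordMetricOn (h : SmoothMetric n M) (he : e ∈ atlas (Model n) M) :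
    IsCoordMetricOn (chartMatrix h.inner e) e.target :=
  (h.isMetricField.isCoordMetricOn h.contMDiffOn he).mono fun _ hy => ⟨hy, mem_univ _⟩

lemma ContMetric.continuousOn_chartMatrix (g : ContMetric n M) (he : e ∈ atlas (Model n) M)
    (i j : Fin n) : ContinuousOn (fun y => chartMatrix g.inner e y i j) e.target :=
  (contDiffOn_zero.1 (contDiffOn_chartMatrix (by simp) g.contMDiffOn he i j)).mono
    fun _ hy => ⟨hy, mem_univ _⟩

lemma ContMetric.det_pos (g : ContMetric n M) (he : e ∈ atlas (Model n) M) (hy : y ∈ e.target) :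
    0 < (chartMatrix g.inner e y).det := g.isMetricField.det_chartMatrix_pos he hy

lemma ContMetric.continuousOn_sqrt_det (g : ContMetric n M) (he : e ∈ atlas (Model n) M) :
    ContinuousOn (fun y => Real.sqrt (chartMatrix g.inner e y).det) e.target :=
  (contDiffOn_zero.1 (contDiffOn_det fun i j =>
    contDiffOn_zero.2 (g.continuousOn_chartMatrix he i j))).sqrt

lemma ContMetric.continuousOn_inv (g : ContMetric n M) (he : e ∈ atlas (Model n) M) (i j : Fin n) :
    ContinuousOn (fun y => (chartMatrix g.inner e y)⁻¹ i j) e.target :=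
  contDiffOn_zero.1 (contDiffOn_inv (fun i j => contDiffOn_zero.2 (g.continuousOn_chartMatrix he i j))
    (fun _ hy => (g.det_pos he hy).ne') i j)

lemma IsCoordMetricOn.smooth_sqrt_det {G : Model n → Matrix (Fin n) (Fin n) ℝ} {W : Set (Model n)}
    (hG : IsCoordMetricOn G W) : ContDiffOn ℝ ∞ (fun y => Real.sqrt (G y).det) W :=
  (contDiffOn_det hG.smooth).sqrt hG.det_ne

lemma continuousOn_coordRatio (h : SmoothMetric n M) (g : ContMetric n M)
    (he : e ∈ atlas (Model n) M) :
    ContinuousOn (coordRatio (chartMatrix g.inner e) (chartMatrix h.inner e)) e.target :=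
  (g.continuousOn_sqrt_det he).div (h.isCoordMetricOn he).smooth_sqrt_det.continuousOn fun _ hy =>
    (Real.sqrt_pos.2 ((h.isCoordMetricOn he).det_pos _ hy)).ne'

variable (h g) in
/-- The weak derivative `½ r gⁱʲ ∇̄ₖ gᵢⱼ` of the density in a chart. -/
def ratioDeriv (e : OpenPartialHomeomorph M (Model n)) (k : Fin n) (y : Model n) : ℝ :=
  (1 / 2) * coordRatio (chartMatrix g.inner e) (chartMatrix h.inner e) y *
    ∑ i, ∑ j, (chartMatrix g.inner e y)⁻¹ i j * chartTrilin (weakCovDeriv h g) e y k i j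

lemma IsCoordMetricOn.pderiv_inv_sqrt_det {H : Model n → Matrix (Fin n) (Fin n) ℝ}
    {W : Set (Model n)} (hW : IsOpen W) (hH : IsCoordMetricOn H W) (hy : y ∈ W) (k : Fin n) :
    pderiv k (fun z => (Real.sqrt (H z).det)⁻¹) y =
      - (Real.sqrt (H y).det)⁻¹ * ∑ l, coordChristoffel H l l k y := by
  have hne : ∀ z ∈ W, Real.sqrt (H z).det ≠ 0 := fun z hz => (Real.sqrt_pos.2 (hH.det_pos z hz)).ne'
  have d1 : DifferentiableAt ℝ (fun z => Real.sqrt (H z).det) y :=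
    hH.smooth_sqrt_det.differentiableAt_of_isOpen hW hy
  have d2 : DifferentiableAt ℝ (fun z => (Real.sqrt (H z).det)⁻¹) y := d1.inv (hne y hy)
  have h1 : pderiv k (fun z => Real.sqrt (H z).det * (Real.sqrt (H z).det)⁻¹) y = 0 := by
    rw [pderiv_congr (f' := fun _ => 1) (by
      filter_upwards [hW.mem_nhds hy] with z hz using mul_inv_cancel₀ (hne z hz))]
    simp [pderiv]
  rw [pderiv_mul d1 d2, hH.pderiv_sqrt_det hW hy] at h1
  have h0 := hne y hy
  field_simp at h1 ⊢
  linarith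

/-- The chain rule for √(det G) and the product rule with the smooth factor 1/√(det H). The
Christoffel symbols of h that relate ∂g to ∇̄g contribute their trace, which cancels the derivative
of 1/√(det H) and leaves an expression in ∇̄g alone. -/
lemma hasWeakPartial_coordRatio {p q : ℝ≥0∞} [ENNReal.HolderConjugate p q] (hq : q ≠ ⊤)
    (hg : MetricMemSobolevLoc h p g) (he : e ∈ atlas (Model n) M) (k : Fin n) :
    HasWeakPartial e.target k (coordRatio (chartMatrix g.inner e) (chartMatrix h.inner e))
      (ratioDeriv h g e k) ∧ MemLpLoc p e.target (ratioDeriv h g e k) := by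
  have hH := h.isCoordMetricOn he
  have hG := g.continuousOn_chartMatrix he
  have hN := g.continuousOn_inv he
  have hT := hg.hasWeakCovDeriv
  have hTL := fun i j => hg.memLpLoc he k i j
  have hL : MemLpLoc p e.target (ratioDeriv h g e k) := by
    unfold ratioDeriv
    refine MemLpLoc.continuousOn_mul (continuousOn_const.mul (continuousOn_coordRatio h g he)) ?_
    exact MemLpLoc.sum _ fun i _ => MemLpLoc.sum _ fun j _ =>
      MemLpLoc.continuousOn_mul (hN i j) (hTL i j)
  refine ⟨?_, hL⟩
  have h1 := HasWeakPartial.sqrt_det e.open_target (fun i j => hT e he k i j) hG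
    (fun y hy => g.det_pos he hy)
  have hs : ContDiffOn ℝ ∞ (fun y => (Real.sqrt (chartMatrix h.inner e y).det)⁻¹) e.target :=
    hH.smooth_sqrt_det.inv fun y hy => (Real.sqrt_pos.2 (hH.det_pos y hy)).ne'
  have hpd := contDiffOn_pderiv e.open_target hs k
  have hv : MemLpLoc p e.target (fun y => (1 / 2) * Real.sqrt (chartMatrix g.inner e y).det *
      ∑ a, ∑ b, (chartMatrix g.inner e y)⁻¹ b a *
        (chartTrilin (weakCovDeriv h g) e y k a b + ∑ l,
          (coordChristoffel (chartMatrix h.inner e) l k a y * chartMatrix g.inner e y l b +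
          coordChristoffel (chartMatrix h.inner e) l k b y * chartMatrix g.inner e y a l))) := by
    refine MemLpLoc.continuousOn_mul (continuousOn_const.mul (g.continuousOn_sqrt_det he)) ?_
    refine MemLpLoc.sum _ fun a _ => MemLpLoc.sum _ fun b _ =>
      MemLpLoc.continuousOn_mul (hN b a) ((hTL a b).add (ContinuousOn.memLpLoc ?_))
    refine continuousOn_finsetSum _ fun l _ => ?_
    exact ((hH.smooth_christoffel e.open_target l k a).continuousOn.mul (hG l b)).add
      ((hH.smooth_christoffel e.open_target l k b).continuousOn.mul (hG a l))
  -- The smooth factor 1/√(det H) plays the part of the W^{1,q} function, and √(det G) that of the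
  -- continuous W^{1,p} one.
  have h2 := HasWeakPartial.mul (p := p) (q := q) e.open_target hq
    (hasWeakPartial_of_contDiffOn e.open_target (hs.of_le (by simp)) k)
    hs.continuousOn.memLpLoc hpd.continuousOn.memLpLoc h1 (g.continuousOn_sqrt_det he) hv
  refine h2.congr_ae (Eventually.of_forall fun y => ?_)
    ((ae_restrict_iff' e.open_target.measurableSet).2 (Eventually.of_forall fun y hy => ?_))
  · rw [coordRatio, div_eq_mul_inv, mul_comm]
  · rw [hH.pderiv_inv_sqrt_det e.open_target hy]
    set N := (chartMatrix g.inner e y)⁻¹ with hNdef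
    have hdet := (g.det_pos he hy).ne'
    have i1 : N * chartMatrix g.inner e y = 1 :=
      Matrix.nonsing_inv_mul _ (isUnit_iff_ne_zero.2 hdet)
    have i2 : chartMatrix g.inner e y * N = 1 :=
      Matrix.mul_nonsing_inv _ (isUnit_iff_ne_zero.2 hdet)
    have i1' : ∀ b l, ∑ a, N b a * chartMatrix g.inner e y a l = if b = l then 1 else 0 :=
      fun b l => by
      have := congrFun (congrFun i1 b) l
      rwa [Matrix.mul_apply, Matrix.one_apply] at this
    have i2' : ∀ l a, ∑ b, chartMatrix g.inner e y l b * N b a = if l = a then 1 else 0 :=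
      fun b l => by
      have := congrFun (congrFun i2 b) l
      rwa [Matrix.mul_apply, Matrix.one_apply] at this
    have hsym : ∀ i j, N i j = N j i := fun i j => by
      have : Nᵀ = N := by
        rw [hNdef, Matrix.transpose_nonsing_inv, g.isMetricField.chartMatrix_transpose]
      exact congrFun (congrFun this j) i
    -- Each of the two Christoffel terms contracts with the inverse metric to the same trace; with
    -- the factor ½ of the determinant formula, one trace is left for the cancellation.
    have s1 : ∑ a, ∑ b, ∑ l, N b a * (coordChristoffel (chartMatrix h.inner e) l k a y *
        chartMatrix g.inner e y l b) = ∑ l, coordChristoffel (chartMatrix h.inner e) l l k y := by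
      calc _ = ∑ a, ∑ l, coordChristoffel (chartMatrix h.inner e) l k a y *
            ∑ b, chartMatrix g.inner e y l b * N b a := by
            refine Finset.sum_congr rfl fun a _ => ?_
            simp only [Finset.mul_sum]
            rw [Finset.sum_comm]
            exact Finset.sum_congr rfl fun l _ => Finset.sum_congr rfl fun b _ => by ring
        _ = _ := by
            simp only [i2', mul_ite, mul_one, mul_zero, Finset.sum_ite_eq', Finset.mem_univ, if_true]
            exact Finset.sum_congr rfl fun l _ => hH.christoffel_symm e.open_target hy _ _ _
    have s2 : ∑ a, ∑ b, ∑ l, N b a * (coordChristoffel (chartMatrix h.inner e) l k b y *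
        chartMatrix g.inner e y a l) = ∑ l, coordChristoffel (chartMatrix h.inner e) l l k y := by
      calc _ = ∑ b, ∑ l, coordChristoffel (chartMatrix h.inner e) l k b y *
            ∑ a, N b a * chartMatrix g.inner e y a l := by
            rw [Finset.sum_comm]
            refine Finset.sum_congr rfl fun a _ => ?_
            simp only [Finset.mul_sum]
            rw [Finset.sum_comm]
            exact Finset.sum_congr rfl fun l _ => Finset.sum_congr rfl fun b _ => by ring
        _ = _ := by
            simp only [i1', mul_ite, mul_one, mul_zero, Finset.sum_ite_eq, Finset.mem_univ, if_true]
            exact Finset.sum_congr rfl fun l _ => hH.christoffel_symm e.open_target hy _ _ _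
    have s3 : ∑ a, ∑ b, N b a * (weakCovDeriv h g (e.symm y) (chartFrame e y k) (chartFrame e y a)
        (chartFrame e y b) + ∑ l,
        (coordChristoffel (chartMatrix h.inner e) l k a y * chartMatrix g.inner e y l b +
        coordChristoffel (chartMatrix h.inner e) l k b y * chartMatrix g.inner e y a l)) =
        (∑ i, ∑ j, N i j * chartTrilin (weakCovDeriv h g) e y k i j) +
        2 * ∑ l, coordChristoffel (chartMatrix h.inner e) l l k y := by
      rw [two_mul]
      nth_rewrite 1 [← s1]
      rw [← s2]
      simp only [← Finset.sum_add_distrib]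
      refine Finset.sum_congr rfl fun a _ => Finset.sum_congr rfl fun b _ => ?_
      rw [hsym a b, mul_add, Finset.mul_sum]
      simp only [mul_add]
      rfl
    rw [s3, ratioDeriv, coordRatio]
    have h0 : Real.sqrt (chartMatrix h.inner e y).det ≠ 0 :=
      (Real.sqrt_pos.2 (hH.det_pos y hy)).ne'
    field_simp
    ring

end WeakDifferential



/-! ### The integrand as a first-order operator with integrable coefficients -/

section Integrand

variable {n : ℕ}

lemma HasWeakPartial.add {Ω : Set (Model n)} {k : Fin n} {f f' v v' : Model n → ℝ}
    (h : HasWeakPartial Ω k f v) (h' : HasWeakPartial Ω k f' v') :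
    HasWeakPartial Ω k (fun y => f y + f' y) (fun y => v y + v' y) := by
  refine hasWeakPartial_of_integral_eq (h.1.add h'.1) (h.2.1.add h'.2.1) fun φ hφ hc hs => ?_
  have c1 := continuous_pderiv (hφ.of_le (by simp)) k
  have s1 : tsupport (pderiv k φ) ⊆ Ω := (tsupport_pderiv_subset k φ).trans hs
  simp only [add_mul]
  rw [integral_add (integrable_mul_of_locallyIntegrableOn h.1 c1 (hc.pderiv k) s1)
    (integrable_mul_of_locallyIntegrableOn h'.1 c1 (hc.pderiv k) s1), h.integral_eq hφ hc hs,
    h'.integral_eq hφ hc hs,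
    integral_add (integrable_mul_of_locallyIntegrableOn h.2.1 hφ.continuous hc hs)
    (integrable_mul_of_locallyIntegrableOn h'.2.1 hφ.continuous hc hs)]
  ring

lemma hasWeakPartial_zero {Ω : Set (Model n)} (k : Fin n) :
    HasWeakPartial Ω k (fun _ => 0) (fun _ => 0) :=
  ⟨locallyIntegrableOn_zero, locallyIntegrableOn_zero, fun φ _ _ _ => by simp⟩

lemma HasWeakPartial.sum {ι : Type*} (s : Finset ι) {Ω : Set (Model n)} {k : Fin n}
    {f v : ι → Model n → ℝ} (h : ∀ i ∈ s, HasWeakPartial Ω k (f i) (v i)) :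
    HasWeakPartial Ω k (fun y => ∑ i ∈ s, f i y) (fun y => ∑ i ∈ s, v i y) := by
  classical
  induction s using Finset.induction_on with
  | empty => simpa using hasWeakPartial_zero k
  | insert i s hi ih =>
    simp only [Finset.sum_insert hi]
    exact (h i (Finset.mem_insert_self _ _)).add (ih fun j hj => h j (Finset.mem_insert_of_mem hj))

variable {M : Type*} [TopologicalSpace M] [ChartedSpace (Model n) M] [IsManifold (𝓡 n) ∞ M]
  {e : OpenPartialHomeomorph M (Model n)} {y : Model n} (h : SmoothMetric n M) (g : ContMetric n M)

/-- The one-form `½ r gⁱʲ ∇̄gᵢⱼ`. -/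
def ratioForm (x : M) : TangentSpace (𝓡 n) x →L[ℝ] ℝ :=
  show Model n →L[ℝ] ℝ from ∑ k, ((1 / 2) * volumeRatio h g x *
    ∑ i, ∑ j, (matrixAt g.inner x)⁻¹ i j * covDerivMetric h g x k i j) •
      (EuclideanSpace.proj k : Model n →L[ℝ] ℝ)

lemma ratioForm_coordVec (x : M) (a : Fin n) : ratioForm h g x (coordVec a : Model n) =
    (1 / 2) * volumeRatio h g x *
      ∑ i, ∑ j, (matrixAt g.inner x)⁻¹ i j * covDerivMetric h g x a i j := by
  change (∑ k, ((1 / 2) * volumeRatio h g x *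
    ∑ i, ∑ j, (matrixAt g.inner x)⁻¹ i j * covDerivMetric h g x k i j) •
      (EuclideanSpace.proj k : Model n →L[ℝ] ℝ)) (coordVec a) = _
  simp [_root_.sum_apply, coordVec]

lemma ratioForm_frame (he : e ∈ atlas (Model n) M) (hy : y ∈ e.target) (k : Fin n) :
    ratioForm h g (e.symm y) (chartFrame e y k) = ratioDeriv h g e k y := by
  have hPQ := frameMatrix_mul_inv he hy
  have hN := inv_chartMatrix_apply (e := e) (y := y) g.inner
  have hT : ∀ k i j, chartTrilin (weakCovDeriv h g) e y k i j =
      act3 (frameMatrix e y)ᵀ (frameMatrix e y)ᵀ (frameMatrix e y)ᵀ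
        (covDerivMetric h g (e.symm y)) k i j := fun k i j => trilinAt_frame _ k i j
  rw [oneFormAt_frame, ratioDeriv, ← volumeRatio_chart h g he hy]
  simp_rw [ratioForm_coordVec]
  rw [metric_trace_act (R := (frameMatrix e y)ᵀ) hPQ hN hT, Finset.mul_sum]
  exact Finset.sum_congr rfl fun c _ => by ring

/-- A weak differential of `u`, with components in `L^q_loc`. -/
structure IsSobolevDifferential (q : ℝ≥0∞) (u : M → ℝ) (w : OneForm n M) : Prop where
  hasWeakDifferential : HasWeakDifferential u w
  memLpLoc : ∀ e ∈ atlas (Model n) M, MemLpLoc q e.target (fun y => u (e.symm y))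
  memLpLoc_form : ∀ e ∈ atlas (Model n) M, ∀ k,
    MemLpLoc q e.target (fun y => w (e.symm y) (chartFrame e y k))

variable {h g} {p q : ℝ≥0∞} [ENNReal.HolderConjugate p q] {u : M → ℝ} {w : OneForm n M}

/-- The product rule chart by chart, assembled into a one-form on M. It gives the weak
differentiability of u dμ_g/dμ_h claimed in the theorem. -/
lemma IsSobolevDifferential.mul_ratio (hq : q ≠ ⊤) (hg : MetricMemSobolevLoc h p g)
    (hu : IsSobolevDifferential q u w) :
    HasWeakDifferential (fun z => u z * volumeRatio h g z)
      (fun x => volumeRatio h g x • w x + u x • ratioForm h g x) := by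
  intro e he k
  have h1 := hasWeakPartial_coordRatio hq hg he k
  have h2 := (hu.hasWeakDifferential e he k).mul e.open_target hq (hu.memLpLoc e he)
    (hu.memLpLoc_form e he k) h1.1 (continuousOn_coordRatio h g he) h1.2
  refine h2.congr_ae
    ((ae_restrict_iff' e.open_target.measurableSet).2 (Eventually.of_forall fun y hy => ?_))
    ((ae_restrict_iff' e.open_target.measurableSet).2 (Eventually.of_forall fun y hy => ?_))
  · rw [← volumeRatio_chart h g he hy]
  · rw [← volumeRatio_chart h g he hy, ← ratioForm_frame h g he hy, mul_comm (w _ _)]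
    rfl

variable (h g) in
/-- The first order coefficients of the curvature pairing in a chart. -/
def chartA (e : OpenPartialHomeomorph M (Model n)) (k : Fin n) (y : Model n) : ℝ :=
  - Real.sqrt (chartMatrix g.inner e y).det * chartV h g e y k

variable (h g) in
/-- The zeroth order coefficient of the curvature pairing in a chart. -/
def chartB (e : OpenPartialHomeomorph M (Model n)) (y : Model n) : ℝ :=
  - Real.sqrt (chartMatrix h.inner e y).det * (∑ k, chartV h g e y k * ratioDeriv h g e k y) +
    Real.sqrt (chartMatrix g.inner e y).det * chartF h g e y

lemma sqrt_mul_coordRatio (he : e ∈ atlas (Model n) M) (hy : y ∈ e.target) :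
    Real.sqrt (chartMatrix h.inner e y).det *
      coordRatio (chartMatrix g.inner e) (chartMatrix h.inner e) y =
      Real.sqrt (chartMatrix g.inner e y).det :=
  mul_div_cancel₀ _ (Real.sqrt_pos.2 ((h.isCoordMetricOn he).det_pos y hy)).ne'

/-- The curvature integrand in a chart as a first order operator. -/
lemma IsSobolevDifferential.sqrt_mul_curvatureIntegrand (hq : q ≠ ⊤)
    (hg : MetricMemSobolevLoc h p g) (hu : IsSobolevDifferential q u w)
    (he : e ∈ atlas (Model n) M) : ∀ᵐ y ∂volume.restrict e.target,
      Real.sqrt (chartMatrix h.inner e y).det * curvatureIntegrand h g u (e.symm y) =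
        ∑ k, chartA h g e k y * w (e.symm y) (chartFrame e y k) +
          chartB h g e y * u (e.symm y) := by
  have h1 := hu.mul_ratio hq hg
  have h2 : ∀ᵐ y ∂volume.restrict e.target, ∀ k,
      weakDifferential (fun z => u z * volumeRatio h g z) (e.symm y) (chartFrame e y k) =
        volumeRatio h g (e.symm y) * w (e.symm y) (chartFrame e y k) +
          u (e.symm y) * ratioForm h g (e.symm y) (chartFrame e y k) :=
    ae_all_iff.2 fun k => h1.weakDifferential.ae_eq h1 he k
  filter_upwards [h2, ae_restrict_mem e.open_target.measurableSet] with y hy hyt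
  rw [curvatureIntegrand_chart h g u he hyt]
  simp_rw [hy, ratioForm_frame h g he hyt, volumeRatio_chart h g he hyt, chartA, chartB,
    ← sqrt_mul_coordRatio (h := h) (g := g) he hyt]
  simp only [mul_add, add_mul, Finset.sum_add_distrib, Finset.mul_sum, Finset.sum_mul, neg_mul,
    mul_neg, Finset.sum_neg_distrib, neg_add]
  have e1 : ∀ k, Real.sqrt (chartMatrix h.inner e y).det * (chartV h g e y k *
      (coordRatio (chartMatrix g.inner e) (chartMatrix h.inner e) y *
        w (e.symm y) (chartFrame e y k))) = Real.sqrt (chartMatrix h.inner e y).det *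
      coordRatio (chartMatrix g.inner e) (chartMatrix h.inner e) y * chartV h g e y k *
        w (e.symm y) (chartFrame e y k) := fun k => by ring
  have e2 : ∀ k, Real.sqrt (chartMatrix h.inner e y).det * (chartV h g e y k *
      (u (e.symm y) * ratioDeriv h g e k y)) = Real.sqrt (chartMatrix h.inner e y).det *
      (chartV h g e y k * ratioDeriv h g e k y) * u (e.symm y) := fun k => by ring
  simp_rw [e1, e2]
  ring

lemma memLpLoc_chartChr (hg : MetricMemSobolevLoc h p g) (he : e ∈ atlas (Model n) M)
    (k i j : Fin n) : MemLpLoc p e.target (fun y => tChr (chartMatrix g.inner e y)⁻¹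
      (chartTrilin (weakCovDeriv h g) e y) k i j) := by
  have hT := fun k i j => hg.memLpLoc he k i j
  unfold tChr
  exact (MemLpLoc.sum _ fun l _ => MemLpLoc.continuousOn_mul (g.continuousOn_inv he k l)
    (((hT i j l).add (hT j i l)).sub (hT l i j))).const_mul _

lemma memLpLoc_chartInv (hg : MetricMemSobolevLoc h p g) (he : e ∈ atlas (Model n) M)
    (k i j : Fin n) : MemLpLoc p e.target (fun y => tInv (chartMatrix g.inner e y)⁻¹
      (chartTrilin (weakCovDeriv h g) e y) k i j) := by
  have hT := fun k i j => hg.memLpLoc he k i j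
  unfold tInv
  exact (MemLpLoc.sum _ fun a _ => MemLpLoc.sum _ fun b _ => MemLpLoc.continuousOn_mul
    ((g.continuousOn_inv he i a).mul (g.continuousOn_inv he j b)) (hT k a b)).neg

lemma memLpLoc_chartV (hg : MetricMemSobolevLoc h p g) (he : e ∈ atlas (Model n) M)
    (k : Fin n) : MemLpLoc p e.target (fun y => chartV h g e y k) := by
  have hA := fun k i j => memLpLoc_chartChr hg he k i j
  unfold chartV tV
  exact MemLpLoc.sum _ fun i _ => MemLpLoc.sum _ fun j _ =>
    (MemLpLoc.continuousOn_mul (g.continuousOn_inv he i j) (hA k i j)).sub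
      (MemLpLoc.continuousOn_mul (g.continuousOn_inv he i k) (hA j j i))

lemma memLpLoc_chartA (hg : MetricMemSobolevLoc h p g) (he : e ∈ atlas (Model n) M)
    (k : Fin n) : MemLpLoc p e.target (chartA h g e k) :=
  MemLpLoc.continuousOn_mul (g.continuousOn_sqrt_det he).neg (memLpLoc_chartV hg he k)

lemma IsCoordMetricOn.continuousOn_coordRicci {H : Model n → Matrix (Fin n) (Fin n) ℝ}
    {W : Set (Model n)} (hW : IsOpen W) (hH : IsCoordMetricOn H W) (i j : Fin n) :
    ContinuousOn (coordRicci H i j) W := by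
  have hC := fun k i j => hH.smooth_christoffel hW k i j
  have hd := fun a k i j => (contDiffOn_pderiv hW (hC k i j) a).continuousOn
  unfold coordRicci
  refine (continuousOn_finsetSum _ fun k _ => (hd k k i j).sub (hd j k i k)).add
    (continuousOn_finsetSum _ fun k _ => continuousOn_finsetSum _ fun l _ => ?_)
  exact ((hC k k l).continuousOn.mul (hC l i j).continuousOn).sub
    ((hC k j l).continuousOn.mul (hC l i k).continuousOn)

/-- Apart from the continuous term with the Ricci curvature of h, every summand is a product of two
factors linear in ∇̄g with continuous coefficients; here 1/t = 2/p. -/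
lemma memLpLoc_chartF {t : ℝ≥0∞} [ENNReal.HolderTriple p p t] (hg : MetricMemSobolevLoc h p g)
    (he : e ∈ atlas (Model n) M) : MemLpLoc t e.target (chartF h g e) := by
  have hA := fun k i j => memLpLoc_chartChr hg he k i j
  have hE := fun k i j => memLpLoc_chartInv hg he k i j
  have hN := g.continuousOn_inv he
  have hR := (h.isCoordMetricOn he).continuousOn_coordRicci e.open_target
  unfold chartF tF
  refine MemLpLoc.add (MemLpLoc.add (MemLpLoc.sub ?_ ?_) ?_) ?_
  · exact MemLpLoc.sum _ fun i _ => MemLpLoc.sum _ fun j _ => ((hN i j).mul (hR i j)).memLpLoc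
  · exact MemLpLoc.sum _ fun k _ => MemLpLoc.sum _ fun i _ => MemLpLoc.sum _ fun j _ =>
      (hE k i j).mul (hA k i j)
  · exact MemLpLoc.sum _ fun k _ => MemLpLoc.sum _ fun i _ => MemLpLoc.sum _ fun j _ =>
      (hE k i k).mul (hA j j i)
  · exact MemLpLoc.sum _ fun i _ => MemLpLoc.sum _ fun j _ => MemLpLoc.continuousOn_mul (hN i j)
      (MemLpLoc.sum _ fun k _ => MemLpLoc.sum _ fun l _ =>
        ((hA k k l).mul (hA l i j)).sub ((hA k j l).mul (hA l i k)))

/-- The derivative of the density is also linear in ∇̄g, so its pairing with V is quadratic like F.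
-/
lemma memLpLoc_chartB {t : ℝ≥0∞} [ENNReal.HolderTriple p p t] (hq : q ≠ ⊤)
    (hg : MetricMemSobolevLoc h p g) (he : e ∈ atlas (Model n) M) :
    MemLpLoc t e.target (chartB h g e) := by
  refine MemLpLoc.add ?_ (MemLpLoc.continuousOn_mul (g.continuousOn_sqrt_det he)
    (memLpLoc_chartF hg he))
  refine MemLpLoc.continuousOn_mul (h.isCoordMetricOn he).smooth_sqrt_det.continuousOn.neg ?_
  exact MemLpLoc.sum _ fun k _ =>
    (memLpLoc_chartV hg he k).mul (hasWeakPartial_coordRatio hq hg he k).2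

variable [MeasurableSpace M] [BorelSpace M] [T2Space M] [SecondCountableTopology M]

/-- The curvature integrand is additive. -/
lemma curvatureIntegrand_sum {ι : Type*} (s : Finset ι) (hq : q ≠ ⊤)
    (hg : MetricMemSobolevLoc h p g) (hu : IsSobolevDifferential q u w) {v : ι → M → ℝ}
    {z : ι → OneForm n M} (hv : ∀ i ∈ s, IsSobolevDifferential q (v i) (z i))
    (huv : ∀ x, u x = ∑ i ∈ s, v i x) : ∀ᵐ x ∂riemannianMeasure h.inner,
      curvatureIntegrand h g u x = ∑ i ∈ s, curvatureIntegrand h g (v i) x := by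
  refine ae_of_ae_chart _ fun e he => ?_
  -- The weak differentials of the summands are chosen independently, so additivity holds only up to
  -- null sets, by uniqueness of weak derivatives.
  have h1 : ∀ᵐ y ∂volume.restrict e.target, ∀ k, w (e.symm y) (chartFrame e y k) =
      ∑ i ∈ s, z i (e.symm y) (chartFrame e y k) := by
    refine ae_all_iff.2 fun k => ?_
    have h2 := HasWeakPartial.sum s fun i hi => (hv i hi).hasWeakDifferential e he k
    simp_rw [← huv] at h2
    exact (hu.hasWeakDifferential e he k).ae_eq e.open_target h2
  have h3 : ∀ᵐ y ∂volume.restrict e.target, ∀ i ∈ s,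
      Real.sqrt (chartMatrix h.inner e y).det * curvatureIntegrand h g (v i) (e.symm y) =
        ∑ k, chartA h g e k y * z i (e.symm y) (chartFrame e y k) +
          chartB h g e y * v i (e.symm y) :=
    (ae_ball_iff s.countable_toSet).2 fun i hi => (hv i hi).sqrt_mul_curvatureIntegrand hq hg he
  filter_upwards [h1, h3, hu.sqrt_mul_curvatureIntegrand hq hg he,
    ae_restrict_mem e.open_target.measurableSet] with y h1 h3 h4 hy
  have h0 := (Real.sqrt_pos.2 ((h.isCoordMetricOn he).det_pos y hy)).ne'
  refine mul_left_cancel₀ h0 ?_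
  rw [h4, Finset.mul_sum, Finset.sum_congr rfl h3, Finset.sum_add_distrib, huv, Finset.mul_sum]
  congr 1
  simp_rw [h1, Finset.mul_sum]
  exact Finset.sum_comm

/-- The curvature integrand vanishes off the support of `u`. -/
lemma curvatureIntegrand_eq_zero (hq : q ≠ ⊤)
    (hg : MetricMemSobolevLoc h p g) (hu : IsSobolevDifferential q u w) :
    ∀ᵐ x ∂riemannianMeasure h.inner, x ∉ tsupport u → curvatureIntegrand h g u x = 0 := by
  refine ae_of_ae_chart _ fun e he => ?_
  set W := e.target ∩ e.symm ⁻¹' (tsupport u)ᶜ with hW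
  have hWo : IsOpen W := e.isOpen_inter_preimage_symm (isClosed_tsupport u).isOpen_compl
  -- On the open set off the support, u has the zero function as weak derivative, and uniqueness
  -- applies.
  have h1 : ∀ᵐ y ∂volume.restrict W, ∀ k, w (e.symm y) (chartFrame e y k) = 0 := by
    refine ae_all_iff.2 fun k => ?_
    refine ((hu.hasWeakDifferential e he k).mono inter_subset_left).ae_eq hWo ?_
    refine (hasWeakPartial_zero k).congr_ae ((ae_restrict_iff' hWo.measurableSet).2
      (Eventually.of_forall fun y hy => ?_)) (Eventually.of_forall fun _ => rfl)
    exact (image_eq_zero_of_notMem_tsupport hy.2).symm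
  rw [ae_restrict_iff' hWo.measurableSet] at h1
  filter_upwards [ae_restrict_of_ae h1, hu.sqrt_mul_curvatureIntegrand hq hg he,
    ae_restrict_mem e.open_target.measurableSet] with y h1 h4 hy hyu
  have h0 := (Real.sqrt_pos.2 ((h.isCoordMetricOn he).det_pos y hy)).ne'
  have h5 := h1 ⟨hy, hyu⟩
  simp only [h5, image_eq_zero_of_notMem_tsupport hyu, mul_zero, Finset.sum_const_zero,
    add_zero, mul_eq_zero, h0, false_or] at h4
  exact h4

end Integrand



/-! ### Positivity where the metric is smooth -/

section TestPositivity

variable {n : ℕ} {M : Type*} [TopologicalSpace M] [ChartedSpace (Model n) M] [IsManifold (𝓡 n) ∞ M]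
  {e : OpenPartialHomeomorph M (Model n)} {h : SmoothMetric n M} {g : ContMetric n M}
  {p q : ℝ≥0∞} [ENNReal.HolderConjugate p q]

lemma contDiff_mul_of_tsupport {m : ℕ∞ω} {W : Set (Model n)} (hW : IsOpen W) {φ s : Model n → ℝ}
    (hφ : ContDiff ℝ m φ) (hs : ContDiffOn ℝ m s W) (hφW : tsupport φ ⊆ W) :
    ContDiff ℝ m (fun y => φ y * s y) := by
  rw [contDiff_iff_contDiffAt]
  intro y
  by_cases hy : y ∈ tsupport φ
  · exact hφ.contDiffAt.mul (hs.contDiffAt (hW.mem_nhds (hφW hy)))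
  · have : (fun y => φ y * s y) =ᶠ[𝓝 y] fun _ => 0 := by
      filter_upwards [(isClosed_tsupport φ).isOpen_compl.mem_nhds hy] with z hz
      simp [image_eq_zero_of_notMem_tsupport hz]
    exact contDiffAt_const.congr_of_eventuallyEq this

/-- Positivity of the curvature pairing on test functions supported where the metric is smooth. -/
lemma chart_test_nonneg (hq : q ≠ ⊤) (hg : MetricMemSobolevLoc h p g) {S : Set M} (hS : IsClosed S)
    (hgS : SmoothMetricOn g Sᶜ) (hR : ∀ x ∈ Sᶜ, 0 ≤ scalarCurvature g.inner x)
    (he : e ∈ atlas (Model n) M) {φ : Model n → ℝ} (hφ : ContDiff ℝ ∞ φ)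
    (hc : HasCompactSupport φ) (hs : tsupport φ ⊆ e.target ∩ e.symm ⁻¹' Sᶜ)
    (hφ0 : ∀ y, 0 ≤ φ y) :
    0 ≤ ∫ y, (∑ k, chartA h g e k y * pderiv k φ y + chartB h g e y * φ y) := by
  set W := e.target ∩ e.symm ⁻¹' Sᶜ with hWdef
  have hW : IsOpen W := e.isOpen_inter_preimage_symm hS.isOpen_compl
  have hG : IsCoordMetricOn (chartMatrix g.inner e) W := g.isMetricField.isCoordMetricOn hgS he
  have hH : IsCoordMetricOn (chartMatrix h.inner e) W :=
    (h.isCoordMetricOn he).mono inter_subset_left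
  set G := chartMatrix g.inner e with hGdef
  set H := chartMatrix h.inner e with hHdef
  have hr : ContDiffOn ℝ ∞ (coordRatio G H) W :=
    hG.smooth_sqrt_det.div hH.smooth_sqrt_det fun y hy =>
      (Real.sqrt_pos.2 (hH.det_pos y hy)).ne'
  -- Where g is smooth its weak derivatives agree almost everywhere with the classical ones, so the
  -- classical divergence identity applies to the weakly defined coefficients.
  have hT : ∀ᵐ y ∂volume.restrict W, ∀ k i j, chartTrilin (weakCovDeriv h g) e y k i j =
      coordCovDeriv G H y k i j := by
    refine ae_all_iff.2 fun k => ae_all_iff.2 fun i => ae_all_iff.2 fun j => ?_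
    filter_upwards [((hg.hasWeakCovDeriv e he k i j).mono inter_subset_left).ae_eq hW
      (hasWeakPartial_of_contDiffOn hW ((hG.smooth i j).of_le (by simp)) k)] with y hy
    exact eq_sub_of_add_eq hy
  have hρ : ∀ᵐ y ∂volume.restrict W, ∀ k, ratioDeriv h g e k y = pderiv k (coordRatio G H) y := by
    refine ae_all_iff.2 fun k => ?_
    exact ((hasWeakPartial_coordRatio hq hg he k).1.mono inter_subset_left).ae_eq hW
      (hasWeakPartial_of_contDiffOn hW (hr.of_le (by simp)) k)
  set s : Fin n → Model n → ℝ := fun k y =>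
    tV (G y)⁻¹ (coordDiff G H y) k * Real.sqrt (H y).det * coordRatio G H y with hsdef
  have hsm : ∀ k, ContDiffOn ℝ ∞ (s k) W := fun k =>
    ((tV_smooth hW hG hH k).mul hH.smooth_sqrt_det).mul hr
  set D : Fin n → Model n → ℝ := fun k y => φ y * s k y with hD
  have hDs : ∀ k, ContDiff ℝ ∞ (D k) := fun k => contDiff_mul_of_tsupport hW hφ (hsm k) hs
  have hDc : ∀ k, HasCompactSupport (D k) := fun k => hc.mul_right
  have hDt : ∀ k, tsupport (D k) ⊆ tsupport φ := fun k => tsupport_mul_subset_left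
  have hae : ∀ᵐ y, (∑ k, chartA h g e k y * pderiv k φ y + chartB h g e y * φ y) =
      (-∑ k, pderiv k (D k) y) +
        coordScalar G y * (φ y * coordRatio G H y) * Real.sqrt (H y).det := by
    rw [ae_restrict_iff' hW.measurableSet] at hT hρ
    filter_upwards [hT, hρ] with y hTy hρy
    by_cases hy : y ∈ W
    · have hT' : chartTrilin (weakCovDeriv h g) e y = coordCovDeriv G H y := by
        ext k i j; exact hTy hy k i j
      have dφ : DifferentiableAt ℝ φ y := hφ.differentiable (by simp) y
      have dr : DifferentiableAt ℝ (coordRatio G H) y := hr.differentiableAt_of_isOpen hW hy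
      have dφr : DifferentiableAt ℝ (fun z => φ z * coordRatio G H z) y := dφ.mul dr
      have hV : ∀ k, chartV h g e y k = tV (G y)⁻¹ (coordDiff G H y) k := fun k => by
        rw [chartV, hT']; rfl
      have hF : chartF h g e y = tF (G y)⁻¹ (coordDiff G H y) (tInv (G y)⁻¹ (coordCovDeriv G H y))
        (Matrix.of fun i j => coordRicci H i j y) := by
        rw [chartF, hT']; rfl
      have hD' : ∀ k, pderiv k (D k) y = pderiv k (fun z => tV (G z)⁻¹ (coordDiff G H z) k *
          Real.sqrt (H z).det * (φ z * coordRatio G H z)) y := fun k => by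
        congr 1
        ext z
        simp only [hD, hsdef]
        ring
      simp_rw [hD']
      rw [← pairing_eq_div hW hG hH hy dφr, ← hF]
      have hsq : Real.sqrt (H y).det * coordRatio G H y = Real.sqrt (G y).det :=
        sqrt_mul_coordRatio he hy.1
      have hAk : ∀ k, chartA h g e k y =
          -(Real.sqrt (H y).det * coordRatio G H y) * chartV h g e y k := fun k => by
        rw [hsq]; rfl
      have hBy : chartB h g e y =
          - Real.sqrt (H y).det * (∑ k, chartV h g e y k * ratioDeriv h g e k y) +
            Real.sqrt (H y).det * coordRatio G H y * chartF h g e y := by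
        rw [hsq]; rfl
      simp_rw [pderiv_mul dφ dr, ← hρy hy, ← hV, hAk, hBy]
      simp only [mul_add, add_mul, Finset.sum_add_distrib, Finset.mul_sum, Finset.sum_mul, neg_mul,
        Finset.sum_neg_distrib, neg_add]
      have e1 : ∀ k, Real.sqrt (H y).det * coordRatio G H y * chartV h g e y k * pderiv k φ y =
        chartV h g e y k * (pderiv k φ y * coordRatio G H y) * Real.sqrt (H y).det :=
        fun k => by ring
      have e2 : ∀ k, Real.sqrt (H y).det * (chartV h g e y k * ratioDeriv h g e k y) * φ y =
        chartV h g e y k * (φ y * ratioDeriv h g e k y) * Real.sqrt (H y).det := fun k => by ring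
      simp_rw [e1, e2]
      ring
    · have hy' : y ∉ tsupport φ := fun h' => hy (hs h')
      have z1 : φ y = 0 := image_eq_zero_of_notMem_tsupport hy'
      have z2 : ∀ k, pderiv k φ y = 0 := fun k =>
        image_eq_zero_of_notMem_tsupport fun h' => hy' (tsupport_pderiv_subset k φ h')
      have z3 : ∀ k, pderiv k (D k) y = 0 := fun k =>
        image_eq_zero_of_notMem_tsupport fun h' => hy' (hDt k (tsupport_pderiv_subset k _ h'))
      simp [z1, z2, z3]
  have hB0 : ∀ y, 0 ≤ coordScalar G y * (φ y * coordRatio G H y) * Real.sqrt (H y).det := by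
    intro y
    by_cases hy : y ∈ W
    · have h1 : coordScalar G y = scalarCurvature g.inner (e.symm y) :=
        g.isMetricField.coordScalar_chart hS.isOpen_compl hgS he hy.1 hy.2
      rw [h1]
      have h2 := hR _ hy.2
      have h3 : 0 ≤ coordRatio G H y := div_nonneg (Real.sqrt_nonneg _) (Real.sqrt_nonneg _)
      have h4 := hφ0 y
      positivity
    · rw [image_eq_zero_of_notMem_tsupport fun h' => hy (hs h')]
      simp
  have hA : Integrable (fun y => -∑ k, pderiv k (D k) y) :=
    (integrable_finsetSum _ fun k _ => (continuous_pderiv ((hDs k).of_le (by simp)) k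
      ).integrable_of_hasCompactSupport ((hDc k).pderiv k)).neg
  have hA0 : ∫ y, (-∑ k, pderiv k (D k) y) = 0 := by
    rw [integral_neg, integral_finsetSum _ fun k _ => (continuous_pderiv
      ((hDs k).of_le (by simp)) k).integrable_of_hasCompactSupport ((hDc k).pderiv k),
      Finset.sum_eq_zero fun k _ => integral_pderiv_eq_zero ((hDs k).of_le (by simp)) (hDc k) k,
      neg_zero]
  rw [integral_congr_ae hae]
  -- If the curvature term were not integrable, the total would not be either, since the divergence
  -- part is; its integral is then 0 by convention and the inequality still holds.
  by_cases hBi : Integrable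
      (fun y => coordScalar G y * (φ y * coordRatio G H y) * Real.sqrt (H y).det)
  · rw [integral_add hA hBi, hA0, zero_add]
    exact integral_nonneg hB0
  · rw [integral_undef fun h' => hBi 
      ((h'.sub hA).congr (Eventually.of_forall fun y => by simp))]

end TestPositivity



/-! ### Charts are locally Lipschitz for the Riemannian distance -/

section ChartLipschitz

open scoped NNReal

variable {E : Type*} [NormedAddCommGroup E] [NormedSpace ℝ E]
  {H : Type*} [TopologicalSpace H] (I : ModelWithCorners ℝ E H)
  {M : Type*} [TopologicalSpace M] [ChartedSpace H M]
  [RiemannianBundle (fun x : M => TangentSpace I x)]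
  [IsManifold I 1 M]

/-- The length of the image of a path in a region where the derivative of the chart is bounded. -/
lemma edist_extChartAt_le_mul_pathELength {x : M} {C : ℝ≥0} {γ : ℝ → M}
    (hγ : ContMDiff 𝓘(ℝ, ℝ) I 1 γ) (hs : ∀ t ∈ Icc (0 : ℝ) 1, γ t ∈ (chartAt H x).source)
    (hC : ∀ t ∈ Icc (0 : ℝ) 1, ∀ v : TangentSpace I (γ t),
      enorm (E := E) (mfderiv I 𝓘(ℝ, E) (extChartAt I x) (γ t) v) ≤ C * ‖v‖ₑ) :
    edist (extChartAt I x (γ 0)) (extChartAt I x (γ 1)) ≤ C * pathELength I γ 0 1 := by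
  let γ' := extChartAt I x ∘ γ
  have hC' : CMDiff[Icc (0 : ℝ) 1] 1 γ' :=
    contMDiffOn_extChartAt.comp (I' := I) (t := (chartAt H x).source)
      hγ.contMDiffOn (fun t' ht' ↦ hs t' ht')
  rw [edist_comm, edist_eq_enorm_sub]
  calc
      ‖γ' 1 - γ' 0‖ₑ
    _ ≤ ∫⁻ t' in Icc (0 : ℝ) 1, ‖derivWithin γ' (Icc 0 1) t'‖ₑ := by
      apply enorm_sub_le_lintegral_derivWithin_Icc_of_contDiffOn_Icc _ zero_le_one
      rwa [← contMDiffOn_iff_contDiffOn]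
    _ ≤ ∫⁻ t' in Icc (0 : ℝ) 1, C * ‖mfderiv[Icc (0 : ℝ) 1] γ t' 1‖ₑ := by
      apply setLIntegral_mono' measurableSet_Icc (fun t' ht' ↦ ?_)
      have h1 : mfderiv[Icc (0 : ℝ) 1] γ' t' =
          (mfderiv% (extChartAt I x) (γ t')) ∘L (mfderiv[Icc (0 : ℝ) 1] γ t') := by
        apply mfderiv_comp_mfderivWithin
        · exact mdifferentiableAt_extChartAt (hs t' ht')
        · exact (hγ.mdifferentiable one_ne_zero).mdifferentiableOn _ ht'
        · rw [uniqueMDiffWithinAt_iff_uniqueDiffWithinAt]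
          exact uniqueDiffOn_Icc zero_lt_one _ ht'
      have h2 : derivWithin γ' (Icc 0 1) t' = (mfderiv I 𝓘(ℝ, E) (extChartAt I x) (γ t')
          (mfderivWithin 𝓘(ℝ, ℝ) I γ (Icc 0 1) t' 1) : E) := by
        rw [← fderivWithin_derivWithin, ← mfderivWithin_eq_fderivWithin]
        exact congr($h1 1)
      rw [h2]
      exact hC t' ht' _
    _ = C * pathELength I γ 0 1 := by
      rw [lintegral_const_mul' _ _ ENNReal.coe_ne_top,
          pathELength_eq_lintegral_mfderivWithin_Icc]

variable [IsContinuousRiemannianBundle E (fun x : M => TangentSpace I x)]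

/-- The derivative of the preferred chart is locally bounded. -/
lemma eventually_enorm_mfderiv_extChartAt_apply_le (x : M) :
    ∃ C : ℝ≥0, ∀ᶠ y in 𝓝 x, ∀ v : TangentSpace I y,
      enorm (E := E) (mfderiv I 𝓘(ℝ, E) (extChartAt I x) y v) ≤ C * ‖v‖ₑ := by
  obtain ⟨C, C_pos, hC⟩ := eventually_norm_trivializationAt_lt E (fun x : M => TangentSpace I x) x
  lift C to ℝ≥0 using C_pos.le
  refine ⟨C, ?_⟩
  filter_upwards [hC, chart_source_mem_nhds H x] with y hy h'y v
  have h1 : (mfderiv I 𝓘(ℝ, E) (extChartAt I x) y v : E) =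
      (trivializationAt E (TangentSpace I) x).continuousLinearMapAt ℝ y v :=
    congr($((TangentBundle.continuousLinearMapAt_trivializationAt (I := I) h'y).symm) v)
  rw [h1]
  refine (ContinuousLinearMap.le_opENorm _ _).trans ?_
  gcongr
  rw [enorm_le_coe]
  exact_mod_cast hy.le

/-- The preferred charts are locally Lipschitz for the Riemannian distance. -/
lemma exists_edist_extChartAt_le [RegularSpace M] (x : M) :
    ∃ C : ℝ≥0, ∃ U : Set M, IsOpen U ∧ x ∈ U ∧ U ⊆ (chartAt H x).source ∧ ∀ a ∈ U, ∀ b ∈ U,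
      edist (extChartAt I x a) (extChartAt I x b) ≤ C * riemannianEDist I a b := by
  obtain ⟨C, hC⟩ := eventually_enorm_mfderiv_extChartAt_apply_le I x
  obtain ⟨c, c_pos, hc⟩ := setOfPred_riemannianEDist_lt_subset_nhds I
    (inter_mem hC (chart_source_mem_nhds H x))
  -- Two points within c/4 of x are at distance below c/2. A curve joining them of length below c/2
  -- stays within 3c/4 of x, hence in the region where the derivative of the chart is bounded.
  have c4 : (0 : ℝ≥0∞) < ((c / 4 : ℝ≥0) : ℝ≥0∞) := by
    have : 0 < c / 4 := by positivity
    exact_mod_cast this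
  obtain ⟨U, hU, hUo, hxU⟩ := mem_nhds_iff.1 (eventually_riemannianEDist_lt I x c4)
  have h4 : ((c / 4 : ℝ≥0) : ℝ≥0∞) + ((c / 4 : ℝ≥0) : ℝ≥0∞) = ((c / 2 : ℝ≥0) : ℝ≥0∞) := by
    rw [← ENNReal.coe_add]
    congr 1
    ring
  have h3 : ((c / 4 : ℝ≥0) : ℝ≥0∞) + ((c / 2 : ℝ≥0) : ℝ≥0∞) < c := by
    rw [← ENNReal.coe_add, ENNReal.coe_lt_coe, ← NNReal.coe_lt_coe]
    push_cast
    have : (0 : ℝ) < c := c_pos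
    linarith
  have hcU : ∀ a ∈ U, riemannianEDist I x a < ((c / 4 : ℝ≥0) : ℝ≥0∞) := fun a ha => hU ha
  refine ⟨C, U, hUo, hxU, fun a ha => (hc ?_).2, fun a ha b hb => ?_⟩
  · exact (hcU a ha).trans (lt_of_le_of_lt le_self_add h3)
  have hab : riemannianEDist I a b < ((c / 2 : ℝ≥0) : ℝ≥0∞) := by
    refine (riemannianEDist_triangle (y := x)).trans_lt ?_
    rw [riemannianEDist_comm (x := a), ← h4]
    exact ENNReal.add_lt_add (hcU a ha) (hcU b hb)
  have key : ∀ r, riemannianEDist I a b < r → r < ((c / 2 : ℝ≥0) : ℝ≥0∞) →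
      edist (extChartAt I x a) (extChartAt I x b) ≤ C * r := by
    intro r hr hrc
    obtain ⟨γ, h0, h1, hγ, hlen, -⟩ := exists_lt_locally_constant_of_riemannianEDist_lt hr
      zero_lt_one
    have hmem : ∀ t ∈ Icc (0 : ℝ) 1, γ t ∈ {y | riemannianEDist I x y < c} := fun t ht => by
      have h2 : riemannianEDist I a (γ t) < ((c / 2 : ℝ≥0) : ℝ≥0∞) :=
        ((riemannianEDist_le_pathELength hγ.contMDiffOn h0 rfl ht.1).trans
          (pathELength_mono le_rfl ht.2)).trans_lt (hlen.trans hrc)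
      exact ((riemannianEDist_triangle (y := a)).trans_lt
        (ENNReal.add_lt_add (hcU a ha) h2)).trans h3
    have := edist_extChartAt_le_mul_pathELength I (x := x) (C := C) hγ
      (fun t ht => (hc (hmem t ht)).2) (fun t ht => (hc (hmem t ht)).1)
    rw [h0, h1] at this
    exact this.trans (by gcongr)
  -- The distance is an infimum of lengths that need not be attained, so the bound is proved for
  -- every slightly larger r and passed to the limit.
  have ht : Tendsto (fun r => (C : ℝ≥0∞) * r) (𝓝[>] (riemannianEDist I a b))
      (𝓝 (C * riemannianEDist I a b)) :=
    (ENNReal.Tendsto.const_mul tendsto_id (Or.inr ENNReal.coe_ne_top)).mono_left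
      nhdsWithin_le_nhds
  have : (𝓝[>] (riemannianEDist I a b)).NeBot := nhdsGT_neBot_of_exists_gt ⟨_, hab⟩
  refine ge_of_tendsto ht ?_
  filter_upwards [Ioo_mem_nhdsGT hab] with r hr
  exact key r hr.1 hr.2

end ChartLipschitz

/-! ### Hausdorff measures in charts -/

section HausdorffChart

open scoped NNReal

variable {n : ℕ} {M : Type*} [TopologicalSpace M] [ChartedSpace (Model n) M] [IsManifold (𝓡 n) ∞ M]
  [T2Space M] [MeasurableSpace M] [BorelSpace M]

/-- Around every point, the preferred chart does not increase Hausdorff measures by more than a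
constant factor. -/
lemma exists_hausdorffMeasure_chart_image_le (g : ContMetric n M) (x : M) :
    ∃ C : ℝ≥0, ∃ U : Set M, IsOpen U ∧ x ∈ U ∧ U ⊆ (chartAt (Model n) x).source ∧
      ∀ d : ℝ, 0 ≤ d → ∀ S : Set M,
        μH[d] (chartAt (Model n) x '' (S ∩ U)) ≤ (C : ℝ≥0∞) ^ d * hausdorffMeasure g d S := by
  let _ : RiemannianBundle (fun x : M => TangentSpace (𝓡 n) x) := ⟨g.toRiemannianMetric⟩
  have : LocallyCompactSpace M := ChartedSpace.locallyCompactSpace (Model n) M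
  have : IsManifold (𝓡 n) 1 M := IsManifold.of_le (n := ∞) (by norm_num)
  obtain ⟨C, U, hU, hx, hs, hC⟩ := exists_edist_extChartAt_le (𝓡 n) x
  refine ⟨C, U, hU, hx, hs, fun d hd S => ?_⟩
  let _ : EMetricSpace M := EMetricSpace.ofRiemannianMetric (𝓡 n) M
  have hL : LipschitzOnWith C (chartAt (Model n) x) U := fun a ha b hb => by
    have := hC a ha b hb
    simp only [extChartAt, mfld_simps] at this
    exact this
  refine ((hL.mono inter_subset_right).hausdorffMeasure_image_le hd).trans ?_
  exact mul_le_mul_right (measure_mono inter_subset_left) _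

end HausdorffChart



/-! ### Positivity for functions supported in one chart -/

section LocalPositivity

open scoped NNReal

variable {n : ℕ} {M : Type*} [TopologicalSpace M] [ChartedSpace (Model n) M] [IsManifold (𝓡 n) ∞ M]
  {e : OpenPartialHomeomorph M (Model n)} {h : SmoothMetric n M} {g : ContMetric n M}
  {p q s : ℝ≥0∞} [ENNReal.HolderConjugate p q]

/-- Positivity of the curvature pairing on test functions: a singular set of small Hausdorff
measure is removable. -/
lemma chart_test_nonneg_of_hausdorff (t : ℝ≥0∞) [ENNReal.HolderTriple p p t]
    [ENNReal.HolderConjugate t s] (hq : q ≠ ⊤) (hs : s ≠ ⊤) (hqn : q.toReal < n)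
    (hg : MetricMemSobolevLoc h p g) {S : Set M} (hS : IsClosed S)
    (hgS : SmoothMetricOn g Sᶜ) (hR : ∀ x ∈ Sᶜ, 0 ≤ scalarCurvature g.inner x)
    (he : e ∈ atlas (Model n) M) {U : Set M} (hU : IsOpen U) (hUe : U ⊆ e.source)
    (hZ1 : p ≠ ⊤ → μH[n - q.toReal] (e '' (S ∩ U)) ≠ ⊤)
    (hZ2 : p = ⊤ → μH[n - q.toReal] (e '' (S ∩ U)) = 0)
    {φ : Model n → ℝ} (hφ : ContDiff ℝ ∞ φ) (hc : HasCompactSupport φ)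
    (hφU : tsupport φ ⊆ e.target ∩ e.symm ⁻¹' U) (hφ0 : ∀ y, 0 ≤ φ y) :
    0 ≤ ∫ y, (∑ k, chartA h g e k y * pderiv k φ y + chartB h g e y * φ y) := by
  have hdiff : (e.target ∩ e.symm ⁻¹' U) \ (e '' (S ∩ U)) =
      e.target ∩ e.symm ⁻¹' (U ∩ Sᶜ) := by
    ext y
    constructor
    · rintro ⟨⟨hy, hyU⟩, hyZ⟩
      exact ⟨hy, hyU, fun hyS => hyZ ⟨e.symm y, ⟨hyS, hyU⟩, e.right_inv hy⟩⟩
    · rintro ⟨hy, hyU, hyS⟩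
      refine ⟨⟨hy, hyU⟩, ?_⟩
      rintro ⟨a, ⟨haS, haU⟩, rfl⟩
      rw [e.left_inv (hUe haU)] at hyS
      exact hyS haS
  refine pairing_test_nonneg_of_off (p := p) (q := q) (s := s) (t := t) hq hs
    (e.isOpen_inter_preimage_symm hU) hqn (Z := e '' (S ∩ U)) ?_ hZ1 hZ2
    (fun k => (memLpLoc_chartA hg he k).mono inter_subset_left)
    ((memLpLoc_chartB hq hg he).mono inter_subset_left) ?_ hφ hc hφU hφ0
  · rw [hdiff]
    exact e.isOpen_inter_preimage_symm (hU.inter hS.isOpen_compl)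
  · intro ψ hψ hψc hψs hψ0
    rw [hdiff] at hψs
    exact chart_test_nonneg hq hg hS hgS hR he hψ hψc
      (hψs.trans (inter_subset_inter_right _ (preimage_mono inter_subset_right))) hψ0

variable [T2Space M] [SecondCountableTopology M] [MeasurableSpace M] [BorelSpace M]
  {u : M → ℝ} {w : OneForm n M}

/-- The curvature pairing with nonnegative Sobolev functions supported in a chart. -/
lemma IsSobolevDifferential.integral_curvatureIntegrand_nonneg (t : ℝ≥0∞) [ENNReal.HolderTriple p p t]
    [ENNReal.HolderConjugate t s] (hq : q ≠ ⊤) (hs : s ≠ ⊤)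
    (hqn : q.toReal < n) (hqs : q.toReal⁻¹ - (n : ℝ)⁻¹ ≤ s.toReal⁻¹)
    (hg : MetricMemSobolevLoc h p g) (he : e ∈ atlas (Model n) M) {U : Set M} (hU : IsOpen U)
    (hUe : U ⊆ e.source)
    (htest : ∀ φ : Model n → ℝ, ContDiff ℝ ∞ φ → HasCompactSupport φ →
      tsupport φ ⊆ e.target ∩ e.symm ⁻¹' U → (∀ y, 0 ≤ φ y) →
      0 ≤ ∫ y, (∑ k, chartA h g e k y * pderiv k φ y + chartB h g e y * φ y))
    (hu : IsSobolevDifferential q u w) (hcs : HasCompactSupport u) (huU : tsupport u ⊆ U)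
    (hu0 : ∀ᵐ x ∂riemannianMeasure h.inner, 0 ≤ u x) :
    Integrable (curvatureIntegrand h g u) (riemannianMeasure h.inner) ∧
      0 ≤ ∫ x, curvatureIntegrand h g u x ∂riemannianMeasure h.inner := by
  have hΩ := e.isOpen_inter_preimage_symm hU
  have hK0 : IsCompact (e '' tsupport u) :=
    hcs.isCompact.image_of_continuousOn (e.continuousOn.mono (huU.trans hUe))
  have hK0Ω : e '' tsupport u ⊆ e.target ∩ e.symm ⁻¹' U := by
    rintro _ ⟨a, ha, rfl⟩
    refine ⟨e.map_source (hUe (huU ha)), ?_⟩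
    rw [mem_preimage, e.left_inv (hUe (huU ha))]
    exact huU ha
  -- Outside the chart target u ∘ e.symm takes meaningless values. The cutoff leaves it unchanged on
  -- the target, where it is 1 near the image of the support of u, and extends it by 0 to a Sobolev
  -- function on ℝⁿ.
  obtain ⟨θ, hθ, hθc, hθs, hθ01, hθ1⟩ := exists_cutoff hK0 hΩ hK0Ω
  have hθe : tsupport θ ⊆ e.target := hθs.trans inter_subset_left
  set f : Model n → ℝ := fun y => θ y * u (e.symm y) with hf
  set v : Fin n → Model n → ℝ := fun k y => θ y * w (e.symm y) (chartFrame e y k) +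
    pderiv k θ y * u (e.symm y) with hv
  have hw : ∀ k, HasWeakPartial univ k f (v k) := fun k =>
    (hu.hasWeakDifferential e he k).cutoff hθ hθc hθe
  have hfe : ∀ y ∈ e.target, f y = u (e.symm y) := fun y hy => by
    by_cases hyK : e.symm y ∈ tsupport u
    · have : θ y = 1 := (hθ1 y ⟨_, hyK, e.right_inv hy⟩).self_of_nhds
      simp [hf, this]
    · simp [hf, image_eq_zero_of_notMem_tsupport hyK]
  -- The cut off function equals u on the whole target, so the gradient of the cutoff contributes
  -- nothing almost everywhere.
  have hve : ∀ᵐ y ∂volume.restrict e.target, ∀ k, v k y = w (e.symm y) (chartFrame e y k) := by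
    refine ae_all_iff.2 fun k => ?_
    have h1 : HasWeakPartial e.target k (fun y => u (e.symm y)) (v k) :=
      ((hw k).mono (subset_univ _)).congr_ae ((ae_restrict_iff' e.open_target.measurableSet).2
        (Eventually.of_forall hfe)) (Eventually.of_forall fun _ => rfl)
    exact h1.ae_eq e.open_target (hu.hasWeakDifferential e he k)
  have hθ0 : ∀ y ∉ tsupport θ, θ y = 0 := fun y hy => image_eq_zero_of_notMem_tsupport hy
  have hdθ0 : ∀ k, ∀ y ∉ tsupport θ, pderiv k θ y = 0 := fun k y hy =>
    image_eq_zero_of_notMem_tsupport fun h' => hy (tsupport_pderiv_subset k θ h')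
  have hf0 : ∀ y ∉ tsupport θ, f y = 0 := fun y hy => by simp [hf, hθ0 y hy]
  have hv0 : ∀ k, ∀ y ∉ tsupport θ, v k y = 0 := fun k y hy => by
    simp [hv, hθ0 y hy, hdθ0 k y hy]
  have hfq : MemLp f q volume := (hu.memLpLoc e he).memLp_mul hθ.continuous hθc hθe
  have hvq : ∀ k, MemLp (v k) q volume := fun k =>
    ((hu.memLpLoc_form e he k).memLp_mul hθ.continuous hθc hθe).add
      ((hu.memLpLoc e he).memLp_mul (continuous_pderiv (hθ.of_le (by simp)) k) (hθc.pderiv k)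
        ((tsupport_pderiv_subset k θ).trans hθe))
  have hfs : MemLp f s volume := by
    have hq1 : 1 ≤ q := ENNReal.HolderConjugate.one_le q p
    lift q to ℝ≥0 using hq
    lift s to ℝ≥0 using hs
    exact memLp_of_hasWeakPartial (q := q) (s := s)
      (HasCompactSupport.intro hθc.isCompact hf0) hw hfq hvq (by exact_mod_cast hq1)
      (by exact_mod_cast hqn) hqs
  have hfpos : ∀ᵐ y, 0 ≤ f y := by
    have h1 := ae_chart_of_ae h.isMetricField he
      (fun i j => ((h.isCoordMetricOn he).smooth i j).continuousOn) hu0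
    rw [ae_restrict_iff' e.open_target.measurableSet] at h1
    filter_upwards [h1] with y hy
    by_cases hyθ : y ∈ tsupport θ
    · exact mul_nonneg (hθ01 y).1 (hy (hθe hyθ))
    · rw [hf0 y hyθ]
  obtain ⟨hI, hpos⟩ := pairing_nonneg_of_test (p := p) (q := q) (s := s) (t := t) hq hs hΩ
    (fun k => (memLpLoc_chartA hg he k).mono inter_subset_left)
    ((memLpLoc_chartB hq hg he).mono inter_subset_left) htest hθc.isCompact hθs hf0 hv0 hfpos hw
    hfq hvq hfs
  have hae : ∀ᵐ y ∂volume.restrict e.target,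
      (∑ k, chartA h g e k y * v k y + chartB h g e y * f y) =
      Real.sqrt (chartMatrix h.inner e y).det * curvatureIntegrand h g u (e.symm y) := by
    filter_upwards [hve, hu.sqrt_mul_curvatureIntegrand hq hg he,
      ae_restrict_mem e.open_target.measurableSet] with y h1 h2 hy
    rw [h2, hfe y hy]
    simp_rw [h1]
  obtain ⟨hIs, hEq⟩ := integral_source_eq (B := h.inner) he
    (fun i j => ((h.isCoordMetricOn he).smooth i j).continuousOn)
    (f := curvatureIntegrand h g u) ((hI.integrableOn (s := e.target)).congr_fun_ae hae)
  have hoff : ∀ᵐ x ∂riemannianMeasure h.inner, x ∉ e.source → curvatureIntegrand h g u x = 0 := by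
    filter_upwards [curvatureIntegrand_eq_zero hq hg hu] with x hx hxe
    exact hx fun h' => hxe (hUe (huU h'))
  refine ⟨hIs.integrable_of_ae_notMem_eq_zero hoff, ?_⟩
  rw [← setIntegral_eq_integral_of_ae_compl_eq_zero hoff, hEq, ← integral_congr_ae hae,
    setIntegral_eq_of_support]
  · exact hpos
  · intro y hy
    by_contra hyt
    have hyθ : y ∉ tsupport θ := fun h' => hyt (hθe h')
    exact hy (by simp [hf0 y hyθ, hv0 _ y hyθ])

end LocalPositivity

/-! ### Exponents -/

section Exponents

/-- With 1/t = 2/p and 1/s = 1 - 2/p, the Sobolev condition 1/q - 1/n ≤ 1/s becomes 1/p ≤ 1/n. From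
p ≥ n ≥ 3 one gets 1/t ≤ 2/3, so that t ≥ 1 and s is finite, and likewise 1/q ≥ 2/3, so that q ≤ 3/2
< n. -/
lemma exists_holder_exponents {n : ℕ} (hn : 3 ≤ n) {p q : ℝ≥0∞} [ENNReal.HolderConjugate p q]
    (hp : (n : ℝ≥0∞) ≤ p) :
    q ≠ ⊤ ∧ q.toReal < n ∧ (p ≠ ⊤ → q.toReal = p.toReal / (p.toReal - 1)) ∧
      (p = ⊤ → q.toReal = 1) ∧ ∃ t s : ℝ≥0∞, ∃ _ : ENNReal.HolderTriple p p t,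
        ∃ _ : ENNReal.HolderConjugate t s, s ≠ ⊤ ∧ q.toReal⁻¹ - (n : ℝ)⁻¹ ≤ s.toReal⁻¹ := by
  have hn3 : (3 : ℝ) ≤ n := by exact_mod_cast hn
  have hn1 : (n : ℝ)⁻¹ ≤ 3⁻¹ := inv_anti₀ (by norm_num) hn3
  have hpi : p⁻¹ ≠ ⊤ := by
    rw [Ne, ENNReal.inv_eq_top]
    rintro rfl
    simp at hp
    omega
  have hpn : p.toReal⁻¹ ≤ (n : ℝ)⁻¹ := by
    have := ENNReal.toReal_mono (by simp; omega) (ENNReal.inv_le_inv.2 hp)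
    simpa [ENNReal.toReal_inv] using this
  have hp0 : 0 ≤ p.toReal⁻¹ := by positivity
  have hqi : q⁻¹ ≠ ⊤ := by
    have := ENNReal.HolderConjugate.one_le q p
    rw [Ne, ENNReal.inv_eq_top]
    rintro rfl
    simp at this
  have hpq : p.toReal⁻¹ + q.toReal⁻¹ = 1 := by
    have := congrArg ENNReal.toReal (ENNReal.HolderConjugate.inv_add_inv_eq_one p q)
    rwa [ENNReal.toReal_add hpi hqi, ENNReal.toReal_inv, ENNReal.toReal_inv,
      ENNReal.toReal_one] at this
  have hq : q ≠ ⊤ := by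
    rintro rfl
    simp at hpq
    rw [hpq] at hpn
    norm_num at *
    linarith
  have hqv : q.toReal⁻¹ = 1 - p.toReal⁻¹ := by linarith
  have hqv' : q.toReal = (1 - p.toReal⁻¹)⁻¹ := by rw [← hqv, inv_inv]
  refine ⟨hq, ?_, fun h => ?_, fun h => by simp [hqv', h], ?_⟩
  · have h23 : (2 / 3 : ℝ) ≤ 1 - p.toReal⁻¹ := by linarith
    have := inv_anti₀ (by norm_num) h23
    rw [hqv']
    norm_num at this
    linarith
  · have hP : p.toReal ≠ 0 := by
      have := ENNReal.toReal_mono h hp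
      rw [ENNReal.toReal_natCast] at this
      linarith
    rw [hqv', ← one_div, show 1 - p.toReal⁻¹ = (p.toReal - 1) / p.toReal by field_simp,
      one_div_div]
  · obtain ⟨t, hti⟩ : ∃ t : ℝ≥0∞, t⁻¹ = p⁻¹ + p⁻¹ := ⟨(p⁻¹ + p⁻¹)⁻¹, inv_inv _⟩
    have htr : t.toReal⁻¹ = p.toReal⁻¹ + p.toReal⁻¹ := by
      rw [← ENNReal.toReal_inv, hti, ENNReal.toReal_add hpi hpi, ENNReal.toReal_inv]
    have hti' : t⁻¹ ≠ ⊤ := by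
      rw [hti]
      exact ENNReal.add_ne_top.2 ⟨hpi, hpi⟩
    have ht1 : 1 ≤ t := by
      rw [← ENNReal.inv_le_one, ← ENNReal.toReal_le_toReal hti' ENNReal.one_ne_top,
        ENNReal.toReal_inv, htr, ENNReal.toReal_one]
      linarith
    have hts := ENNReal.HolderConjugate.conjExponent ht1
    have hs1 := ENNReal.HolderConjugate.one_le (ENNReal.conjExponent t) t
    have hsi : (ENNReal.conjExponent t)⁻¹ ≠ ⊤ := by
      rw [Ne, ENNReal.inv_eq_top]
      intro h0
      rw [h0] at hs1
      simp at hs1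
    have hs : t.toReal⁻¹ + (ENNReal.conjExponent t).toReal⁻¹ = 1 := by
      have := congrArg ENNReal.toReal
        (ENNReal.HolderConjugate.inv_add_inv_eq_one t (ENNReal.conjExponent t))
      rwa [ENNReal.toReal_add hti' hsi, ENNReal.toReal_inv, ENNReal.toReal_inv,
        ENNReal.toReal_one] at this
    refine ⟨t, ENNReal.conjExponent t, ⟨hti.symm⟩, hts, fun h => ?_, by linarith⟩
    rw [h] at hs
    simp only [ENNReal.toReal_top, inv_zero] at hs
    linarith

end Exponents



/-! ### From charts to the manifold -/

section Globalization

variable {n : ℕ} {M : Type*} [TopologicalSpace M] [ChartedSpace (Model n) M] [IsManifold (𝓡 n) ∞ M]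
  [T2Space M] [SecondCountableTopology M]

/-- By local finiteness only finitely many members of a smooth partition of unity meet a compact
set, and these already sum to 1 on it. -/
lemma exists_finset_smooth_partition {K : Set M} (hK : IsCompact K) {U : M → Set M}
    (hU : ∀ x, IsOpen (U x)) (hxU : ∀ x, x ∈ U x) :
    ∃ (s : Finset M) (χ : M → M → ℝ), (∀ i, ContMDiff (𝓡 n) 𝓘(ℝ) ∞ (χ i)) ∧
      (∀ i x, 0 ≤ χ i x) ∧ (∀ i, tsupport (χ i) ⊆ U i) ∧ ∀ x ∈ K, ∑ i ∈ s, χ i x = 1 := by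
  have : LocallyCompactSpace M := ChartedSpace.locallyCompactSpace (Model n) M
  obtain ⟨ρ, hρ⟩ := SmoothPartitionOfUnity.exists_isSubordinate (𝓡 n) (isClosed_univ (X := M)) U hU
    fun x _ => mem_iUnion.2 ⟨x, hxU x⟩
  have hfin := ρ.locallyFinite.finite_nonempty_inter_compact hK
  refine ⟨hfin.toFinset, fun i => ρ i, fun i => (ρ i).contMDiff, fun i x => ρ.nonneg i x, hρ,
    fun x hx => ?_⟩
  rw [← ρ.sum_eq_one (mem_univ x)]
  refine (finsum_eq_sum_of_support_subset _ fun i hi => ?_).symm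
  simp only [Finite.coe_toFinset, mem_ofPred_eq]
  exact ⟨x, hi, hx⟩

variable [MeasurableSpace M] [BorelSpace M] {h : SmoothMetric n M} {g : ContMetric n M}

/-- Positivity of the curvature pairing, from its local version. -/
lemma integral_curvatureIntegrand_nonneg_of_local {p q : ℝ≥0∞} [ENNReal.HolderConjugate p q]
    (hq : q ≠ ⊤) (hg : MetricMemSobolevLoc h p g) {U : M → Set M} (hU : ∀ x, IsOpen (U x))
    (hxU : ∀ x, x ∈ U x)
    (hloc : ∀ (x : M) (v : M → ℝ) (z : OneForm n M), IsSobolevDifferential q v z →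
      HasCompactSupport v → tsupport v ⊆ U x → (∀ᵐ x ∂riemannianMeasure h.inner, 0 ≤ v x) →
      Integrable (curvatureIntegrand h g v) (riemannianMeasure h.inner) ∧
        0 ≤ ∫ x, curvatureIntegrand h g v x ∂riemannianMeasure h.inner)
    {u : M → ℝ} (hu : MemSobolevLoc n q u) (hcs : HasCompactSupport u)
    (hu0 : ∀ᵐ x ∂riemannianMeasure h.inner, 0 ≤ u x) :
    PairingDefined h g u ∧ 0 ≤ scalarCurvatureDistribution h g u := by
  obtain ⟨s, χ, hχ, hχ0, hχU, hχ1⟩ := exists_finset_smooth_partition (n := n) hcs.isCompact hU hxU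
  obtain ⟨w, hw, hwL⟩ := id hu
  have hu' : IsSobolevDifferential q u w := ⟨hw, fun e he => (hwL e he).1, fun e he => (hwL e he).2⟩
  choose z hz using fun i => hu.smooth_mul (p := p) hq (hχ i)
  have hz' : ∀ i, IsSobolevDifferential q (fun x => χ i x * u x) (z i) := fun i =>
    ⟨(hz i).1, fun e he => ((hz i).2 e he).1, fun e he => ((hz i).2 e he).2⟩
  have hsum : ∀ x, u x = ∑ i ∈ s, χ i x * u x := fun x => by
    rw [← Finset.sum_mul]
    by_cases hx : x ∈ tsupport u
    · rw [hχ1 x hx, one_mul]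
    · rw [image_eq_zero_of_notMem_tsupport hx, mul_zero]
  have hpiece := fun i => hloc i _ _ (hz' i) hcs.mul_left
    (tsupport_mul_subset_left.trans (hχU i))
    (hu0.mono fun x hx => mul_nonneg (hχ0 i x) hx)
  have hae := curvatureIntegrand_sum s hq hg hu' (fun i _ => hz' i) hsum
  refine ⟨⟨⟨_, hu'.mul_ratio hq hg⟩, ?_⟩, ?_⟩
  · exact (integrable_finsetSum s fun i _ => (hpiece i).1).congr (hae.mono fun x hx => hx.symm)
  · rw [scalarCurvatureDistribution, integral_congr_ae hae,
      integral_finsetSum s fun i _ => (hpiece i).1]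
    exact Finset.sum_nonneg fun i _ => (hpiece i).2

end Globalization

end RoughMetric

end

theorem mainTheorem6 {n : ℕ} (hn : 3 ≤ n)
    {M : Type*} [TopologicalSpace M] [ChartedSpace (RoughMetric.Model n) M]
    [IsManifold (𝓡 n) ∞ M] [T2Space M] [SecondCountableTopology M]
    [MeasurableSpace M] [BorelSpace M]
    (h : RoughMetric.SmoothMetric n M) (g : RoughMetric.ContMetric n M)
    (p : ℝ≥0∞) (hp : (n : ℝ≥0∞) ≤ p)
    (hg : RoughMetric.MetricMemSobolevLoc h p g)
    (S : Set M) (hS : IsClosed S)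
    (hgS : RoughMetric.SmoothMetricOn g Sᶜ)
    (hfin : p ≠ ⊤ →
      RoughMetric.hausdorffMeasure g ((n : ℝ) - p.toReal / (p.toReal - 1)) S < ⊤)
    (hzero : p = ⊤ → RoughMetric.hausdorffMeasure g ((n : ℝ) - 1) S = 0)
    (hR : ∀ x ∈ Sᶜ, 0 ≤ RoughMetric.scalarCurvature g.inner x)
    (u : M → ℝ) (hu : RoughMetric.MemSobolevLoc n (ENNReal.conjExponent p) u)
    (hcs : HasCompactSupport u)
    (hu0 : ∀ᵐ x ∂(RoughMetric.riemannianMeasure h.inner), 0 ≤ u x) :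
    RoughMetric.PairingDefined h g u ∧
      0 ≤ RoughMetric.scalarCurvatureDistribution h g u := by
  have hn1 : 1 ≤ p := le_trans (by exact_mod_cast (by omega : 1 ≤ n)) hp
  have := ENNReal.HolderConjugate.conjExponent hn1
  obtain ⟨hq, hqn, hq1, hq2, t, s, _, _, hs, hqs⟩ :=
    RoughMetric.exists_holder_exponents hn (q := ENNReal.conjExponent p) hp
  -- Positivity is localised to neighbourhoods on which the preferred chart is Lipschitz, so that
  -- the hypothesis on Σ becomes one on its coordinate image in Euclidean space.
  choose C U hU hxU hUs hC using fun x : M => RoughMetric.exists_hausdorffMeasure_chart_image_le g x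
  have hd : (0 : ℝ) ≤ n - (ENNReal.conjExponent p).toReal := by linarith
  refine RoughMetric.integral_curvatureIntegrand_nonneg_of_local (p := p) hq hg hU hxU
    (fun x v z hv hvc hvU hv0 => ?_) hu hcs hu0
  have he := chart_mem_atlas (RoughMetric.Model n) x
  refine hv.integral_curvatureIntegrand_nonneg (p := p) t hq hs hqn hqs hg he (hU x) (hUs x)
    (fun φ hφ hφc hφs hφ0 => ?_) hvc hvU hv0
  refine RoughMetric.chart_test_nonneg_of_hausdorff (p := p) (s := s) t hq hs hqn hg hS hgS hR he
    (hU x) (hUs x) (fun hpt => ?_) (fun hpt => ?_) hφ hφc hφs hφ0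
  · refine ((hC x _ hd S).trans_lt (ENNReal.mul_lt_top ?_ ?_)).ne
    · exact ENNReal.rpow_lt_top_of_nonneg hd ENNReal.coe_ne_top
    · rw [hq1 hpt]
      exact hfin hpt
  · refine le_antisymm ((hC x _ hd S).trans ?_) zero_le
    rw [hq2 hpt, hzero hpt, mul_zero]
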